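/- For $f\in L^2(\mathbb R)$ let $\widehat f(\xi)=\int_{\mathbb R}e^{-ix\xi}f(x)\,dx$ be its Fourier transform, and let $$[\widetilde E_5]f(t,x)=\frac1{2\pi}\int_{\mathbb R}|\xi+\xi^3|^{1/6}\,e^{ix\xi+it(\xi^3+\xi^5)}\,\widehat f(\xi)\,d\xi ,\qquad (t,x)\in\mathbb R^2,$$ be the Fourier extension operator of the curve $(\xi,\xi^3+\xi^5)$, where for general $f\in L^2(\mathbb R)$ the integral is understood as the limit in $L^6_{t,x}(\mathbb R^2)$, as $R\to\infty$, of the absolutely convergent integrals over $|\xi|<R$. Let $\mathcal D$ be the set of all dyadic intervals $\tau=[k,k+1)2^j$ with $k,j\in\mathbb Z$; write $|\tau|$ for the length and $c_\tau$ for the center of $\tau$, and let $f_\tau\in L^2(\mathbb R)$ be given by $\widehat{f_\tau}=\mathbf 1_\tau\widehat f$. Then there are $\theta\in(0,1)$ and a constant $C<\infty$ such that for all $f\in L^2(\mathbb R)$ the function $[\widetilde E_5]f\in L^6_{t,x}(\mathbb R^2)$ exists and $$\big\|[\widetilde E_5]f\big\|_{L^6_{t,x}(\mathbb R^2)}\le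 C\Big[\sup_{\tau\in\mathcal D}|c_\tau+c_\tau^3|^{-1/6}\,|\tau|^{-1/2}\,\big\|[\widetilde E_5]f_\tau\big\|_{L^\infty_{t,x}(\mathbb R^2)}\Big]^{\theta}\,\|f\|_{L^2(\mathbb R)}^{1-\theta}.$$ -/

import Mathlib

open MeasureTheory Filter Topology FourierTransform
open scoped ENNReal NNReal

noncomputable section

namespace RefinedStrichartz

/-- The space `L²(ℝ)` of complex-valued square-integrable functions. -/
abbrev L2 : Type := Lp ℂ 2 (volume : Measure ℝ)

/-- The Fourier transform in angular frequency, `f̂(ξ) = ∫ e^{-ixξ} f(x) dx`, of `f ∈ L²(ℝ)`.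
Mathlib's `𝓕` is the extension to `L²` of `f ↦ ∫ e^{-2πixζ} f(x) dx`, so `f̂(ξ) = 𝓕 f (ξ / 2π)`. -/
def hat (f : L2) (ξ : ℝ) : ℂ :=
  (𝓕 f : L2) (ξ / (2 * Real.pi))

/-- The frequency localization of `f ∈ L²(ℝ)` to the interval `[a, b)`: the function whose
Fourier transform `f̂` is cut off to `[a, b)`.  The angular frequency of `ζ` is `2πζ`. -/
def freqCut (a b : ℝ) (f : L2) : L2 :=
  𝓕⁻ (MemLp.toLp _ ((Lp.memLp (𝓕 f : L2)).indicator
    (s := (fun ζ : ℝ => 2 * Real.pi * ζ) ⁻¹' Set.Ico a b)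
    ((measurable_const_mul (2 * Real.pi)) measurableSet_Ico)) : L2)

/-- The Fourier transform of `freqCut a b f` is `f̂` on `[a, b)` and `0` elsewhere. -/
theorem hat_freqCut (a b : ℝ) (f : L2) :
    hat (freqCut a b f) =ᵐ[volume] (Set.Ico a b).indicator (hat f) := by
  have hpi : (2 * Real.pi) ≠ 0 := by positivity
  have hq : Measure.QuasiMeasurePreserving (fun ξ : ℝ => ξ / (2 * Real.pi)) volume volume := by
    refine ⟨by fun_prop, ?_⟩
    have : (fun ξ : ℝ => ξ / (2 * Real.pi)) = fun ξ => (2 * Real.pi)⁻¹ * ξ := by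
      funext ξ; rw [div_eq_inv_mul]
    rw [this, Real.map_volume_mul_left (inv_ne_zero hpi)]
    exact Measure.smul_absolutelyContinuous
  have h1 : (𝓕 (freqCut a b f) : L2) =ᵐ[volume]
      ((fun ζ : ℝ => 2 * Real.pi * ζ) ⁻¹' Set.Ico a b).indicator (𝓕 f : L2) := by
    unfold freqCut
    rw [FourierTransform.fourier_fourierInv_eq]
    exact MemLp.coeFn_toLp _
  have h2 := hq.ae_eq_comp h1
  filter_upwards [h2] with ξ hξ
  simp only [Function.comp] at hξ
  rw [hat, hξ]
  have : 2 * Real.pi * (ξ / (2 * Real.pi)) = ξ := by field_simp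
  by_cases h : ξ ∈ Set.Ico a b
  · rw [Set.indicator_of_mem h, Set.indicator_of_mem (by simpa [this] using h)]; rfl
  · rw [Set.indicator_of_notMem h, Set.indicator_of_notMem (by simpa [this] using h)]

/-- The oscillatory integral of the Fourier extension operator for the curve `(ξ, ξ³ + ξ⁵)`, at
the space-time point `p = (t, x)`:
`(1/2π) ∫ |ξ + ξ³|^{1/6} e^{ixξ + it(ξ³ + ξ⁵)} f̂(ξ) dξ`.
It converges absolutely whenever `f̂` has bounded support. -/
def extIntegral (f : L2) (p : ℝ × ℝ) : ℂ :=
  (1 / (2 * Real.pi) : ℂ) * ∫ ξ : ℝ, ((|ξ + ξ ^ 3| ^ (1 / 6 : ℝ) : ℝ) : ℂ) *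
    Complex.exp (Complex.I * ((p.2 * ξ + p.1 * (ξ ^ 3 + ξ ^ 5) : ℝ) : ℂ)) * hat f ξ

/-- `F` is the function `Ẽ₅ f ∈ L⁶(ℝ²)`.  For a general `f ∈ L²(ℝ)` the oscillatory integral does
not converge absolutely, and it is understood as the limit in `L⁶_{t,x}(ℝ²)`, as `R → ∞`, of the
absolutely convergent integrals over `|ξ| < R`.  Such an `F` is unique almost everywhere. -/
def IsExtension (f : L2) (F : ℝ × ℝ → ℂ) : Prop :=
  MemLp F 6 volume ∧
    Tendsto (fun R : ℝ => eLpNorm (extIntegral (freqCut (-R) R f) - F) 6 volume) atTop (𝓝 0)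

/-- The dyadic interval `[k, k + 1) 2^j` with `k, j ∈ ℤ`. -/
structure DyadicInterval where
  /-- the position -/
  k : ℤ
  /-- the scale -/
  j : ℤ

namespace DyadicInterval

/-- The left end point `k 2^j`. -/
def left (τ : DyadicInterval) : ℝ := τ.k * (2 : ℝ) ^ τ.j

/-- The right end point `(k + 1) 2^j`. -/
def right (τ : DyadicInterval) : ℝ := (τ.k + 1) * (2 : ℝ) ^ τ.j

/-- The length `|τ|`. -/
def length (τ : DyadicInterval) : ℝ := τ.right - τ.left

/-- The center `c_τ`; it is never `0`. -/
def center (τ : DyadicInterval) : ℝ := (τ.left + τ.right) / 2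

end DyadicInterval

/-- The piece `f_τ` of `f`, whose Fourier transform is `f̂` cut off to `τ`. -/
def piece (f : L2) (τ : DyadicInterval) : L2 := freqCut τ.left τ.right f

/-- `sup_τ |c_τ + c_τ³|^{-1/6} |τ|^{-1/2} ‖Ẽ₅ f_τ‖_{L^∞(ℝ²)}` over all dyadic intervals. -/
def dyadicSup (f : L2) : ℝ≥0∞ :=
  ⨆ τ : DyadicInterval,
    ENNReal.ofReal (|τ.center + τ.center ^ 3| ^ (-(1 / 6) : ℝ) * τ.length ^ (-(1 / 2) : ℝ)) *
      eLpNorm (extIntegral (piece f τ)) ∞ volume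

end RefinedStrichartz

end

/-! Write `w(ξ) = |ξ + ξ³|^{1/6}` and let `E u` be the extension of `w u` from the curve. For `u`
supported on `(0, ∞)`, `(E u)²` is twice an extension over the pairs `0 < ξ < η` under the sum map
`(ξ, η) ↦ γ(ξ) + γ(η)`, so the `L⁶` norm of `E u` is governed by an `L³` norm of a bilinear object.
The sum map is injective with Jacobian `J ≥ (η - ξ) w(η)⁶`. The weight `w` is made to cancel this
factor: Hausdorff–Young from `L^{3/2}` to `L³` leaves `∬ |u(ξ) u(η)|^{3/2} |ξ - η|^{-1/2}`, which
the Hardy–Littlewood–Sobolev inequality would bound by `‖u‖₂³`.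

The refinement comes from asking when that last bound is lossy. Cut the pairs into Whitney squares
of side `2^j` near the diagonal, and normalize `‖u‖₂ ≤ 1`. Pairs where `|u(ξ)|` or `|u(η)|` is not
within a factor `K = L⁴` of `2^{-j/2}` contribute only `O(1/L)` to the double integral
(`lintegral_rest_le`). On the remaining pairs the extension from each Whitney square is a product of
extensions from two dyadic intervals, which the supremum bounds in `L^∞`. Interpolating square by
square with Plancherel (`lintegral_oscInt_cube_le_partition`), the sum over squares is controlled by
the `L²` mass of the relevant part of `u`; each frequency is relevant at only `O(log K)` scales, so
the sum costs a logarithm times the supremum (`lintegral_oscInt_midPairs_le`). With the supremum of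
size `L^{-4}`, both parts give `‖E u‖₆⁶ ≲ L^{-2}`, that is, `θ = 1/12`.

Both endpoint inequalities (Hausdorff–Young and its version for partitions) follow from
`lintegral_oscInt_cube_le`: a layer-cake argument that splits the density at a level depending on
the point, with Plancherel for one part and the trivial `L^∞` bound for the other. Negative
frequencies are handled by reflection, and a general `f` by the cut-offs to `[-2^m, 2^m)`, which
respect the dyadic structure. -/

noncomputable section

namespace RefinedStrichartz

/-! ### Plancherel for extension operators of parametrized measures in the plane. -/

/-- The Fourier transform of a Gaussian on `ℝ²`. -/
theorem integral_char_mul_gaussian {ε : ℝ} (hε : 0 < ε) (y : ℝ × ℝ) :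
    ∫ p : ℝ × ℝ, Complex.exp (Complex.I * ((p.1 * y.1 + p.2 * y.2 : ℝ) : ℂ)) *
        ((Real.exp (-ε * (p.1 ^ 2 + p.2 ^ 2)) : ℝ) : ℂ) =
      ((Real.pi / ε * Real.exp (-(y.1 ^ 2 + y.2 ^ 2) / (4 * ε)) : ℝ) : ℂ) := by
  have h1 (t : ℝ) : ∫ x : ℝ, Complex.exp (Complex.I * t * x) * Complex.exp (-(ε : ℂ) * x ^ 2) =
      ((Real.sqrt (Real.pi / ε) * Real.exp (-t ^ 2 / (4 * ε)) : ℝ) : ℂ) := by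
    rw [fourierIntegral_gaussian (by simpa using hε)]
    rw [Real.sqrt_eq_rpow]
    push_cast [Complex.ofReal_cpow (by positivity : 0 ≤ Real.pi / ε)]
    norm_num
  have h2 : (fun p : ℝ × ℝ => Complex.exp (Complex.I * ((p.1 * y.1 + p.2 * y.2 : ℝ) : ℂ)) *
        ((Real.exp (-ε * (p.1 ^ 2 + p.2 ^ 2)) : ℝ) : ℂ)) = fun p =>
      (Complex.exp (Complex.I * y.1 * p.1) * Complex.exp (-(ε : ℂ) * p.1 ^ 2)) *
      (Complex.exp (Complex.I * y.2 * p.2) * Complex.exp (-(ε : ℂ) * p.2 ^ 2)) := by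
    funext p
    push_cast
    simp only [← Complex.exp_add]
    congr 1
    ring
  rw [h2, Measure.volume_eq_prod, integral_prod_mul
    (fun x : ℝ => Complex.exp (Complex.I * y.1 * x) * Complex.exp (-(ε : ℂ) * x ^ 2))
    (fun x : ℝ => Complex.exp (Complex.I * y.2 * x) * Complex.exp (-(ε : ℂ) * x ^ 2)), h1, h1,
    ← Complex.ofReal_mul]
  congr 1
  have h3 : Real.sqrt (Real.pi / ε) * Real.sqrt (Real.pi / ε) = Real.pi / ε :=
    Real.mul_self_sqrt (by positivity)
  rw [mul_mul_mul_comm, h3, ← Real.exp_add]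
  congr 2
  ring

theorem lintegral_gaussian_prod {b : ℝ} (hb : 0 < b) :
    ∫⁻ p : ℝ × ℝ, ENNReal.ofReal (Real.exp (-b * (p.1 ^ 2 + p.2 ^ 2))) =
      ENNReal.ofReal (Real.pi / b) := by
  have h1 : ∫⁻ x : ℝ, ENNReal.ofReal (Real.exp (-b * x ^ 2)) =
      ENNReal.ofReal (Real.sqrt (Real.pi / b)) := by
    rw [← ofReal_integral_eq_lintegral_ofReal (integrable_exp_neg_mul_sq hb)
      (ae_of_all _ fun _ => (Real.exp_pos _).le), integral_gaussian]
  have h2 : (fun p : ℝ × ℝ => ENNReal.ofReal (Real.exp (-b * (p.1 ^ 2 + p.2 ^ 2)))) = fun p =>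
      ENNReal.ofReal (Real.exp (-b * p.1 ^ 2)) * ENNReal.ofReal (Real.exp (-b * p.2 ^ 2)) := by
    funext p
    rw [← ENNReal.ofReal_mul (Real.exp_pos _).le, ← Real.exp_add]
    congr 2
    ring
  rw [h2, Measure.volume_eq_prod, lintegral_prod_mul
    (f := fun x : ℝ => ENNReal.ofReal (Real.exp (-b * x ^ 2)))
    (g := fun x : ℝ => ENNReal.ofReal (Real.exp (-b * x ^ 2))) (by fun_prop) (by fun_prop), h1,
    ← ENNReal.ofReal_mul (Real.sqrt_nonneg _), Real.mul_self_sqrt (by positivity)]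

section Oscillatory

variable {X : Type*} [MeasurableSpace X]

/-- The extension operator `h ↦ ∫ e^{i p·Φ(z)} h(z) dμ(z)` of a parametrized measure in `ℝ²`. -/
def oscInt (μ : Measure X) (Φ : X → ℝ × ℝ) (h : X → ℂ) (p : ℝ × ℝ) : ℂ :=
  ∫ z, Complex.exp (Complex.I * ((p.1 * (Φ z).1 + p.2 * (Φ z).2 : ℝ) : ℂ)) * h z ∂μ

theorem norm_exp_I_mul_ofReal (x : ℝ) : ‖Complex.exp (Complex.I * (x : ℂ))‖ = 1 := by
  rw [mul_comm, Complex.norm_exp_ofReal_mul_I]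

theorem measurable_char {Φ : X → ℝ × ℝ} (hΦ : Measurable Φ) (p : ℝ × ℝ) :
    Measurable fun z =>
      Complex.exp (Complex.I * ((p.1 * (Φ z).1 + p.2 * (Φ z).2 : ℝ) : ℂ)) := by
  fun_prop

theorem integrable_char_mul {μ : Measure X} {Φ : X → ℝ × ℝ} (hΦ : Measurable Φ) {h : X → ℂ}
    (hh : Integrable h μ) (p : ℝ × ℝ) :
    Integrable (fun z =>
      Complex.exp (Complex.I * ((p.1 * (Φ z).1 + p.2 * (Φ z).2 : ℝ) : ℂ)) * h z) μ := by
  refine hh.bdd_mul (c := 1) (measurable_char hΦ p).aestronglyMeasurable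
    (ae_of_all _ fun z => (norm_exp_I_mul_ofReal _).le)

theorem continuous_oscInt {μ : Measure X} {Φ : X → ℝ × ℝ} (hΦ : Measurable Φ) {h : X → ℂ}
    (hh : Integrable h μ) : Continuous (oscInt μ Φ h) := by
  refine continuous_of_dominated (bound := fun z => ‖h z‖)
    (fun p => (integrable_char_mul hΦ hh p).aestronglyMeasurable)
    (fun p => ae_of_all _ fun z => ?_) hh.norm (ae_of_all _ fun z => by fun_prop)
  rw [norm_mul, norm_exp_I_mul_ofReal, one_mul]

/-- AM–GM with weights `j'/j` and `j/j'`. In the Schur test each term then has the Jacobian `J` in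
one variable, ready for the change of variables, and `|h|² / J` in the other. -/
theorem two_mul_le_weighted (a b : ℝ≥0) {j j' : ℝ} (hj : 0 < j) (hj' : 0 < j') :
    2 * ((a : ℝ≥0∞) * b) ≤ (a : ℝ≥0∞) ^ 2 / ENNReal.ofReal j * ENNReal.ofReal j' +
      (b : ℝ≥0∞) ^ 2 / ENNReal.ofReal j' * ENNReal.ofReal j := by
  lift j to ℝ≥0 using hj.le
  lift j' to ℝ≥0 using hj'.le
  have hj0 : j ≠ 0 := by rintro rfl; simp at hj
  have hj0' : j' ≠ 0 := by rintro rfl; simp at hj'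
  simp only [ENNReal.ofReal_coe_nnreal]
  rw [← ENNReal.coe_pow, ← ENNReal.coe_pow, ← ENNReal.coe_div hj0, ← ENNReal.coe_div hj0']
  norm_cast
  rw [← NNReal.coe_le_coe]
  push_cast
  have : (a : ℝ) ^ 2 / j * j' + b ^ 2 / j' * j - 2 * (a * b) =
      (a * j' - b * j) ^ 2 / (j * j') := by field_simp; ring
  have h2 : 0 ≤ ((a : ℝ) * j' - b * j) ^ 2 / (j * j') := by positivity
  linarith

variable {μ : Measure X} [SFinite μ] {Φ : X → ℝ × ℝ} {J : X → ℝ}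

/-- A Schur test for the Gaussian-regularized kernel. -/
theorem lintegral_schur (hΦ : Measurable Φ) (hJm : Measurable J) (hJ : ∀ᵐ z ∂μ, 0 < J z)
    (hΦJ : ∀ G : ℝ × ℝ → ℝ≥0∞, Measurable G →
      ∫⁻ z, ENNReal.ofReal (J z) * G (Φ z) ∂μ ≤ ∫⁻ y, G y)
    {h : X → ℂ} (hh : AEStronglyMeasurable h μ) {k : ℝ × ℝ → ℝ≥0∞} (hk : Measurable k)
    (hsymm : ∀ y, k (-y) = k y) :
    ∫⁻ z, ∫⁻ z', ‖h z‖ₑ * ‖h z'‖ₑ * k (Φ z - Φ z') ∂μ ∂μ ≤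
      (∫⁻ y, k y) * ∫⁻ z, ‖h z‖ₑ ^ 2 / ENNReal.ofReal (J z) ∂μ := by
  set S := ∫⁻ z, ∫⁻ z', (‖h z‖ₑ ^ 2 / ENNReal.ofReal (J z) * ENNReal.ofReal (J z')) *
    k (Φ z - Φ z') ∂μ ∂μ with hS
  have hSle : S ≤ (∫⁻ y, k y) * ∫⁻ z, ‖h z‖ₑ ^ 2 / ENNReal.ofReal (J z) ∂μ := by
    have h1 (z : X) : ∫⁻ z', (‖h z‖ₑ ^ 2 / ENNReal.ofReal (J z) * ENNReal.ofReal (J z')) *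
        k (Φ z - Φ z') ∂μ ≤ (∫⁻ y, k y) * (‖h z‖ₑ ^ 2 / ENNReal.ofReal (J z)) := by
      simp_rw [mul_assoc]
      rw [lintegral_const_mul _ (by fun_prop), mul_comm]
      gcongr
      refine (hΦJ (fun y => k (Φ z - y)) (by fun_prop)).trans ?_
      rw [lintegral_sub_left_eq_self k (Φ z)]
    calc S ≤ ∫⁻ z, (∫⁻ y, k y) * (‖h z‖ₑ ^ 2 / ENNReal.ofReal (J z)) ∂μ := lintegral_mono h1
      _ = _ := lintegral_const_mul'' _ (by fun_prop)
  have hm : AEMeasurable (fun q : X × X => (‖h q.1‖ₑ ^ 2 / ENNReal.ofReal (J q.1) *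
      ENNReal.ofReal (J q.2)) * k (Φ q.1 - Φ q.2)) (μ.prod μ) := by
    have := hh.comp_fst (ν := μ)
    fun_prop
  have hswap : ∫⁻ z, ∫⁻ z', (‖h z'‖ₑ ^ 2 / ENNReal.ofReal (J z') * ENNReal.ofReal (J z)) *
      k (Φ z - Φ z') ∂μ ∂μ = S := by
    rw [hS]
    symm
    rw [lintegral_lintegral_swap (by exact hm)]
    refine lintegral_congr fun z => lintegral_congr fun z' => ?_
    rw [← hsymm (Φ z' - Φ z), neg_sub]
  have h2 : 2 * ∫⁻ z, ∫⁻ z', ‖h z‖ₑ * ‖h z'‖ₑ * k (Φ z - Φ z') ∂μ ∂μ ≤ S + S := by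
    nth_rewrite 2 [← hswap]
    rw [hS, ← lintegral_add_left' (AEMeasurable.lintegral_prod_right' hm),
      ← lintegral_const_mul' _ _ (by simp)]
    refine lintegral_mono_ae ?_
    filter_upwards [hJ] with z hz
    have hm2 : AEMeasurable (fun z' => (‖h z‖ₑ ^ 2 / ENNReal.ofReal (J z) * ENNReal.ofReal (J z')) *
        k (Φ z - Φ z')) μ := by fun_prop
    rw [← lintegral_add_left' hm2, ← lintegral_const_mul' _ _ (by simp)]
    refine lintegral_mono_ae ?_
    filter_upwards [hJ] with z' hz'
    rw [← mul_assoc, ← add_mul]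
    gcongr
    exact two_mul_le_weighted ‖h z‖₊ ‖h z'‖₊ hz hz'
  rw [← two_mul] at h2
  exact ((ENNReal.mul_le_mul_iff_right (by simp) (by simp)).1 h2).trans hSle

/-- The Plancherel inequality with a Gaussian weight. -/
theorem lintegral_oscInt_gaussian_le (hΦ : Measurable Φ) (hJm : Measurable J)
    (hJ : ∀ᵐ z ∂μ, 0 < J z)
    (hΦJ : ∀ G : ℝ × ℝ → ℝ≥0∞, Measurable G →
      ∫⁻ z, ENNReal.ofReal (J z) * G (Φ z) ∂μ ≤ ∫⁻ y, G y)
    {h : X → ℂ} (hh : Integrable h μ) {ε : ℝ} (hε : 0 < ε) :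
    ∫⁻ p, ‖oscInt μ Φ h p‖ₑ ^ 2 * ENNReal.ofReal (Real.exp (-ε * (p.1 ^ 2 + p.2 ^ 2))) ≤
      ENNReal.ofReal ((2 * Real.pi) ^ 2) * ∫⁻ z, ‖h z‖ₑ ^ 2 / ENNReal.ofReal (J z) ∂μ := by
  set g : ℝ × ℝ → ℝ := fun p => Real.exp (-ε * (p.1 ^ 2 + p.2 ^ 2)) with hg
  set k : ℝ × ℝ → ℝ≥0∞ := fun y =>
    ENNReal.ofReal (Real.pi / ε * Real.exp (-(y.1 ^ 2 + y.2 ^ 2) / (4 * ε))) with hk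
  have hgi : Integrable g := by
    refine ⟨by fun_prop, ?_⟩
    rw [hasFiniteIntegral_iff_ofReal (ae_of_all _ fun _ => (Real.exp_pos _).le),
      lintegral_gaussian_prod hε]
    exact ENNReal.ofReal_lt_top
  -- The transformed Gaussian has the same mass for every `ε`; this makes the final bound uniform in
  -- `ε`.
  have hkint : ∫⁻ y, k y = ENNReal.ofReal ((2 * Real.pi) ^ 2) := by
    have h1 : k = fun y => ENNReal.ofReal (Real.pi / ε) *
        ENNReal.ofReal (Real.exp (-(1 / (4 * ε)) * (y.1 ^ 2 + y.2 ^ 2))) := by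
      funext y
      rw [hk, ← ENNReal.ofReal_mul (by positivity)]
      ring_nf
    rw [h1, lintegral_const_mul _ (by fun_prop), lintegral_gaussian_prod (by positivity),
      ← ENNReal.ofReal_mul (by positivity)]
    congr 1
    field_simp
    ring
  rw [← hkint]
  refine le_trans ?_ (lintegral_schur hΦ hJm hJ hΦJ hh.aestronglyMeasurable (k := k)
    (by fun_prop) (fun y => by simp [hk]))
  let e : ℝ × ℝ → X → ℂ := fun p z =>
    Complex.exp (Complex.I * ((p.1 * (Φ z).1 + p.2 * (Φ z).2 : ℝ) : ℂ))
  -- The square is a double integral with phase `p · (Φ z - Φ z')`; by Fubini the `p`-integral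
  -- becomes the positive kernel `k (Φ z - Φ z')`, to which the Schur test applies.
  have hsq (p : ℝ × ℝ) : ((‖oscInt μ Φ h p‖ ^ 2 * g p : ℝ) : ℂ) =
      ∫ q : X × X, Complex.exp (Complex.I * ((p.1 * (Φ q.1 - Φ q.2).1 +
        p.2 * (Φ q.1 - Φ q.2).2 : ℝ) : ℂ)) * (g p : ℂ) *
        (h q.1 * (starRingEnd ℂ) (h q.2)) ∂(μ.prod μ) := by
    have h1 : ((‖oscInt μ Φ h p‖ ^ 2 : ℝ) : ℂ) =
        ∫ q : X × X, (e p q.1 * h q.1) * (starRingEnd ℂ) (e p q.2 * h q.2) ∂(μ.prod μ) := by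
      rw [integral_prod_mul (fun z => e p z * h z) (fun z => (starRingEnd ℂ) (e p z * h z)),
        integral_conj, Complex.mul_conj, Complex.normSq_eq_norm_sq]
      rfl
    rw [Complex.ofReal_mul, h1, ← integral_mul_const]
    refine integral_congr_ae (ae_of_all _ fun q => ?_)
    have h2 : (starRingEnd ℂ) (e p q.2) = Complex.exp (-(Complex.I * ((p.1 * (Φ q.2).1 +
        p.2 * (Φ q.2).2 : ℝ) : ℂ))) := by
      simp only [e, ← Complex.exp_conj, map_mul, Complex.conj_I, Complex.conj_ofReal, neg_mul]
    have h3 : Complex.exp (Complex.I * ((p.1 * (Φ q.1 - Φ q.2).1 +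
        p.2 * (Φ q.1 - Φ q.2).2 : ℝ) : ℂ)) = e p q.1 * (starRingEnd ℂ) (e p q.2) := by
      rw [h2, ← Complex.exp_add]
      congr 1
      simp only [Prod.fst_sub, Prod.snd_sub]
      push_cast
      ring
    simp only [h3, map_mul]
    ring
  have hHi : Integrable (fun q : X × X => h q.1 * (starRingEnd ℂ) (h q.2)) (μ.prod μ) :=
    hh.mul_prod ((Complex.conjCLE : ℂ →L[ℝ] ℂ).integrable_comp hh)
  have hbig : Integrable (Function.uncurry fun (p : ℝ × ℝ) (q : X × X) =>
      Complex.exp (Complex.I * ((p.1 * (Φ q.1 - Φ q.2).1 +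
        p.2 * (Φ q.1 - Φ q.2).2 : ℝ) : ℂ)) * (g p : ℂ) *
        (h q.1 * (starRingEnd ℂ) (h q.2))) (volume.prod (μ.prod μ)) := by
    have h1 := (hgi.ofReal (𝕜 := ℂ)).mul_prod hHi
    refine (h1.bdd_mul (c := 1) (f := fun r : (ℝ × ℝ) × (X × X) => Complex.exp (Complex.I *
      ((r.1.1 * (Φ r.2.1 - Φ r.2.2).1 + r.1.2 * (Φ r.2.1 - Φ r.2.2).2 : ℝ) : ℂ)))
      ?_ (ae_of_all _ fun z => (norm_exp_I_mul_ofReal _).le)).congr (ae_of_all _ fun r => ?_)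
    · refine Measurable.aestronglyMeasurable ?_
      fun_prop
    · simp only [Function.uncurry]
      rw [mul_assoc]
      rfl
  have hmain : ((∫ p, ‖oscInt μ Φ h p‖ ^ 2 * g p : ℝ) : ℂ) =
      ∫ q : X × X, ((Real.pi / ε * Real.exp (-((Φ q.1 - Φ q.2).1 ^ 2 +
        (Φ q.1 - Φ q.2).2 ^ 2) / (4 * ε)) : ℝ) : ℂ) *
        (h q.1 * (starRingEnd ℂ) (h q.2)) ∂(μ.prod μ) := by
    rw [← integral_complex_ofReal]
    simp_rw [hsq]
    rw [integral_integral_swap hbig]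
    refine integral_congr_ae (ae_of_all _ fun q => ?_)
    simp only
    rw [integral_mul_const, hg, integral_char_mul_gaussian hε]
  have hsqi : Integrable (fun p => ‖oscInt μ Φ h p‖ ^ 2 * g p) := by
    refine hgi.bdd_mul (c := (∫ z, ‖h z‖ ∂μ) ^ 2)
      ((continuous_oscInt hΦ hh).norm.pow 2).aestronglyMeasurable (ae_of_all _ fun p => ?_)
    rw [Real.norm_of_nonneg (by positivity)]
    gcongr
    refine (norm_integral_le_integral_norm _).trans_eq ?_
    simp_rw [norm_mul, norm_exp_I_mul_ofReal, one_mul]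
  have hlhs : ∫⁻ p, ‖oscInt μ Φ h p‖ₑ ^ 2 * ENNReal.ofReal (g p) =
      ‖((∫ p, ‖oscInt μ Φ h p‖ ^ 2 * g p : ℝ) : ℂ)‖ₑ := by
    have h0 : 0 ≤ ∫ p, ‖oscInt μ Φ h p‖ ^ 2 * g p :=
      integral_nonneg fun p => mul_nonneg (by positivity) (Real.exp_pos _).le
    rw [← ofReal_norm, Complex.norm_real, Real.norm_of_nonneg h0,
      ofReal_integral_eq_lintegral_ofReal hsqi
        (ae_of_all _ fun p => mul_nonneg (by positivity) (Real.exp_pos _).le)]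
    refine lintegral_congr fun p => ?_
    rw [ENNReal.ofReal_mul (by positivity), ENNReal.ofReal_pow (norm_nonneg _),
      ofReal_norm]
  rw [hlhs, hmain]
  refine (enorm_integral_le_lintegral_enorm _).trans ?_
  have hm : AEMeasurable (fun q : X × X => ‖h q.1‖ₑ * ‖h q.2‖ₑ * k (Φ q.1 - Φ q.2))
      (μ.prod μ) := by
    have h1 := hh.aestronglyMeasurable.comp_fst (ν := μ)
    have h2 := hh.aestronglyMeasurable.comp_snd (μ := μ)
    fun_prop
  rw [← lintegral_prod _ hm]
  refine lintegral_mono fun q => le_of_eq ?_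
  rw [enorm_mul, enorm_mul, hk, mul_comm, ← ofReal_norm (((Real.pi / ε * _ : ℝ)) : ℂ),
    Complex.norm_real, Real.norm_of_nonneg (by positivity)]
  simp [enorm_eq_nnnorm]

/-- The measure `J dμ` is mapped by `Φ` to a measure dominated by Lebesgue measure on `ℝ²`. -/
structure IsDominatedParam (μ : Measure X) (Φ : X → ℝ × ℝ) (J : X → ℝ) : Prop where
  measurable : Measurable Φ
  measurable_weight : Measurable J
  weight_pos : ∀ᵐ z ∂μ, 0 < J z
  lintegral_le : ∀ G : ℝ × ℝ → ℝ≥0∞, Measurable G →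
    ∫⁻ z, ENNReal.ofReal (J z) * G (Φ z) ∂μ ≤ ∫⁻ y, G y

/-- The Plancherel inequality `∫ |Th|² ≤ (2π)² ∫ |h|² / J`, where `J dμ` is mapped by `Φ` to a
measure dominated by Lebesgue measure. -/
theorem lintegral_oscInt_sq_le (H : IsDominatedParam μ Φ J) {h : X → ℂ} (hh : Integrable h μ) :
    ∫⁻ p, ‖oscInt μ Φ h p‖ₑ ^ 2 ≤
      ENNReal.ofReal ((2 * Real.pi) ^ 2) * ∫⁻ z, ‖h z‖ₑ ^ 2 / ENNReal.ofReal (J z) ∂μ := by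
  obtain ⟨hΦ, hJm, hJ, hΦJ⟩ := H
  have hc := continuous_oscInt hΦ hh
  -- The Gaussian weights tend to `1` pointwise, so Fatou's lemma removes them.
  have hlim (p : ℝ × ℝ) : Tendsto (fun n : ℕ => ‖oscInt μ Φ h p‖ₑ ^ 2 *
      ENNReal.ofReal (Real.exp (-(1 / ((n : ℝ) + 1)) * (p.1 ^ 2 + p.2 ^ 2)))) atTop
      (𝓝 (‖oscInt μ Φ h p‖ₑ ^ 2)) := by
    have h1 : Tendsto (fun n : ℕ => Real.exp (-(1 / ((n : ℝ) + 1)) * (p.1 ^ 2 + p.2 ^ 2))) atTop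
        (𝓝 1) := by
      have h2 := ((tendsto_one_div_add_atTop_nhds_zero_nat (𝕜 := ℝ)).neg.mul_const
        (p.1 ^ 2 + p.2 ^ 2)).rexp
      simpa using h2
    have h3 := ENNReal.Tendsto.const_mul (a := ‖oscInt μ Φ h p‖ₑ ^ 2)
      (ENNReal.tendsto_ofReal h1) (Or.inl (by simp))
    simpa using h3
  calc ∫⁻ p, ‖oscInt μ Φ h p‖ₑ ^ 2 = ∫⁻ p, liminf (fun n : ℕ => ‖oscInt μ Φ h p‖ₑ ^ 2 *
      ENNReal.ofReal (Real.exp (-(1 / ((n : ℝ) + 1)) * (p.1 ^ 2 + p.2 ^ 2)))) atTop :=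
        lintegral_congr fun p => (hlim p).liminf_eq.symm
    _ ≤ liminf (fun n : ℕ => ∫⁻ p, ‖oscInt μ Φ h p‖ₑ ^ 2 *
      ENNReal.ofReal (Real.exp (-(1 / ((n : ℝ) + 1)) * (p.1 ^ 2 + p.2 ^ 2)))) atTop :=
        lintegral_liminf_le fun n => by
          have := hc.measurable
          fun_prop
    _ ≤ _ := liminf_le_of_le (by isBoundedDefault) fun b hb => by
        obtain ⟨n, hn⟩ := hb.exists
        exact hn.trans (lintegral_oscInt_gaussian_le hΦ hJm hJ hΦJ hh (by positivity))

end Oscillatory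

/-! ### `L³` bounds by interpolation between `L^∞` and Plancherel. -/

section Interpolation

variable {X : Type*} [MeasurableSpace X] {μ : Measure X} {Φ : X → ℝ × ℝ} {J : X → ℝ}

theorem oscInt_add {h₁ h₂ : X → ℂ} (hΦ : Measurable Φ) (hh₁ : Integrable h₁ μ)
    (hh₂ : Integrable h₂ μ) (p : ℝ × ℝ) :
    oscInt μ Φ (h₁ + h₂) p = oscInt μ Φ h₁ p + oscInt μ Φ h₂ p := by
  simp only [oscInt, Pi.add_apply, mul_add]
  exact integral_add (integrable_char_mul hΦ hh₁ p) (integrable_char_mul hΦ hh₂ p)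

theorem enorm_oscInt_le (h : X → ℂ) (p : ℝ × ℝ) : ‖oscInt μ Φ h p‖ₑ ≤ ∫⁻ z, ‖h z‖ₑ ∂μ := by
  refine (enorm_integral_le_lintegral_enorm _).trans_eq (lintegral_congr fun z => ?_)
  rw [enorm_mul, ← ofReal_norm (Complex.exp _), norm_exp_I_mul_ofReal]
  simp

theorem oscInt_congr {h₁ h₂ : X → ℂ} (h : h₁ =ᵐ[μ] h₂) (p : ℝ × ℝ) :
    oscInt μ Φ h₁ p = oscInt μ Φ h₂ p :=
  integral_congr_ae (h.mono fun z hz => by simp only [hz])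

variable [SFinite μ]

/-- Interpolation between the trivial `L^∞` bound and the Plancherel inequality: if at each level
`λ` the part of `h` on `{Λ < λ}` has an extension bounded by `λ / 2`, then the `L³` norm is
controlled by a weighted `L²` norm of `h`. -/
theorem lintegral_oscInt_cube_le (H : IsDominatedParam μ Φ J) {h : X → ℂ} (hh : Integrable h μ)
    {Λ : X → ℝ} (hΛ : Measurable Λ)
    (hsmall : ∀ t : ℝ, 0 < t → ∀ p, ‖oscInt μ Φ ({z | Λ z < t}.indicator h) p‖ ≤ t / 2) :
    ∫⁻ p, ‖oscInt μ Φ h p‖ₑ ^ 3 ≤ ENNReal.ofReal (12 * (2 * Real.pi) ^ 2) *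
      ∫⁻ z, ENNReal.ofReal (Λ z) * (‖h z‖ₑ ^ 2 / ENNReal.ofReal (J z)) ∂μ := by
  set D : X → ℝ≥0∞ := fun z => ‖h z‖ₑ ^ 2 / ENNReal.ofReal (J z) with hD
  have hDm : AEMeasurable D μ := by
    have := hh.aestronglyMeasurable
    have := H.measurable_weight
    fun_prop
  set c : ℝ≥0∞ := ENNReal.ofReal ((2 * Real.pi) ^ 2) with hc
  -- Where the whole extension exceeds `t`, the part from `{t ≤ Λ}` is at least `t / 2`. Chebyshev
  -- and Plancherel for that part give `4 / t²`, which cancels the factor `t²` of the layer-cake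
  -- formula.
  have hlevel (t : ℝ) (ht : 0 < t) : volume {p | t < ‖oscInt μ Φ h p‖} *
      ENNReal.ofReal (t ^ (3 - 1 : ℝ)) ≤ 4 * c * ∫⁻ z, {z | t ≤ Λ z}.indicator D z ∂μ := by
    have hms : MeasurableSet {z | t ≤ Λ z} := measurableSet_le measurable_const hΛ
    have hms' : MeasurableSet {z | Λ z < t} := measurableSet_lt hΛ measurable_const
    set k : X → ℂ := {z | t ≤ Λ z}.indicator h with hk
    have hki : Integrable k μ := hh.indicator hms
    have hsplit (p : ℝ × ℝ) : oscInt μ Φ h p =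
        oscInt μ Φ ({z | Λ z < t}.indicator h) p + oscInt μ Φ k p := by
      rw [← oscInt_add H.measurable (hh.indicator hms') hki]
      congr 1
      have : {z | t ≤ Λ z} = {z | Λ z < t}ᶜ := by ext; simp
      rw [hk, this, Set.indicator_self_add_compl]
    have hsub : {p | t < ‖oscInt μ Φ h p‖} ⊆
        {p | ENNReal.ofReal ((t / 2) ^ 2) ≤ ‖oscInt μ Φ k p‖ₑ ^ 2} := by
      intro p hp
      have h1 : t < ‖oscInt μ Φ h p‖ := hp
      rw [hsplit] at h1
      have h2 := (h1.trans_le (norm_add_le _ _))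
      have h3 := hsmall t ht p
      have h4 : t / 2 ≤ ‖oscInt μ Φ k p‖ := by linarith
      change ENNReal.ofReal ((t / 2) ^ 2) ≤ ‖oscInt μ Φ k p‖ₑ ^ 2
      rw [← ofReal_norm, ← ENNReal.ofReal_pow (norm_nonneg _)]
      gcongr
    have hkm : AEMeasurable (fun p => ‖oscInt μ Φ k p‖ₑ ^ 2) (volume : Measure (ℝ × ℝ)) := by
      have := (continuous_oscInt H.measurable hki).measurable
      fun_prop
    have hcheb := meas_ge_le_lintegral_div hkm
      (ε := ENNReal.ofReal ((t / 2) ^ 2)) (by simp; positivity) (by simp)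
    have hpl := lintegral_oscInt_sq_le H hki
    have hDk : ∫⁻ z, ‖k z‖ₑ ^ 2 / ENNReal.ofReal (J z) ∂μ =
        ∫⁻ z, {z | t ≤ Λ z}.indicator D z ∂μ := by
      refine lintegral_congr fun z => ?_
      by_cases hz : z ∈ {z | t ≤ Λ z}
      · simp only [hk, hD, Set.indicator_of_mem hz]
      · simp only [hk, Set.indicator_of_notMem hz]
        simp
    rw [hDk] at hpl
    have ht2 : ENNReal.ofReal (t ^ (3 - 1 : ℝ)) = 4 * ENNReal.ofReal ((t / 2) ^ 2) := by
      have : (4 : ℝ≥0∞) = ENNReal.ofReal 4 := by simp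
      rw [this, ← ENNReal.ofReal_mul (by norm_num)]
      congr 1
      norm_num
      ring
    calc _ ≤ (c * ∫⁻ z, {z | t ≤ Λ z}.indicator D z ∂μ) / ENNReal.ofReal ((t / 2) ^ 2) *
        (4 * ENNReal.ofReal ((t / 2) ^ 2)) := by
          rw [ht2]
          gcongr
          exact (measure_mono hsub).trans (hcheb.trans (by gcongr))
      _ = (c * ∫⁻ z, {z | t ≤ Λ z}.indicator D z ∂μ) / ENNReal.ofReal ((t / 2) ^ 2) *
        ENNReal.ofReal ((t / 2) ^ 2) * 4 := by ring
      _ = (c * ∫⁻ z, {z | t ≤ Λ z}.indicator D z ∂μ) * 4 := by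
          rw [ENNReal.div_mul_cancel (by simp; positivity) (by simp)]
      _ = _ := by ring
  have hcake := lintegral_rpow_eq_lintegral_meas_lt_mul (volume : Measure (ℝ × ℝ))
    (f := fun p => ‖oscInt μ Φ h p‖) (ae_of_all _ fun _ => norm_nonneg _)
    (continuous_oscInt H.measurable hh).norm.measurable.aemeasurable (p := 3) (by norm_num)
  have hlhs : ∫⁻ p, ‖oscInt μ Φ h p‖ₑ ^ 3 =
      ∫⁻ p, ENNReal.ofReal (‖oscInt μ Φ h p‖ ^ (3 : ℝ)) := by
    refine lintegral_congr fun p => ?_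
    rw [← ofReal_norm, ← ENNReal.ofReal_pow (norm_nonneg _)]
    norm_cast
  have hmeas : AEMeasurable (Function.uncurry fun (t : ℝ) (z : X) => {z | t ≤ Λ z}.indicator D z)
      ((volume.restrict (Set.Ioi 0)).prod μ) := by
    have h1 : (Function.uncurry fun (t : ℝ) (z : X) => {z | t ≤ Λ z}.indicator D z) =
        {q : ℝ × X | q.1 ≤ Λ q.2}.indicator fun q => D q.2 := by
      funext ⟨t, z⟩
      simp [Function.uncurry, Set.indicator]
    rw [h1]
    exact hDm.comp_snd.indicator (measurableSet_le measurable_fst (hΛ.comp measurable_snd))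
  rw [hlhs, hcake]
  calc _ ≤ ENNReal.ofReal 3 * ∫⁻ t : ℝ in Set.Ioi 0,
        4 * c * ∫⁻ z, {z | t ≤ Λ z}.indicator D z ∂μ := by
        gcongr ENNReal.ofReal 3 * ?_
        exact setLIntegral_mono' measurableSet_Ioi fun t ht => hlevel t ht
    -- After Fubini, the set of levels `0 < t ≤ Λ z` has length `Λ z` (or is empty if `Λ z ≤ 0`).
    _ = ENNReal.ofReal 3 * (4 * c * ∫⁻ z, ENNReal.ofReal (Λ z) * D z ∂μ) := by
        rw [lintegral_const_mul' _ _ (ENNReal.mul_ne_top (by simp) (by simp [hc])),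
          lintegral_lintegral_swap hmeas]
        congr 2
        refine lintegral_congr fun z => ?_
        have h1 : (fun t : ℝ => {z | t ≤ Λ z}.indicator D z) =
            (Set.Iic (Λ z)).indicator fun _ => D z := by
          funext t
          simp [Set.indicator]
        rw [h1, lintegral_indicator measurableSet_Iic, lintegral_const,
          Measure.restrict_restrict measurableSet_Iic, Measure.restrict_apply MeasurableSet.univ,
          Set.univ_inter, Set.inter_comm, Set.Ioi_inter_Iic, Real.volume_Ioc, sub_zero, mul_comm]
    _ = _ := by
        rw [hc, ← mul_assoc, ENNReal.ofReal_mul (by norm_num), ← mul_assoc]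
        congr 2
        rw [show (4 : ℝ≥0∞) = ENNReal.ofReal 4 by simp, ← ENNReal.ofReal_mul (by norm_num)]
        norm_num

theorem norm_le_of_enorm_le {E : Type*} [SeminormedAddGroup E] {x : E} {r : ℝ} (hr : 0 ≤ r)
    (h : ‖x‖ₑ ≤ ENNReal.ofReal r) : ‖x‖ ≤ r := by
  rw [← ofReal_norm] at h
  exact (ENNReal.ofReal_le_ofReal_iff hr).1 h

/-- The weighted Hausdorff–Young inequality from `L^{3/2}` to `L³`. -/
theorem lintegral_oscInt_cube_le_hausdorffYoung (H : IsDominatedParam μ Φ J) {h : X → ℂ}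
    (hh : Integrable h μ) (hm : Measurable h) {N : ℝ} (hN : 0 < N)
    (hhN : ∫⁻ z, ENNReal.ofReal (‖h z‖ * √‖h z‖ / √(J z)) ∂μ ≤ ENNReal.ofReal N) :
    ∫⁻ p, ‖oscInt μ Φ h p‖ₑ ^ 3 ≤ ENNReal.ofReal (48 * (2 * Real.pi) ^ 2 * N ^ 2) := by
  have hJm := H.measurable_weight
  -- This `Λ` turns `Λ |h|² / J` into `4 N |h|^{3/2} / √J`. On `{Λ < t}` it also gives `|h| ≤ (t /
  -- 4N) |h|^{3/2} / √J`, with integral at most `t / 4`.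
  have hΛ : Measurable fun z => 4 * N * (√(J z) / √‖h z‖) := by fun_prop
  refine (lintegral_oscInt_cube_le H hh hΛ fun t ht p => ?_).trans ?_
  · refine norm_le_of_enorm_le (by positivity) ((enorm_oscInt_le _ _).trans ?_)
    have h1 : ∀ᵐ z ∂μ, ‖({z | 4 * N * (√(J z) / √‖h z‖) < t}.indicator h) z‖ₑ ≤
        ENNReal.ofReal (t / (4 * N)) * ENNReal.ofReal (‖h z‖ * √‖h z‖ / √(J z)) := by
      filter_upwards [H.weight_pos] with z hz
      by_cases hzt : z ∈ {z | 4 * N * (√(J z) / √‖h z‖) < t}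
      · rw [Set.indicator_of_mem hzt, ← ofReal_norm, ← ENNReal.ofReal_mul (by positivity)]
        apply ENNReal.ofReal_le_ofReal
        have h2 : 4 * N * (√(J z) / √‖h z‖) < t := hzt
        rcases (norm_nonneg (h z)).eq_or_lt with h0 | h0
        · rw [← h0]; simp
        · have h3 : 0 < √‖h z‖ := Real.sqrt_pos.2 h0
          have h4 : 0 < √(J z) := Real.sqrt_pos.2 hz
          have h5 : √(J z) / √‖h z‖ ≤ t / (4 * N) := by
            rw [le_div_iff₀ (by positivity)]
            linarith
          calc ‖h z‖ = √(J z) / √‖h z‖ * (‖h z‖ * √‖h z‖ / √(J z)) := by field_simp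
            _ ≤ _ := by gcongr
      · rw [Set.indicator_of_notMem hzt]
        simp
    refine (lintegral_mono_ae h1).trans ?_
    rw [lintegral_const_mul _ (by fun_prop)]
    calc _ ≤ ENNReal.ofReal (t / (4 * N)) * ENNReal.ofReal N := by gcongr
      _ = ENNReal.ofReal (t / 4) := by
        rw [← ENNReal.ofReal_mul (by positivity)]
        congr 1
        field_simp
      _ ≤ _ := by
        apply ENNReal.ofReal_le_ofReal
        linarith
  · have h1 : ∀ᵐ z ∂μ, ENNReal.ofReal (4 * N * (√(J z) / √‖h z‖)) *
        (‖h z‖ₑ ^ 2 / ENNReal.ofReal (J z)) =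
        ENNReal.ofReal (4 * N) * ENNReal.ofReal (‖h z‖ * √‖h z‖ / √(J z)) := by
      filter_upwards [H.weight_pos] with z hz
      rw [← ofReal_norm, ← ENNReal.ofReal_pow (norm_nonneg _), ← ENNReal.ofReal_div_of_pos hz,
        ← ENNReal.ofReal_mul (by positivity), ← ENNReal.ofReal_mul (by positivity)]
      congr 1
      rcases (norm_nonneg (h z)).eq_or_lt with h0 | h0
      · rw [← h0]; simp
      · have h3 : 0 < √‖h z‖ := Real.sqrt_pos.2 h0
        have h4 : 0 < √(J z) := Real.sqrt_pos.2 hz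
        have h5 := Real.sq_sqrt hz.le
        have h6 := Real.sq_sqrt h0.le
        generalize √‖h z‖ = α at *
        generalize √(J z) = β at *
        rw [← h5, ← h6]
        field_simp
    rw [lintegral_congr_ae h1, lintegral_const_mul _ (by fun_prop)]
    calc _ ≤ ENNReal.ofReal (12 * (2 * Real.pi) ^ 2) * (ENNReal.ofReal (4 * N) *
        ENNReal.ofReal N) := by gcongr
      _ = _ := by
        rw [← ENNReal.ofReal_mul (by positivity), ← ENNReal.ofReal_mul (by positivity)]
        congr 1
        ring

/-- The `L³` bound for a sum of pieces with bounded extensions, over a countable partition. -/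
theorem lintegral_oscInt_cube_le_partition (H : IsDominatedParam μ Φ J) {h : X → ℂ}
    (hh : Integrable h μ) {ι : Type*} [Countable ι] [Nonempty ι] {Q : ι → Set X}
    (hQm : ∀ i, MeasurableSet (Q i)) (hQd : Pairwise (Function.onFun Disjoint Q))
    (hQ : ∀ᵐ z ∂μ, z ∈ ⋃ i, Q i) {a b : ι → ℝ} (ha : ∀ i, 0 ≤ a i) (hb : ∀ i, 0 ≤ b i)
    (hQa : ∀ i p, ‖oscInt (μ.restrict (Q i)) Φ h p‖ ≤ a i)
    (hQb : ∀ i, ∫⁻ z in Q i, ‖h z‖ₑ ^ 2 / ENNReal.ofReal (J z) ∂μ ≤ ENNReal.ofReal (b i))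
    {N : ℝ} (hN : 0 < N) (hab : ∑' i, ENNReal.ofReal (√(a i * b i)) ≤ ENNReal.ofReal N) :
    ∫⁻ p, ‖oscInt μ Φ h p‖ₑ ^ 3 ≤ ENNReal.ofReal (48 * (2 * Real.pi) ^ 2 * N ^ 2) := by
  -- The level is constant on each piece, and `√(a / b)` balances the two bounds: `a = √(a / b) √(a
  -- b)` and `√(a / b) b = √(a b)`.
  obtain ⟨Λ, hΛm, hΛ⟩ := exists_measurable_piecewise Q hQm
    (fun i _ => 4 * N * √(a i / b i)) (fun i => measurable_const) (by
      intro i j hij z hz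
      exact (Set.disjoint_left.1 (hQd hij) hz.1 hz.2).elim)
  have hrestrict : μ.restrict (⋃ i, Q i) = μ := by
    rw [Measure.restrict_eq_self_of_ae_mem hQ]
  have hms (t : ℝ) : MeasurableSet {z | Λ z < t} := measurableSet_lt hΛm measurable_const
  refine (lintegral_oscInt_cube_le H hh hΛm fun t ht p => ?_).trans ?_
  · refine norm_le_of_enorm_le (by positivity) ?_
    have hi := integrable_char_mul H.measurable (hh.indicator (hms t)) p
    have h1 : oscInt μ Φ ({z | Λ z < t}.indicator h) p =
        ∑' i, oscInt (μ.restrict (Q i)) Φ ({z | Λ z < t}.indicator h) p := by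
      unfold oscInt
      rw [← integral_iUnion hQm hQd hi.integrableOn, hrestrict]
    rw [h1]
    refine enorm_tsum_le_tsum_enorm.trans ?_
    have h2 (i : ι) : ‖oscInt (μ.restrict (Q i)) Φ ({z | Λ z < t}.indicator h) p‖ₑ ≤
        ENNReal.ofReal (t / (4 * N)) * ENNReal.ofReal (√(a i * b i)) := by
      by_cases hit : 4 * N * √(a i / b i) < t
      · have h3 : oscInt (μ.restrict (Q i)) Φ ({z | Λ z < t}.indicator h) p =
            oscInt (μ.restrict (Q i)) Φ h p := by
          refine oscInt_congr ?_ p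
          filter_upwards [ae_restrict_mem (hQm i)] with z hz
          rw [Set.indicator_of_mem]
          simpa [hΛ i hz] using hit
        rw [h3]
        -- If `b i = 0`, then `a i / b i = 0` says nothing about `a i`, but `h` vanishes almost
        -- everywhere on the piece.
        rcases (hb i).eq_or_lt with hbi | hbi
        · have h4 : h =ᵐ[μ.restrict (Q i)] 0 := by
            have h5 := hQb i
            rw [← hbi, ENNReal.ofReal_zero, nonpos_iff_eq_zero, lintegral_eq_zero_iff' (by
              have := hh.aestronglyMeasurable.restrict (s := Q i)
              have := H.measurable_weight
              fun_prop)] at h5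
            filter_upwards [h5] with z hz
            simpa using hz
          rw [oscInt_congr h4]
          simp [oscInt]
        · rw [← ofReal_norm, ← ENNReal.ofReal_mul (by positivity)]
          apply ENNReal.ofReal_le_ofReal
          refine (hQa i p).trans ?_
          have h5 : √(a i / b i) ≤ t / (4 * N) := by
            rw [le_div_iff₀ (by positivity)]
            linarith
          calc a i = √(a i / b i) * √(a i * b i) := by
                rw [← Real.sqrt_mul (div_nonneg (ha i) (hb i)),
                  show a i / b i * (a i * b i) = a i ^ 2 by field_simp, Real.sqrt_sq (ha i)]
            _ ≤ _ := by gcongr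
      · have h3 : oscInt (μ.restrict (Q i)) Φ ({z | Λ z < t}.indicator h) p =
            oscInt (μ.restrict (Q i)) Φ 0 p := by
          refine oscInt_congr ?_ p
          filter_upwards [ae_restrict_mem (hQm i)] with z hz
          rw [Set.indicator_of_notMem]
          · rfl
          · simpa [hΛ i hz] using hit
        rw [h3]
        simp [oscInt]
    refine (ENNReal.tsum_le_tsum h2).trans ?_
    rw [ENNReal.tsum_mul_left]
    calc _ ≤ ENNReal.ofReal (t / (4 * N)) * ENNReal.ofReal N := by gcongr
      _ = ENNReal.ofReal (t / 4) := by
        rw [← ENNReal.ofReal_mul (by positivity)]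
        congr 1
        field_simp
      _ ≤ _ := by
        apply ENNReal.ofReal_le_ofReal
        linarith
  · have h1 : ∫⁻ z, ENNReal.ofReal (Λ z) * (‖h z‖ₑ ^ 2 / ENNReal.ofReal (J z)) ∂μ ≤
        ∑' i, ENNReal.ofReal (4 * N) * ENNReal.ofReal (√(a i * b i)) := by
      nth_rewrite 1 [← hrestrict]
      rw [lintegral_iUnion hQm hQd]
      refine ENNReal.tsum_le_tsum fun i => ?_
      have h2 : ∫⁻ z in Q i, ENNReal.ofReal (Λ z) * (‖h z‖ₑ ^ 2 / ENNReal.ofReal (J z)) ∂μ =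
          ENNReal.ofReal (4 * N * √(a i / b i)) *
            ∫⁻ z in Q i, (‖h z‖ₑ ^ 2 / ENNReal.ofReal (J z)) ∂μ := by
        rw [← lintegral_const_mul' _ _ (by simp)]
        refine setLIntegral_congr_fun (hQm i) fun z hz => ?_
        simp only [hΛ i hz]
      rw [h2]
      calc _ ≤ ENNReal.ofReal (4 * N * √(a i / b i)) * ENNReal.ofReal (b i) := by
            gcongr
            exact hQb i
        _ = _ := by
            rw [← ENNReal.ofReal_mul (by positivity), ← ENNReal.ofReal_mul (by positivity)]
            congr 1
            rcases (hb i).eq_or_lt with hbi | hbi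
            · simp [← hbi]
            · rw [mul_assoc]
              congr 1
              nth_rewrite 2 [← Real.sqrt_sq (hb i)]
              rw [← Real.sqrt_mul (div_nonneg (ha i) (hb i))]
              congr 1
              field_simp
    rw [ENNReal.tsum_mul_left] at h1
    calc _ ≤ ENNReal.ofReal (12 * (2 * Real.pi) ^ 2) * (ENNReal.ofReal (4 * N) *
        ENNReal.ofReal N) := by
          gcongr
          exact h1.trans (by gcongr)
      _ = _ := by
        rw [← ENNReal.ofReal_mul (by positivity), ← ENNReal.ofReal_mul (by positivity)]
        congr 1
        ring

end Interpolation

/-! ### The weighted curve and the bilinear extension over pairs of frequencies. -/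

/-- The weight `|ξ + ξ³|^{1/6}`. -/
def wt (ξ : ℝ) : ℝ := |ξ + ξ ^ 3| ^ (1 / 6 : ℝ)

theorem wt_nonneg (ξ : ℝ) : 0 ≤ wt ξ := Real.rpow_nonneg (abs_nonneg _) _

theorem wt_pos {ξ : ℝ} (h : 0 < ξ) : 0 < wt ξ :=
  Real.rpow_pos_of_pos (abs_pos.2 (by positivity)) _

theorem wt_neg (ξ : ℝ) : wt (-ξ) = wt ξ := by
  unfold wt
  rw [show -ξ + (-ξ) ^ 3 = -(ξ + ξ ^ 3) by ring, abs_neg]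

theorem measurable_wt : Measurable wt := by
  unfold wt
  fun_prop

theorem wt_pow_six {ξ : ℝ} (h : 0 ≤ ξ) : wt ξ ^ 6 = ξ + ξ ^ 3 := by
  unfold wt
  rw [← Real.rpow_natCast, ← Real.rpow_mul (abs_nonneg _), abs_of_nonneg (by positivity)]
  norm_num

theorem wt_le_wt {ξ η : ℝ} (h : |ξ| ≤ |η|) : wt ξ ≤ wt η := by
  unfold wt
  refine Real.rpow_le_rpow (abs_nonneg _) ?_ (by norm_num)
  have h1 (x : ℝ) : |x + x ^ 3| = |x| * (1 + |x| ^ 2) := by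
    rw [show x + x ^ 3 = x * (1 + x ^ 2) by ring, abs_mul, sq_abs,
      abs_of_nonneg (by positivity : 0 ≤ 1 + x ^ 2)]
  rw [h1, h1]
  gcongr

/-- The weight is doubling. -/
theorem wt_le_two_mul {ξ η : ℝ} (h : |ξ| ≤ 2 * |η|) : wt ξ ≤ 2 * wt η := by
  -- In sixth powers this is `2η + 8η³ ≤ 64 (η + η³)`.
  have h2 : wt (2 * η) ≤ 2 * wt η := by
    refine le_of_pow_le_pow_left₀ (n := 6) (by norm_num) (by positivity [wt_nonneg η]) ?_
    wlog hη : 0 ≤ η generalizing η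
    · rw [← wt_neg (2 * η), ← wt_neg η, show -(2 * η) = 2 * -η by ring]
      exact this (by simpa using h) (by linarith)
    rw [mul_pow, wt_pow_six hη, wt_pow_six (by positivity)]
    nlinarith [pow_nonneg hη 3]
  refine le_trans (wt_le_wt ?_) h2
  rwa [abs_mul, abs_two]

/-- The curve `ξ ↦ (ξ³ + ξ⁵, ξ)`. -/
def curve (ξ : ℝ) : ℝ × ℝ := (ξ ^ 3 + ξ ^ 5, ξ)

theorem measurable_curve : Measurable curve := by
  unfold curve
  fun_prop

/-- The Fourier extension of the density `u` on the curve, with the weight `wt`. -/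
def curveExt (u : ℝ → ℂ) : ℝ × ℝ → ℂ := oscInt volume curve fun ξ => (wt ξ : ℂ) * u ξ

theorem extIntegral_eq (f : L2) (p : ℝ × ℝ) :
    extIntegral f p = (1 / (2 * Real.pi) : ℂ) * curveExt (hat f) p := by
  unfold extIntegral curveExt oscInt curve
  congr 1
  refine integral_congr_ae (ae_of_all _ fun ξ => ?_)
  simp only [wt]
  rw [add_comm (p.2 * ξ)]
  ring

/-- The region `0 < ξ < η` of pairs of frequencies. -/
def pairs : Set (ℝ × ℝ) := {z | 0 < z.1 ∧ z.1 < z.2}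

theorem measurableSet_pairs : MeasurableSet pairs :=
  (measurableSet_lt measurable_const measurable_fst).inter
    (measurableSet_lt measurable_fst measurable_snd)

/-- The sum of two points of the curve. -/
def curveSum (z : ℝ × ℝ) : ℝ × ℝ := curve z.1 + curve z.2

theorem measurable_curveSum : Measurable curveSum :=
  (measurable_curve.comp measurable_fst).add (measurable_curve.comp measurable_snd)

/-- The absolute value of the Jacobian determinant of `curveSum`. -/
def jac (z : ℝ × ℝ) : ℝ := (z.2 - z.1) * (z.2 + z.1) * (3 + 5 * (z.1 ^ 2 + z.2 ^ 2))

/-- The Jacobian dominates the separation times the sixth power of the weight at the larger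
frequency. This is what makes the exponent `1/6` the right one: `w³ / √J` loses only `|η -
ξ|^{-1/2}`. -/
theorem jac_ge {z : ℝ × ℝ} (hz : z ∈ pairs) : (z.2 - z.1) * wt z.2 ^ 6 ≤ jac z := by
  obtain ⟨h1, h2⟩ := hz
  rw [wt_pow_six (h1.trans h2).le, jac, mul_assoc]
  have h3 : 0 < z.2 - z.1 := by linarith
  gcongr
  have h4 : 0 < z.2 := h1.trans h2
  have : z.2 + z.2 ^ 3 ≤ z.2 * (3 + 5 * (z.1 ^ 2 + z.2 ^ 2)) := by
    nlinarith [mul_pos h4 (pow_pos h4 2), mul_nonneg h4.le (sq_nonneg z.1)]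
  refine this.trans ?_
  gcongr
  linarith

theorem jac_pos {z : ℝ × ℝ} (hz : z ∈ pairs) : 0 < jac z := by
  obtain ⟨h1, h2⟩ := hz
  unfold jac
  have h3 : 0 < z.2 - z.1 := by linarith
  have h4 : 0 < z.2 + z.1 := by linarith
  positivity

/-- For a fixed sum `s = a + b`, the first coordinate is a polynomial in the product `ab`, and it is
strictly monotone in the relevant range because products are at most `s² / 4`. Sum and product
determine an ordered pair. -/
theorem curveSum_injOn : Set.InjOn curveSum pairs := by
  rintro ⟨a, b⟩ ⟨h1, h2⟩ ⟨c, d⟩ ⟨h3, h4⟩ h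
  simp only [curveSum, curve, Prod.mk_add_mk, Prod.mk.injEq] at h h1 h2 h3 h4
  obtain ⟨h5, h6⟩ := h
  have hs : 0 < a + b := by linarith
  have hd : d = a + b - c := by linarith
  have h7 : (a + b) * (a * b - c * d) * (3 + 5 * (a + b) ^ 2 - 5 * (a * b + c * d)) = 0 := by
    subst hd
    linear_combination (-1) * h5
  have h8 : 0 < 3 + 5 * (a + b) ^ 2 - 5 * (a * b + c * d) := by
    have : c * d ≤ (a + b) ^ 2 / 4 := by rw [h6]; nlinarith [sq_nonneg (c - d)]
    nlinarith [sq_nonneg (a - b)]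
  have h9 : a * b - c * d = 0 := by
    rcases mul_eq_zero.1 h7 with h | h
    · rcases mul_eq_zero.1 h with h | h
      · exact absurd h hs.ne'
      · exact h
    · exact absurd h h8.ne'
  have h10 : (a - c) * (b - c) = 0 := by
    subst hd
    linear_combination h9
  rcases mul_eq_zero.1 h10 with h | h
  · have : a = c := by linarith
    subst this
    simp; linarith
  · exfalso; linarith

theorem isDominatedParam_curveSum :
    IsDominatedParam (volume.restrict pairs) curveSum jac where
  measurable := measurable_curveSum
  measurable_weight := by unfold jac; fun_prop
  weight_pos := by
    filter_upwards [ae_restrict_mem measurableSet_pairs] with z hz using jac_pos hz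
  lintegral_le := by
    intro G _
    let D : ℝ × ℝ → ℝ × ℝ →L[ℝ] ℝ × ℝ := fun z =>
      LinearMap.toContinuousLinearMap (Matrix.toLin (.finTwoProd ℝ) (.finTwoProd ℝ)
        !![3 * z.1 ^ 2 + 5 * z.1 ^ 4, 3 * z.2 ^ 2 + 5 * z.2 ^ 4; 1, 1])
    have hD (z : ℝ × ℝ) : HasFDerivAt curveSum (D z) z := by
      simp only [D]
      rw [Matrix.toLin_finTwoProd_toContinuousLinearMap]
      have h1 : HasFDerivAt (fun z : ℝ × ℝ => z.1) (ContinuousLinearMap.fst ℝ ℝ ℝ) z :=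
        hasFDerivAt_fst
      have h2 : HasFDerivAt (fun z : ℝ × ℝ => z.2) (ContinuousLinearMap.snd ℝ ℝ ℝ) z :=
        hasFDerivAt_snd
      have h3 := (((h1.pow 3).add (h1.pow 5)).add ((h2.pow 3).add (h2.pow 5))).prodMk (h1.add h2)
      refine h3.congr_fderiv ?_
      ext <;> simp
    have hdet (z : ℝ × ℝ) : (D z).det = -jac z := by
      simp only [D, jac, LinearMap.det_toContinuousLinearMap, LinearMap.det_toLin,
        Matrix.det_fin_two_of]
      ring
    have h1 := lintegral_image_eq_lintegral_abs_det_fderiv_mul volume measurableSet_pairs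
      (fun z _ => (hD z).hasFDerivWithinAt) curveSum_injOn G
    calc _ = ∫⁻ z in pairs, ENNReal.ofReal |(D z).det| * G (curveSum z) := by
          refine setLIntegral_congr_fun measurableSet_pairs fun z hz => ?_
          simp only [hdet, abs_neg, abs_of_pos (jac_pos hz)]
      _ ≤ _ := by
          rw [← h1]
          exact setLIntegral_le_lintegral _ _

theorem oscInt_curveSum_prod (S T : Set ℝ) (hS : MeasurableSet S) (hT : MeasurableSet T)
    (u v : ℝ → ℂ) (p : ℝ × ℝ) :
    oscInt (volume.restrict (S ×ˢ T)) curveSum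
        (fun z => (wt z.1 * u z.1 : ℂ) * (wt z.2 * v z.2)) p =
      curveExt (S.indicator u) p * curveExt (T.indicator v) p := by
  have h1 (S : Set ℝ) (hS : MeasurableSet S) (u : ℝ → ℂ) : curveExt (S.indicator u) p =
      ∫ ξ in S, Complex.exp (Complex.I * ((p.1 * (curve ξ).1 + p.2 * (curve ξ).2 : ℝ) : ℂ)) *
        (wt ξ * u ξ) := by
    rw [← integral_indicator hS]
    unfold curveExt oscInt
    refine integral_congr_ae (ae_of_all _ fun ξ => ?_)
    by_cases h : ξ ∈ S <;> simp [h]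
  rw [h1 S hS, h1 T hT, ← integral_prod_mul, Measure.prod_restrict, ← Measure.volume_eq_prod]
  unfold oscInt
  refine integral_congr_ae (ae_of_all _ fun z => ?_)
  have : Complex.exp (Complex.I * ((p.1 * (curveSum z).1 + p.2 * (curveSum z).2 : ℝ) : ℂ)) =
      Complex.exp (Complex.I * ((p.1 * (curve z.1).1 + p.2 * (curve z.1).2 : ℝ) : ℂ)) *
      Complex.exp (Complex.I * ((p.1 * (curve z.2).1 + p.2 * (curve z.2).2 : ℝ) : ℂ)) := by
    rw [← Complex.exp_add]
    congr 1
    simp only [curveSum, Prod.fst_add, Prod.snd_add]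
    push_cast
    ring
  simp only [this]
  ring

theorem volume_diagonal : (volume : Measure (ℝ × ℝ)) {z | z.1 = z.2} = 0 := by
  rw [Measure.volume_eq_prod, Measure.measure_prod_null (measurableSet_eq_fun measurable_fst
    measurable_snd)]
  refine ae_of_all _ fun x => ?_
  have : Prod.mk x ⁻¹' {z : ℝ × ℝ | z.1 = z.2} = {x} := by
    ext y; simp [eq_comm]
  simp [this]

/-- The square of the extension of a density on `(0, ∞)` is twice a bilinear extension over
`0 < ξ < η`. -/
theorem curveExt_sq {u : ℝ → ℂ} (hu : ∀ ξ ≤ 0, u ξ = 0)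
    (hi : Integrable fun ξ => (wt ξ : ℂ) * u ξ) (p : ℝ × ℝ) :
    curveExt u p ^ 2 = 2 * oscInt (volume.restrict pairs) curveSum
      (fun z => (wt z.1 * u z.1 : ℂ) * (wt z.2 * u z.2)) p := by
  set h : ℝ × ℝ → ℂ := fun z => (wt z.1 * u z.1 : ℂ) * (wt z.2 * u z.2) with hh
  set G : ℝ × ℝ → ℂ := fun z =>
    Complex.exp (Complex.I * ((p.1 * (curveSum z).1 + p.2 * (curveSum z).2 : ℝ) : ℂ)) * h z with hG
  have hint : Integrable h := hi.mul_prod hi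
  have hGi : Integrable G := integrable_char_mul measurable_curveSum hint p
  have hsq : curveExt u p ^ 2 = ∫ z, G z := by
    have := oscInt_curveSum_prod Set.univ Set.univ MeasurableSet.univ MeasurableSet.univ u u p
    simp only [Set.univ_prod_univ, Measure.restrict_univ, Set.indicator_univ] at this
    rw [sq, ← this]
    rfl
  have hlt : MeasurableSet {z : ℝ × ℝ | z.1 < z.2} := measurableSet_lt measurable_fst measurable_snd
  have hsplit := integral_add_compl hlt hGi
  -- The integrand is symmetric and the diagonal is a null set.
  have hlower : ∫ z in {z : ℝ × ℝ | z.1 < z.2}ᶜ, G z = ∫ z in {z : ℝ × ℝ | z.1 < z.2}, G z := by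
    have h1 : ({z : ℝ × ℝ | z.1 < z.2}ᶜ : Set (ℝ × ℝ)) =ᵐ[volume] {z : ℝ × ℝ | z.2 < z.1} := by
      have h2 : ∀ᵐ z : ℝ × ℝ, z.1 ≠ z.2 := by
        rw [ae_iff]
        simpa using volume_diagonal
      filter_upwards [h2] with z hz
      apply propext
      change ¬ (z.1 < z.2) ↔ z.2 < z.1
      constructor
      · intro h; exact lt_of_le_of_ne (not_lt.1 h) hz.symm
      · intro h; exact not_lt.2 h.le
    rw [setIntegral_congr_set h1]
    have h3 := (Measure.measurePreserving_swap (μ := (volume : Measure ℝ))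
      (ν := (volume : Measure ℝ))).setIntegral_preimage_emb
      MeasurableEquiv.prodComm.measurableEmbedding G {z : ℝ × ℝ | z.2 < z.1}
    rw [← Measure.volume_eq_prod] at h3
    rw [← h3]
    refine setIntegral_congr_fun hlt fun z _ => ?_
    simp only [hG, hh, Prod.swap, curveSum]
    rw [add_comm (curve z.2), mul_comm ((wt z.2 : ℂ) * u z.2)]
  have hpairs : ∫ z in {z : ℝ × ℝ | z.1 < z.2}, G z = ∫ z in pairs, G z := by
    refine (setIntegral_eq_of_subset_of_forall_sdiff_eq_zero hlt (fun z hz => hz.2)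
      fun z hz => ?_)
    have h1 : z.1 ≤ 0 := by
      by_contra hc
      exact hz.2 ⟨not_le.1 hc, hz.1⟩
    simp [hG, hh, hu _ h1]
  rw [hsq, ← hsplit, hlower, hpairs, two_mul]
  rfl

/-! ### Dyadic intervals and the Whitney decomposition of the pairs. -/

/-- The dyadic interval `[k, k + 1) 2^j`. -/
def cell (j k : ℤ) : Set ℝ := Set.Ico (k * (2 : ℝ) ^ j) ((k + 1) * (2 : ℝ) ^ j)

theorem measurableSet_cell (j k : ℤ) : MeasurableSet (cell j k) := measurableSet_Ico

theorem mem_cell_iff {j k : ℤ} {x : ℝ} : x ∈ cell j k ↔ ⌊x / (2 : ℝ) ^ j⌋ = k := by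
  have h : (0 : ℝ) < 2 ^ j := by positivity
  rw [Int.floor_eq_iff, le_div_iff₀ h, div_lt_iff₀ h]
  rfl

theorem volume_cell (j k : ℤ) : volume (cell j k) = ENNReal.ofReal ((2 : ℝ) ^ j) := by
  rw [cell, Real.volume_Ico]
  congr 1
  ring

theorem floor_div_zpow_succ (x : ℝ) (j : ℤ) :
    ⌊x / (2 : ℝ) ^ (j + 1)⌋ = ⌊x / (2 : ℝ) ^ j⌋ / 2 := by
  have h : x / (2 : ℝ) ^ (j + 1) = x / (2 : ℝ) ^ j / (2 : ℕ) := by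
    rw [zpow_add_one₀ (by norm_num), div_div]
    norm_num
  rw [h, Int.floor_div_natCast]
  rfl

/-- The dyadic intervals of length `2^j` that contain the two points are not adjacent. -/
def Separated (j : ℤ) (z : ℝ × ℝ) : Prop := ⌊z.1 / (2 : ℝ) ^ j⌋ + 2 ≤ ⌊z.2 / (2 : ℝ) ^ j⌋

theorem Separated.of_succ {j : ℤ} {z : ℝ × ℝ} (h : Separated (j + 1) z) : Separated j z := by
  unfold Separated at *
  rw [floor_div_zpow_succ, floor_div_zpow_succ] at h
  omega

theorem Separated.of_le {i j : ℤ} {z : ℝ × ℝ} (h : Separated j z) (hij : i ≤ j) :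
    Separated i z := by
  obtain ⟨n, rfl⟩ := Int.le.dest hij
  induction n with
  | zero => simpa using h
  | succ n ih =>
    refine ih ?_ (by omega)
    apply Separated.of_succ
    push_cast at h
    rwa [← add_assoc] at h

/-- Separation passes to finer scales, holds at scales fine compared with `η - ξ`, and fails once
both points lie in `[0, 2^n)`. So there is a coarsest separated scale. -/
theorem exists_separated_not_succ {z : ℝ × ℝ} (hz : z ∈ pairs) :
    ∃ j, Separated j z ∧ ¬ Separated (j + 1) z := by
  obtain ⟨h1, h2⟩ := hz
  have hd : 0 < z.2 - z.1 := by linarith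
  obtain ⟨n, hn⟩ := pow_unbounded_of_one_lt z.2 (one_lt_two : (1 : ℝ) < 2)
  obtain ⟨m, hm⟩ := pow_unbounded_of_one_lt (3 / (z.2 - z.1)) (one_lt_two : (1 : ℝ) < 2)
  have hbig : ¬ Separated n z := by
    unfold Separated
    have h3 : ⌊z.1 / (2 : ℝ) ^ (n : ℤ)⌋ = 0 := by
      rw [Int.floor_eq_zero_iff, zpow_natCast]
      exact ⟨by positivity, (div_lt_one (by positivity)).2 (by linarith)⟩
    have h4 : ⌊z.2 / (2 : ℝ) ^ (n : ℤ)⌋ = 0 := by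
      rw [Int.floor_eq_zero_iff, zpow_natCast]
      exact ⟨div_nonneg (by linarith) (by positivity), (div_lt_one (by positivity)).2 hn⟩
    omega
  have hsmall : Separated (-m) z := by
    unfold Separated
    simp only [zpow_neg, zpow_natCast, div_inv_eq_mul]
    rw [← Int.floor_add_ofNat, Int.le_floor]
    rw [div_lt_iff₀ hd] at hm
    refine (Int.floor_le _).trans ?_
    nlinarith
  obtain ⟨j, hj, hmax⟩ := Int.exists_greatest_of_bdd (P := fun j => Separated j z)
    ⟨n, fun j hj => by
      by_contra hc
      exact hbig (hj.of_le (by omega))⟩ ⟨_, hsmall⟩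
  exact ⟨j, hj, fun h => by have := hmax _ h; omega⟩

/-- The offset between the two sides of a Whitney square. -/
def offset (b : Bool) : ℤ := cond b 3 2

/-- The Whitney squares `[k, k + 1) 2^j × [k + 2, k + 3) 2^j` for all `k`, and
`[k, k + 1) 2^j × [k + 3, k + 4) 2^j` for even `k`. -/
def whitney (i : ℤ × ℤ × Bool) : Set (ℝ × ℝ) :=
  {z | z ∈ cell i.1 i.2.1 ×ˢ cell i.1 (i.2.1 + offset i.2.2) ∧ (i.2.2 = true → Even i.2.1)}

theorem whitney_eq {i : ℤ × ℤ × Bool} (h : i.2.2 = true → Even i.2.1) :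
    whitney i = cell i.1 i.2.1 ×ˢ cell i.1 (i.2.1 + offset i.2.2) := by
  ext z
  simp only [whitney, Set.mem_ofPred_eq, and_iff_left h]

theorem whitney_eq_empty {i : ℤ × ℤ × Bool} (h : ¬ (i.2.2 = true → Even i.2.1)) :
    whitney i = ∅ := by
  ext z
  simp only [whitney, Set.mem_ofPred_eq, Set.mem_empty_iff_false, iff_false]
  exact fun hz => h hz.2

theorem measurableSet_whitney (i : ℤ × ℤ × Bool) : MeasurableSet (whitney i) := by
  by_cases h : i.2.2 = true → Even i.2.1
  · rw [whitney_eq h]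
    exact (measurableSet_cell _ _).prod (measurableSet_cell _ _)
  · rw [whitney_eq_empty h]
    exact MeasurableSet.empty

/-- Offset `2` always becomes `1` in the parent generation, offset `3` does so exactly when `k` is
even, and larger offsets never do. Hence these squares are exactly the ones at the coarsest
separated scale. -/
theorem separated_of_mem_whitney {i : ℤ × ℤ × Bool} {z : ℝ × ℝ} (hz : z ∈ whitney i) :
    Separated i.1 z ∧ ¬ Separated (i.1 + 1) z := by
  obtain ⟨j, k, b⟩ := i
  obtain ⟨⟨h1, h2⟩, h3⟩ := hz
  simp only [mem_cell_iff] at h1 h2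
  unfold Separated
  rw [floor_div_zpow_succ, floor_div_zpow_succ, h1, h2]
  cases b
  · simp only [offset, cond_false]
    omega
  · obtain ⟨m, hm⟩ := h3 rfl
    simp only at hm
    simp only [offset, cond_true]
    omega

theorem exists_mem_whitney {z : ℝ × ℝ} (hz : z ∈ pairs) : ∃ i, z ∈ whitney i := by
  obtain ⟨j, h1, h2⟩ := exists_separated_not_succ hz
  unfold Separated at h1 h2
  rw [floor_div_zpow_succ, floor_div_zpow_succ] at h2
  by_cases h3 : ⌊z.2 / (2 : ℝ) ^ j⌋ = ⌊z.1 / (2 : ℝ) ^ j⌋ + 2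
  · refine ⟨(j, ⌊z.1 / (2 : ℝ) ^ j⌋, false), ⟨mem_cell_iff.2 rfl, mem_cell_iff.2 ?_⟩, by simp⟩
    simpa [offset] using h3
  · refine ⟨(j, ⌊z.1 / (2 : ℝ) ^ j⌋, true), ⟨mem_cell_iff.2 rfl, mem_cell_iff.2 ?_⟩, fun _ => ?_⟩
    · simp only [offset, cond_true]
      omega
    · simp only
      rw [Int.even_iff]
      omega

theorem pairwise_disjoint_whitney : Pairwise (Function.onFun Disjoint whitney) := by
  intro i i' hii'
  rw [Function.onFun, Set.disjoint_left]
  intro z hz hz'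
  apply hii'
  have h1 := separated_of_mem_whitney hz
  have h2 := separated_of_mem_whitney hz'
  obtain ⟨j, k, b⟩ := i
  obtain ⟨j', k', b'⟩ := i'
  have hj : j = j' := by
    rcases lt_trichotomy j j' with h | h | h
    · exact absurd (h2.1.of_le (by simp only; omega)) h1.2
    · exact h
    · exact absurd (h1.1.of_le (by simp only; omega)) h2.2
  subst hj
  obtain ⟨⟨h3, h4⟩, -⟩ := hz
  obtain ⟨⟨h5, h6⟩, -⟩ := hz'
  simp only [mem_cell_iff] at h3 h4 h5 h6
  have hk : k = k' := by omega
  subst hk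
  have hb : offset b = offset b' := by omega
  have : b = b' := by
    cases b <;> cases b' <;> simp_all [offset]
  rw [this]

theorem dist_of_mem_whitney {i : ℤ × ℤ × Bool} {z : ℝ × ℝ} (hz : z ∈ whitney i) :
    (2 : ℝ) ^ i.1 ≤ z.2 - z.1 ∧ z.2 - z.1 ≤ 4 * (2 : ℝ) ^ i.1 := by
  obtain ⟨j, k, b⟩ := i
  obtain ⟨⟨⟨h1, h2⟩, ⟨h3, h4⟩⟩, -⟩ := hz
  have h : (0 : ℝ) < 2 ^ j := by positivity
  cases b <;> simp only [offset, cond_true, cond_false] at * <;> push_cast at * <;>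
    constructor <;> nlinarith

/-! ### Pairs with incomparable heights: a gain in the double integral. -/

/-- The profile `min (p⁵, p³)`. -/
def profile (p : ℝ) : ℝ := if p ≤ 1 then p ^ 5 else p ^ 3

theorem profile_nonneg {p : ℝ} (hp : 0 ≤ p) : 0 ≤ profile p := by
  unfold profile
  split_ifs <;> positivity

theorem measurable_profile : Measurable profile :=
  Measurable.ite measurableSet_Iic (by fun_prop) (by fun_prop)

/-- The pointwise source of the gain `1 / L`. If `p` is huge, either `pq ≥ L` and `p⁴q⁴` wins, or
`p³q³L < L⁴ ≤ p³`. If `p` is tiny, then `pL ≤ 1` absorbs the factor `L` and leaves `p²q³` or, when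
`q ≤ p`, `p⁵`; this is at most one of the profiles. -/
theorem cube_mul_cube_le {p q L : ℝ} (hp : 0 ≤ p) (hq : 0 ≤ q) (hL : 2 ≤ L)
    (h : L ^ 4 < p ^ 2 ∨ p ^ 2 < 2 / L ^ 4) :
    p ^ 3 * q ^ 3 ≤ 1 / L * (p ^ 4 * q ^ 4 + profile p + profile q) := by
  have hL0 : 0 < L := by linarith
  have hPp := profile_nonneg hp
  have hPq := profile_nonneg hq
  rw [one_div, inv_mul_eq_div, le_div_iff₀ hL0]
  rcases h with h | h
  · have hpL : L ^ 2 < p := by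
      refine lt_of_pow_lt_pow_left₀ 2 hp ?_
      rwa [← pow_mul]
    rcases le_or_gt L (p * q) with h1 | h1
    · have : p ^ 3 * q ^ 3 * L ≤ p ^ 3 * q ^ 3 * (p * q) := by gcongr
      nlinarith
    · have h2 : (p * q) ^ 3 ≤ L ^ 3 := by gcongr
      have h3 : (L ^ 2) ^ 3 ≤ p ^ 3 := by gcongr
      have h4 : profile p = p ^ 3 := by
        unfold profile
        rw [if_neg (by nlinarith)]
      have h5 : L ^ 3 * L ≤ (L ^ 2) ^ 3 := by
        rw [← pow_mul, ← pow_succ]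
        exact pow_le_pow_right₀ (by linarith) (by norm_num)
      have h6 : (p * q) ^ 3 * L ≤ L ^ 3 * L := by gcongr
      rw [mul_pow] at h6
      have : 0 ≤ p ^ 4 * q ^ 4 := by positivity
      linarith
  · have hpL : p * L ≤ 1 := by
      refine le_of_sq_le_sq ?_ (by norm_num)
      rw [lt_div_iff₀ (by positivity)] at h
      have h2 : 4 ≤ L ^ 2 := by nlinarith
      have : p ^ 2 * L ^ 2 * 4 ≤ p ^ 2 * L ^ 2 * L ^ 2 := by gcongr
      nlinarith
    have hp1 : p ≤ 1 := by nlinarith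
    have h0 : 0 ≤ p ^ 4 * q ^ 4 := by positivity
    have hpp : profile p = p ^ 5 := by
      unfold profile
      rw [if_pos hp1]
    rcases le_or_gt q p with h1 | h1
    · have h2 : p ^ 3 * q ^ 3 * L ≤ p ^ 3 * p ^ 3 * L := by gcongr
      have h3 : p ^ 3 * p ^ 3 * L ≤ p ^ 5 := by
        calc p ^ 3 * p ^ 3 * L = p ^ 5 * (p * L) := by ring
          _ ≤ p ^ 5 * 1 := by gcongr
          _ = _ := mul_one _
      linarith
    · rcases le_or_gt q 1 with h2 | h2
      · have hpq : profile q = q ^ 5 := by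
          unfold profile
          rw [if_pos h2]
        have h3 : p ^ 3 * q ^ 3 * L ≤ q ^ 5 := by
          calc p ^ 3 * q ^ 3 * L = p ^ 2 * q ^ 3 * (p * L) := by ring
            _ ≤ q ^ 2 * q ^ 3 * 1 := by gcongr
            _ = _ := by ring
        linarith
      · have hpq : profile q = q ^ 3 := by
          unfold profile
          rw [if_neg (not_le.2 h2)]
        have h3 : p ^ 3 * q ^ 3 * L ≤ q ^ 3 := by
          calc p ^ 3 * q ^ 3 * L = p ^ 2 * q ^ 3 * (p * L) := by ring
            _ ≤ 1 ^ 2 * q ^ 3 * 1 := by gcongr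
            _ = _ := by ring
        linarith

theorem lintegral_Ioc_rpow {c r : ℝ} (hc : 0 ≤ c) (hr : -1 < r) :
    ∫⁻ t in Set.Ioc 0 c, ENNReal.ofReal (t ^ r) = ENNReal.ofReal (c ^ (r + 1) / (r + 1)) := by
  rw [← ofReal_integral_eq_lintegral_ofReal, ← intervalIntegral.integral_of_le hc,
    integral_rpow (Or.inl hr), Real.zero_rpow (by linarith), sub_zero]
  · exact (intervalIntegrable_iff_integrableOn_Ioc_of_le hc).1
      (intervalIntegral.intervalIntegrable_rpow' hr)
  · filter_upwards [ae_restrict_mem measurableSet_Ioc] with t ht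
    exact Real.rpow_nonneg ht.1.le _

theorem lintegral_Ioi_rpow {c r : ℝ} (hc : 0 < c) (hr : r < -1) :
    ∫⁻ t in Set.Ioi c, ENNReal.ofReal (t ^ r) = ENNReal.ofReal (-c ^ (r + 1) / (r + 1)) := by
  rw [← ofReal_integral_eq_lintegral_ofReal, integral_Ioi_rpow_of_lt hr hc]
  · exact integrableOn_Ioi_rpow_of_lt hr hc
  · filter_upwards [ae_restrict_mem measurableSet_Ioi] with t ht
    exact Real.rpow_nonneg (hc.trans ht).le _

/-- A power `p^r` of `p = √(a√t)` gives `t^{r/4 - 2}`, so `r = 4` is critical: `p⁵` is integrable at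
`0` and `p³` at infinity. The profile changes at `p = 1`, i.e. `t = a^{-2}`, and each side
contributes `4a²`. -/
theorem lintegral_profile_le {a : ℝ} (ha : 0 ≤ a) :
    ∫⁻ t in Set.Ioi 0, ENNReal.ofReal (profile √(a * √t) / t ^ 2) ≤ ENNReal.ofReal (8 * a ^ 2) := by
  rcases ha.eq_or_lt with rfl | ha
  · simp [profile]
  have hc : 0 < a ^ (-2 : ℝ) := by positivity
  have hsqrt {t : ℝ} (ht : 0 < t) : √(a * √t) = a ^ (1 / 2 : ℝ) * t ^ (1 / 4 : ℝ) := by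
    rw [Real.sqrt_eq_rpow, Real.sqrt_eq_rpow, Real.mul_rpow ha.le (by positivity),
      ← Real.rpow_mul ht.le]
    norm_num
  have hpow {t : ℝ} (ht : 0 < t) (n : ℕ) : √(a * √t) ^ n / t ^ 2 =
      a ^ (n / 2 : ℝ) * t ^ (n / 4 - 2 : ℝ) := by
    rw [hsqrt ht, mul_pow, ← Real.rpow_natCast, ← Real.rpow_natCast, ← Real.rpow_mul ha.le,
      ← Real.rpow_mul ht.le, Real.rpow_sub ht, mul_div_assoc]
    norm_num
    ring_nf
  have hle {t : ℝ} (ht : 0 < t) : √(a * √t) ≤ 1 ↔ t ≤ a ^ (-2 : ℝ) := by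
    rw [Real.sqrt_le_left zero_le_one, one_pow, ← le_div_iff₀' ha, Real.sqrt_le_left (by positivity),
      Real.rpow_neg ha.le]
    norm_num
  have hunion : Set.Ioi (0 : ℝ) = Set.Ioc 0 (a ^ (-2 : ℝ)) ∪ Set.Ioi (a ^ (-2 : ℝ)) :=
    (Set.Ioc_union_Ioi_eq_Ioi hc.le).symm
  rw [hunion]
  refine (lintegral_union_le _ _ _).trans ?_
  have h1 : ∫⁻ t in Set.Ioc 0 (a ^ (-2 : ℝ)), ENNReal.ofReal (profile √(a * √t) / t ^ 2) =
      ENNReal.ofReal (4 * a ^ 2) := by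
    have : ∫⁻ t in Set.Ioc 0 (a ^ (-2 : ℝ)), ENNReal.ofReal (profile √(a * √t) / t ^ 2) =
        ∫⁻ t in Set.Ioc 0 (a ^ (-2 : ℝ)), ENNReal.ofReal (a ^ (5 / 2 : ℝ)) *
          ENNReal.ofReal (t ^ (-3 / 4 : ℝ)) := by
      refine setLIntegral_congr_fun measurableSet_Ioc fun t ht => ?_
      rw [profile, if_pos ((hle ht.1).2 ht.2), hpow ht.1, ← ENNReal.ofReal_mul (by positivity)]
      norm_num
    rw [this, lintegral_const_mul' _ _ (by simp), lintegral_Ioc_rpow hc.le (by norm_num),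
      ← ENNReal.ofReal_mul (by positivity)]
    congr 1
    rw [← Real.rpow_mul ha.le, mul_div_assoc', ← Real.rpow_add ha]
    norm_num
    ring
  have h2 : ∫⁻ t in Set.Ioi (a ^ (-2 : ℝ)), ENNReal.ofReal (profile √(a * √t) / t ^ 2) =
      ENNReal.ofReal (4 * a ^ 2) := by
    have : ∫⁻ t in Set.Ioi (a ^ (-2 : ℝ)), ENNReal.ofReal (profile √(a * √t) / t ^ 2) =
        ∫⁻ t in Set.Ioi (a ^ (-2 : ℝ)), ENNReal.ofReal (a ^ (3 / 2 : ℝ)) *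
          ENNReal.ofReal (t ^ (-5 / 4 : ℝ)) := by
      refine setLIntegral_congr_fun measurableSet_Ioi fun t ht => ?_
      have ht0 : 0 < t := hc.trans ht
      rw [profile, if_neg (by rw [hle ht0]; exact not_le.2 ht), hpow ht0,
        ← ENNReal.ofReal_mul (by positivity)]
      norm_num
    rw [this, lintegral_const_mul' _ _ (by simp), lintegral_Ioi_rpow hc (by norm_num),
      ← ENNReal.ofReal_mul (by positivity)]
    congr 1
    rw [← Real.rpow_mul ha.le, mul_div_assoc', mul_neg, ← Real.rpow_add ha]
    norm_num
    ring
  rw [h1, h2, ← ENNReal.ofReal_add (by positivity) (by positivity)]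
  apply ENNReal.ofReal_le_ofReal
  linarith

/-- `√(|u| √(η - ξ))`, for the value of `u` at one of the two frequencies. -/
def height (a : ℝ) (z : ℝ × ℝ) : ℝ := √(a * √(z.2 - z.1))

theorem lintegral_pairs_profile_fst_le {v : ℝ → ℝ} (hv : Measurable v) (hv0 : ∀ ξ, 0 ≤ v ξ) :
    ∫⁻ z in pairs, ENNReal.ofReal (profile (height (v z.1) z) / (z.2 - z.1) ^ 2) ≤
      8 * ∫⁻ ξ, ENNReal.ofReal (v ξ ^ 2) := by
  have hm := measurable_profile
  calc _ ≤ ∫⁻ z in {z : ℝ × ℝ | z.1 < z.2},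
        ENNReal.ofReal (profile (height (v z.1) z) / (z.2 - z.1) ^ 2) :=
        lintegral_mono_set fun z hz => hz.2
    _ = ∫⁻ z : ℝ × ℝ, (Set.Ioi (0 : ℝ)).indicator
        (fun t => ENNReal.ofReal (profile √(v z.1 * √t) / t ^ 2)) (z.2 - z.1) := by
        rw [← lintegral_indicator (measurableSet_lt measurable_fst measurable_snd)]
        refine lintegral_congr fun z => ?_
        simp [Set.indicator, height]
    _ = ∫⁻ ξ, ∫⁻ η, (Set.Ioi (0 : ℝ)).indicator
        (fun t => ENNReal.ofReal (profile √(v ξ * √t) / t ^ 2)) (η - ξ) := by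
        rw [Measure.volume_eq_prod, lintegral_prod]
        have h1 : (fun z : ℝ × ℝ => (Set.Ioi (0 : ℝ)).indicator
          (fun t => ENNReal.ofReal (profile √(v z.1 * √t) / t ^ 2)) (z.2 - z.1)) =
          {z : ℝ × ℝ | 0 < z.2 - z.1}.indicator fun z =>
            ENNReal.ofReal (profile √(v z.1 * √(z.2 - z.1)) / (z.2 - z.1) ^ 2) := by
          funext z
          simp [Set.indicator]
        rw [h1]
        exact (Measurable.indicator (by fun_prop) (measurableSet_lt measurable_const
          (by fun_prop))).aemeasurable
    _ ≤ ∫⁻ ξ, 8 * ENNReal.ofReal (v ξ ^ 2) := by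
        refine lintegral_mono fun ξ => ?_
        simp only
        rw [lintegral_sub_right_eq_self (μ := volume) (fun t => (Set.Ioi (0 : ℝ)).indicator
          (fun t => ENNReal.ofReal (profile √(v ξ * √t) / t ^ 2)) t) ξ,
          lintegral_indicator measurableSet_Ioi]
        refine (lintegral_profile_le (hv0 ξ)).trans_eq ?_
        rw [ENNReal.ofReal_mul (by norm_num)]
        simp
    _ = _ := lintegral_const_mul _ (by fun_prop)

theorem lintegral_pairs_profile_snd_le {v : ℝ → ℝ} (hv : Measurable v) (hv0 : ∀ ξ, 0 ≤ v ξ) :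
    ∫⁻ z in pairs, ENNReal.ofReal (profile (height (v z.2) z) / (z.2 - z.1) ^ 2) ≤
      8 * ∫⁻ ξ, ENNReal.ofReal (v ξ ^ 2) := by
  have hm := measurable_profile
  calc _ ≤ ∫⁻ z in {z : ℝ × ℝ | z.1 < z.2},
        ENNReal.ofReal (profile (height (v z.2) z) / (z.2 - z.1) ^ 2) :=
        lintegral_mono_set fun z hz => hz.2
    _ = ∫⁻ z : ℝ × ℝ, (Set.Ioi (0 : ℝ)).indicator
        (fun t => ENNReal.ofReal (profile √(v z.2 * √t) / t ^ 2)) (z.2 - z.1) := by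
        rw [← lintegral_indicator (measurableSet_lt measurable_fst measurable_snd)]
        refine lintegral_congr fun z => ?_
        simp [Set.indicator, height]
    _ = ∫⁻ η, ∫⁻ ξ, (Set.Ioi (0 : ℝ)).indicator
        (fun t => ENNReal.ofReal (profile √(v η * √t) / t ^ 2)) (η - ξ) := by
        rw [Measure.volume_eq_prod, lintegral_prod_symm]
        have h1 : (fun z : ℝ × ℝ => (Set.Ioi (0 : ℝ)).indicator
          (fun t => ENNReal.ofReal (profile √(v z.2 * √t) / t ^ 2)) (z.2 - z.1)) =
          {z : ℝ × ℝ | 0 < z.2 - z.1}.indicator fun z =>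
            ENNReal.ofReal (profile √(v z.2 * √(z.2 - z.1)) / (z.2 - z.1) ^ 2) := by
          funext z
          simp [Set.indicator]
        rw [h1]
        exact (Measurable.indicator (by fun_prop) (measurableSet_lt measurable_const
          (by fun_prop))).aemeasurable
    _ ≤ ∫⁻ ξ, 8 * ENNReal.ofReal (v ξ ^ 2) := by
        refine lintegral_mono fun ξ => ?_
        simp only
        rw [lintegral_sub_left_eq_self (μ := volume) (fun t => (Set.Ioi (0 : ℝ)).indicator
          (fun t => ENNReal.ofReal (profile √(v ξ * √t) / t ^ 2)) t) ξ,
          lintegral_indicator measurableSet_Ioi]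
        refine (lintegral_profile_le (hv0 ξ)).trans_eq ?_
        rw [ENNReal.ofReal_mul (by norm_num)]
        simp
    _ = _ := lintegral_const_mul _ (by fun_prop)

/-- The frequencies at which `|u|` is comparable to `2^{-j/2}`, up to a factor `K`. -/
def mid (u : ℝ → ℂ) (K : ℝ) (j : ℤ) : Set ℝ :=
  {ξ | K⁻¹ ≤ ‖u ξ‖ * √((2 : ℝ) ^ j) ∧ ‖u ξ‖ * √((2 : ℝ) ^ j) ≤ K}

theorem measurableSet_mid {u : ℝ → ℂ} (hu : Measurable u) (K : ℝ) (j : ℤ) :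
    MeasurableSet (mid u K j) := by
  have h : Measurable fun ξ => ‖u ξ‖ * √((2 : ℝ) ^ j) := by fun_prop
  exact (measurableSet_le measurable_const h).inter (measurableSet_le h measurable_const)

/-- The pairs of frequencies at which both values of `u` are comparable to the inverse square root
of the size of the Whitney square. -/
def midPairs (u : ℝ → ℂ) (K : ℝ) : Set (ℝ × ℝ) :=
  ⋃ i : ℤ × ℤ × Bool, whitney i ∩ mid u K i.1 ×ˢ mid u K i.1

theorem measurableSet_midPairs {u : ℝ → ℂ} (hu : Measurable u) (K : ℝ) :
    MeasurableSet (midPairs u K) :=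
  MeasurableSet.iUnion fun i => (measurableSet_whitney i).inter
    ((measurableSet_mid hu K i.1).prod (measurableSet_mid hu K i.1))

theorem mem_midPairs_iff {u : ℝ → ℂ} {K : ℝ} {i : ℤ × ℤ × Bool} {z : ℝ × ℝ}
    (hz : z ∈ whitney i) : z ∈ midPairs u K ↔ z ∈ mid u K i.1 ×ˢ mid u K i.1 := by
  refine ⟨fun h => ?_, fun h => Set.mem_iUnion.2 ⟨i, hz, h⟩⟩
  obtain ⟨i', hi', h'⟩ := Set.mem_iUnion.1 h
  have : i = i' := by
    by_contra hne
    exact Set.disjoint_left.1 (pairwise_disjoint_whitney hne) hz hi'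
  rwa [this]

/-- The density `(ξ, η) ↦ w(ξ) u(ξ) w(η) u(η)`. -/
def pairDensity (u : ℝ → ℂ) (z : ℝ × ℝ) : ℂ := (wt z.1 * u z.1 : ℂ) * (wt z.2 * u z.2)

theorem measurable_pairDensity {u : ℝ → ℂ} (hu : Measurable u) : Measurable (pairDensity u) := by
  have := measurable_wt
  unfold pairDensity
  fun_prop

theorem norm_pairDensity (u : ℝ → ℂ) (z : ℝ × ℝ) :
    ‖pairDensity u z‖ = wt z.1 * wt z.2 * (‖u z.1‖ * ‖u z.2‖) := by
  simp only [pairDensity, norm_mul, Complex.norm_real, Real.norm_of_nonneg (wt_nonneg _)]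
  ring

theorem norm_pairDensity_le {z : ℝ × ℝ} (hz : z ∈ pairs) (u : ℝ → ℂ) :
    ‖pairDensity u z‖ ≤ wt z.2 ^ 2 * (‖u z.1‖ * ‖u z.2‖) := by
  rw [norm_pairDensity, sq]
  have h1 : wt z.1 ≤ wt z.2 := wt_le_wt (by
    rw [abs_of_pos hz.1, abs_of_pos (hz.1.trans hz.2)]
    exact hz.2.le)
  have := wt_nonneg z.2
  gcongr

/-- The weight cancels against `√J`, leaving the Hardy–Littlewood–Sobolev integrand
`|u(ξ)u(η)|^{3/2} t^{-1/2}` with `t = η - ξ`, rewritten in terms of the heights. -/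
theorem pairDensity_hausdorffYoung_le {z : ℝ × ℝ} (hz : z ∈ pairs) (u : ℝ → ℂ) :
    ‖pairDensity u z‖ * √‖pairDensity u z‖ / √(jac z) ≤
      height ‖u z.1‖ z ^ 3 * height ‖u z.2‖ z ^ 3 / (z.2 - z.1) ^ 2 := by
  have hd : 0 < z.2 - z.1 := by linarith [hz.2]
  have hw : 0 < wt z.2 := wt_pos (hz.1.trans hz.2)
  have h1 := norm_pairDensity_le hz u
  have h2 := jac_ge hz
  set a := ‖u z.1‖
  set b := ‖u z.2‖
  set W := wt z.2
  set t := z.2 - z.1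
  have ha : 0 ≤ a := norm_nonneg _
  have hb : 0 ≤ b := norm_nonneg _
  have h3 : √(W ^ 2 * (a * b)) = W * √(a * b) := by
    rw [Real.sqrt_mul (by positivity), Real.sqrt_sq hw.le]
  have h4 : √(t * W ^ 6) = √t * W ^ 3 := by
    rw [Real.sqrt_mul hd.le, show W ^ 6 = (W ^ 3) ^ 2 by ring, Real.sqrt_sq (by positivity)]
  calc _ ≤ W ^ 2 * (a * b) * √(W ^ 2 * (a * b)) / √(t * W ^ 6) := by gcongr
    _ = a * b * √(a * b) / √t := by
      rw [h3, h4]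
      have := Real.sqrt_pos.2 hd
      field_simp
    _ = _ := by
      have h5 : height a z * height b z = √(a * b) * √t := by
        unfold height
        rw [← Real.sqrt_mul (by positivity), ← Real.sqrt_mul (by positivity)]
        congr 1
        change a * √t * (b * √t) = a * b * t
        nth_rewrite 3 [← Real.mul_self_sqrt hd.le]
        ring
      rw [← mul_pow, h5]
      have h6 := Real.sq_sqrt hd.le
      have h7 := Real.sq_sqrt (mul_nonneg ha hb)
      have h8 := Real.sqrt_pos.2 hd
      nth_rewrite 1 [← h7]
      nth_rewrite 3 [← h6]
      field_simp

/-- On a Whitney square `2^j ≤ η - ξ ≤ 4 · 2^j`, so replacing `√(2^j)` by `√(η - ξ)` can only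
increase the value, by at most a factor `2`; hence the `2` in the lower threshold only. -/
theorem height_mem_of_notMem_mid {u : ℝ → ℂ} {L : ℝ} {i : ℤ × ℤ × Bool} {z : ℝ × ℝ}
    (hz : z ∈ whitney i) {ξ : ℝ} (hξ : ξ ∉ mid u (L ^ 4) i.1) :
    L ^ 4 < height ‖u ξ‖ z ^ 2 ∨ height ‖u ξ‖ z ^ 2 < 2 / L ^ 4 := by
  obtain ⟨h1, h2⟩ := dist_of_mem_whitney hz
  have hs : (0 : ℝ) < 2 ^ i.1 := by positivity
  have h3 : height ‖u ξ‖ z ^ 2 = ‖u ξ‖ * √(z.2 - z.1) := Real.sq_sqrt (by positivity)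
  rw [h3]
  have h4 : √((2 : ℝ) ^ i.1) ≤ √(z.2 - z.1) := Real.sqrt_le_sqrt h1
  have h5 : √(z.2 - z.1) ≤ 2 * √((2 : ℝ) ^ i.1) := by
    refine (Real.sqrt_le_sqrt h2).trans_eq ?_
    rw [Real.sqrt_mul (by norm_num), show (4 : ℝ) = 2 ^ 2 by norm_num,
      Real.sqrt_sq (by norm_num)]
  have h6 : ¬ (((L ^ 4)⁻¹ ≤ ‖u ξ‖ * √((2 : ℝ) ^ i.1)) ∧ ‖u ξ‖ * √((2 : ℝ) ^ i.1) ≤ L ^ 4) := hξ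
  rw [not_and_or, not_le, not_le] at h6
  have hu := norm_nonneg (u ξ)
  rcases h6 with h6 | h6
  · right
    calc ‖u ξ‖ * √(z.2 - z.1) ≤ ‖u ξ‖ * (2 * √((2 : ℝ) ^ i.1)) := by gcongr
      _ = 2 * (‖u ξ‖ * √((2 : ℝ) ^ i.1)) := by ring
      _ < 2 * (L ^ 4)⁻¹ := by gcongr
      _ = _ := rfl
  · left
    exact h6.trans_le (by gcongr)

/-- The part of the bilinear density with incomparable heights is small in the weighted
`L^{3/2}` norm. -/
theorem lintegral_rest_le {u : ℝ → ℂ} (hu : Measurable u) (hu1 : ∫⁻ ξ, ‖u ξ‖ₑ ^ 2 ≤ 1)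
    {L : ℝ} (hL : 2 ≤ L) :
    ∫⁻ z in pairs, ENNReal.ofReal (‖(midPairs u (L ^ 4))ᶜ.indicator (pairDensity u) z‖ *
        √‖(midPairs u (L ^ 4))ᶜ.indicator (pairDensity u) z‖ / √(jac z)) ≤
      ENNReal.ofReal (17 / L) := by
  have hL0 : 0 < L := by linarith
  have hm := measurable_profile
  have hsq (ξ : ℝ) : ENNReal.ofReal (‖u ξ‖ ^ 2) = ‖u ξ‖ₑ ^ 2 := by
    rw [ENNReal.ofReal_pow (norm_nonneg _), ofReal_norm]
  have hpt : ∀ z ∈ pairs, ENNReal.ofReal (‖(midPairs u (L ^ 4))ᶜ.indicator (pairDensity u) z‖ *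
        √‖(midPairs u (L ^ 4))ᶜ.indicator (pairDensity u) z‖ / √(jac z)) ≤
      ENNReal.ofReal (1 / L) * (‖u z.1‖ₑ ^ 2 * ‖u z.2‖ₑ ^ 2 +
        ENNReal.ofReal (profile (height ‖u z.1‖ z) / (z.2 - z.1) ^ 2) +
        ENNReal.ofReal (profile (height ‖u z.2‖ z) / (z.2 - z.1) ^ 2)) := by
    intro z hz
    by_cases hzm : z ∈ midPairs u (L ^ 4)
    · rw [Set.indicator_of_notMem (by simpa using hzm)]
      simp
    rw [Set.indicator_of_mem (by simpa using hzm)]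
    have hd : 0 < z.2 - z.1 := by linarith [hz.2]
    obtain ⟨i, hi⟩ := exists_mem_whitney hz
    rw [mem_midPairs_iff hi, Set.mem_prod, not_and_or] at hzm
    have hp : 0 ≤ height ‖u z.1‖ z := Real.sqrt_nonneg _
    have hq : 0 ≤ height ‖u z.2‖ z := Real.sqrt_nonneg _
    have key : height ‖u z.1‖ z ^ 3 * height ‖u z.2‖ z ^ 3 ≤
        1 / L * (height ‖u z.1‖ z ^ 4 * height ‖u z.2‖ z ^ 4 +
          profile (height ‖u z.1‖ z) + profile (height ‖u z.2‖ z)) := by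
      rcases hzm with h | h
      · exact cube_mul_cube_le hp hq hL (height_mem_of_notMem_mid hi h)
      · have := cube_mul_cube_le hq hp hL (height_mem_of_notMem_mid hi h)
        rw [mul_comm (_ ^ 3)]
        refine this.trans_eq ?_
        ring
    -- Hence the term `p⁴q⁴ / t²` is `|u(ξ)|²|u(η)|²`, of total integral at most `1`. The two
    -- profile terms give `8` each, and `17 = 1 + 8 + 8`.
    have h4 (a : ℝ) (ha : 0 ≤ a) : height a z ^ 4 = a ^ 2 * (z.2 - z.1) := by
      rw [show height a z ^ 4 = (height a z ^ 2) ^ 2 by ring, height,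
        Real.sq_sqrt (by positivity), mul_pow, Real.sq_sqrt hd.le]
    rw [← hsq, ← hsq, ← ENNReal.ofReal_mul (by positivity),
      ← ENNReal.ofReal_add (by positivity) (div_nonneg (profile_nonneg hp) (by positivity)),
      ← ENNReal.ofReal_add (add_nonneg (by positivity)
        (div_nonneg (profile_nonneg hp) (by positivity)))
        (div_nonneg (profile_nonneg hq) (by positivity)), ← ENNReal.ofReal_mul (by positivity)]
    apply ENNReal.ofReal_le_ofReal
    refine (pairDensity_hausdorffYoung_le hz u).trans ?_
    rw [div_le_iff₀ (by positivity)]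
    refine key.trans_eq ?_
    rw [h4 _ (norm_nonneg _), h4 _ (norm_nonneg _)]
    field_simp
  have hprod : ∫⁻ z in pairs, ‖u z.1‖ₑ ^ 2 * ‖u z.2‖ₑ ^ 2 ≤ 1 := by
    refine (setLIntegral_le_lintegral _ _).trans ?_
    rw [Measure.volume_eq_prod, lintegral_prod_mul (f := fun ξ => ‖u ξ‖ₑ ^ 2)
      (g := fun ξ => ‖u ξ‖ₑ ^ 2) (by fun_prop) (by fun_prop)]
    exact mul_le_one' hu1 hu1
  have hfst := lintegral_pairs_profile_fst_le hu.norm (fun ξ => norm_nonneg (u ξ))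
  have hsnd := lintegral_pairs_profile_snd_le hu.norm (fun ξ => norm_nonneg (u ξ))
  simp_rw [hsq] at hfst hsnd
  refine (setLIntegral_mono' measurableSet_pairs hpt).trans ?_
  have hhm (ζ : ℝ × ℝ → ℝ) (hζ : Measurable ζ) : Measurable fun z : ℝ × ℝ =>
      ENNReal.ofReal (profile (height ‖u (ζ z)‖ z) / (z.2 - z.1) ^ 2) := by
    unfold height
    fun_prop
  rw [lintegral_const_mul' _ _ (by simp), lintegral_add_right _ (hhm _ measurable_snd),
    lintegral_add_right _ (hhm _ measurable_fst)]
  calc _ ≤ ENNReal.ofReal (1 / L) * (1 + 8 * 1 + 8 * 1) := by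
        gcongr
        · exact hfst.trans (by gcongr)
        · exact hsnd.trans (by gcongr)
    _ = _ := by
        rw [show (1 + 8 * 1 + 8 * 1 : ℝ≥0∞) = ENNReal.ofReal 17 by norm_num,
          ← ENNReal.ofReal_mul (by positivity)]
        congr 1
        ring

/-! ### Pairs with comparable heights: summing over Whitney squares. -/

/-- The center of the dyadic interval `[k, k + 1) 2^j`. -/
def cellCenter (j k : ℤ) : ℝ := (k + 1 / 2) * (2 : ℝ) ^ j

theorem wt_mul_indicator (S : Set ℝ) (u : ℝ → ℂ) :
    (fun ξ => (wt ξ : ℂ) * S.indicator u ξ) = S.indicator fun ξ => (wt ξ : ℂ) * u ξ := by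
  funext ξ
  by_cases h : ξ ∈ S <;> simp [h]

theorem integrable_wt_mul_indicator {u : ℝ → ℂ} (hi : Integrable fun ξ => (wt ξ : ℂ) * u ξ)
    {S : Set ℝ} (hS : MeasurableSet S) : Integrable fun ξ => (wt ξ : ℂ) * S.indicator u ξ := by
  rw [wt_mul_indicator]
  exact hi.indicator hS

theorem curveExt_add {u v : ℝ → ℂ} (hu : Integrable fun ξ => (wt ξ : ℂ) * u ξ)
    (hv : Integrable fun ξ => (wt ξ : ℂ) * v ξ) (p : ℝ × ℝ) :
    curveExt (u + v) p = curveExt u p + curveExt v p := by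
  unfold curveExt
  rw [← oscInt_add measurable_curve hu hv]
  congr 1
  funext ξ
  simp [mul_add]

theorem enorm_curveExt_le (u : ℝ → ℂ) (p : ℝ × ℝ) :
    ‖curveExt u p‖ₑ ≤ ∫⁻ ξ, ENNReal.ofReal (wt ξ) * ‖u ξ‖ₑ := by
  refine (enorm_oscInt_le _ _).trans_eq (lintegral_congr fun ξ => ?_)
  rw [enorm_mul, ← ofReal_norm (wt ξ : ℂ), Complex.norm_real, Real.norm_of_nonneg (wt_nonneg _)]

theorem cell_nonneg {j k : ℤ} (hk : 0 ≤ k) {ξ : ℝ} (hξ : ξ ∈ cell j k) : 0 ≤ ξ := by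
  refine le_trans ?_ hξ.1
  have : (0 : ℝ) ≤ k := by exact_mod_cast hk
  positivity

theorem cell_neg {j k : ℤ} (hk : k < 0) {ξ : ℝ} (hξ : ξ ∈ cell j k) : ξ < 0 := by
  refine hξ.2.trans_le (mul_nonpos_of_nonpos_of_nonneg ?_ (by positivity))
  exact_mod_cast hk

theorem cellCenter_pos {j k : ℤ} (hk : 0 ≤ k) : 0 < cellCenter j k := by
  have : (0 : ℝ) ≤ k := by exact_mod_cast hk
  unfold cellCenter
  positivity

theorem wt_le_of_mem_cell {j k : ℤ} {ξ : ℝ} (hξ : ξ ∈ cell j k) :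
    wt ξ ≤ 2 * wt (cellCenter j k) := by
  apply wt_le_two_mul
  have h : (0 : ℝ) < 2 ^ j := by positivity
  obtain ⟨h1, h2⟩ := hξ
  rcases le_or_gt 0 k with hk | hk
  · rw [abs_of_nonneg (cell_nonneg hk ⟨h1, h2⟩), abs_of_pos (cellCenter_pos hk)]
    have : (0 : ℝ) ≤ k := by exact_mod_cast hk
    unfold cellCenter
    nlinarith
  · have hk1 : (k : ℝ) + 1 ≤ 0 := by exact_mod_cast hk
    have hc : cellCenter j k < 0 := mul_neg_of_neg_of_pos (by linarith) h
    rw [abs_of_neg (cell_neg hk ⟨h1, h2⟩), abs_of_neg hc]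
    unfold cellCenter
    nlinarith

/-- The cell `k = 0` must be excluded, since it reaches the zero of the weight. -/
theorem wt_center_le_of_mem_cell {j k : ℤ} (hk : 1 ≤ k) {ξ : ℝ} (hξ : ξ ∈ cell j k) :
    wt (cellCenter j k) ≤ 2 * wt ξ := by
  apply wt_le_two_mul
  rw [abs_of_nonneg (cell_nonneg (by omega) hξ), abs_of_pos (cellCenter_pos (by omega))]
  have h1 := hξ.1
  have : (1 : ℝ) ≤ k := by exact_mod_cast hk
  have h : (0 : ℝ) < 2 ^ j := by positivity
  unfold cellCenter
  nlinarith

theorem norm_indicator_compl_mid_le {u : ℝ → ℂ} {K : ℝ} (hK : 0 < K) (j : ℤ) (ξ : ℝ) :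
    ‖(mid u K j)ᶜ.indicator u ξ‖ ≤
      1 / (K * √((2 : ℝ) ^ j)) + √((2 : ℝ) ^ j) / K * ‖u ξ‖ ^ 2 := by
  have hs : 0 < √((2 : ℝ) ^ j) := Real.sqrt_pos.2 (by positivity)
  by_cases h : ξ ∈ mid u K j
  · rw [Set.indicator_of_notMem (by simpa using h), norm_zero]
    positivity
  · rw [Set.indicator_of_mem (by simpa using h)]
    have h1 : ¬ (K⁻¹ ≤ ‖u ξ‖ * √((2 : ℝ) ^ j) ∧ ‖u ξ‖ * √((2 : ℝ) ^ j) ≤ K) := h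
    rw [not_and_or, not_le, not_le] at h1
    have hu := norm_nonneg (u ξ)
    rcases h1 with h1 | h1
    · have h2 : ‖u ξ‖ ≤ 1 / (K * √((2 : ℝ) ^ j)) := by
        rw [inv_eq_one_div, lt_div_iff₀ hK] at h1
        rw [le_div_iff₀ (by positivity)]
        linarith
      have : 0 ≤ √((2 : ℝ) ^ j) / K * ‖u ξ‖ ^ 2 := by positivity
      linarith
    · have h2 : ‖u ξ‖ ≤ √((2 : ℝ) ^ j) / K * ‖u ξ‖ ^ 2 := by
        rw [div_mul_eq_mul_div, le_div_iff₀ hK]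
        nlinarith
      have : 0 ≤ 1 / (K * √((2 : ℝ) ^ j)) := by positivity
      linarith

/-- Removing the values of `u` that are not comparable to `2^{-j/2}` changes the extension from a
dyadic interval only slightly. -/
theorem norm_curveExt_mid_le {u : ℝ → ℂ} (hu : Measurable u)
    (hi : Integrable fun ξ => (wt ξ : ℂ) * u ξ) (hu1 : ∫⁻ ξ, ‖u ξ‖ₑ ^ 2 ≤ 1)
    {K : ℝ} (hK : 0 < K) {A : ℝ} {j k : ℤ} {p : ℝ × ℝ}
    (hA : ‖curveExt ((cell j k).indicator u) p‖ ≤ A * (wt (cellCenter j k) * √((2 : ℝ) ^ j))) :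
    ‖curveExt ((cell j k).indicator ((mid u K j).indicator u)) p‖ ≤
      (A + 4 / K) * (wt (cellCenter j k) * √((2 : ℝ) ^ j)) := by
  have hM := measurableSet_mid hu K j
  have hC := measurableSet_cell j k
  set s : ℝ := (2 : ℝ) ^ j with hs
  have hs0 : 0 < s := by positivity
  have hss : 0 < √s := Real.sqrt_pos.2 hs0
  have hw := wt_nonneg (cellCenter j k)
  have hsum : curveExt ((cell j k).indicator u) p =
      curveExt ((cell j k).indicator ((mid u K j).indicator u)) p +
      curveExt ((cell j k).indicator ((mid u K j)ᶜ.indicator u)) p := by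
    rw [← curveExt_add (integrable_wt_mul_indicator (integrable_wt_mul_indicator hi hM) hC)
      (integrable_wt_mul_indicator (integrable_wt_mul_indicator hi hM.compl) hC),
      ← Set.indicator_add', Set.indicator_self_add_compl]
  have hrest : ‖curveExt ((cell j k).indicator ((mid u K j)ᶜ.indicator u)) p‖ ≤
      4 / K * (wt (cellCenter j k) * √s) := by
    refine norm_le_of_enorm_le (by positivity) ((enorm_curveExt_le _ _).trans ?_)
    -- Small values of `u` are bounded by `1 / (K√s)` and large ones by `√s |u|² / K`. Over a cell
    -- of length `s` each bound integrates to at most `√s / K`; the doubling of the weight makes the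
    -- total `4 / K`.
    have h1 : ∫⁻ ξ, ENNReal.ofReal (wt ξ) *
        ‖(cell j k).indicator ((mid u K j)ᶜ.indicator u) ξ‖ₑ ≤
        ∫⁻ ξ in cell j k, ENNReal.ofReal (2 * wt (cellCenter j k)) *
          (ENNReal.ofReal (1 / (K * √s)) + ENNReal.ofReal (√s / K) * ‖u ξ‖ₑ ^ 2) := by
      rw [← lintegral_indicator hC]
      refine lintegral_mono fun ξ => ?_
      by_cases h : ξ ∈ cell j k
      · simp only [Set.indicator_of_mem h]
        gcongr
        · exact wt_le_of_mem_cell h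
        · rw [← ofReal_norm, ← ofReal_norm, ← ENNReal.ofReal_pow (norm_nonneg _),
            ← ENNReal.ofReal_mul (by positivity),
            ← ENNReal.ofReal_add (by positivity) (by positivity)]
          exact ENNReal.ofReal_le_ofReal (norm_indicator_compl_mid_le hK j ξ)
      · simp [h]
    refine h1.trans ?_
    rw [lintegral_const_mul' _ _ ENNReal.ofReal_ne_top, lintegral_add_left measurable_const,
      lintegral_const_mul' _ _ (by simp), setLIntegral_const, volume_cell]
    calc _ ≤ ENNReal.ofReal (2 * wt (cellCenter j k)) * (ENNReal.ofReal (1 / (K * √s)) *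
        ENNReal.ofReal s + ENNReal.ofReal (√s / K) * ENNReal.ofReal 1) := by
          gcongr
          exact (setLIntegral_le_lintegral _ _).trans (by simpa using hu1)
      _ = _ := by
          rw [← ENNReal.ofReal_mul (by positivity), ← ENNReal.ofReal_mul (by positivity),
            ← ENNReal.ofReal_add (by positivity) (by positivity),
            ← ENNReal.ofReal_mul (by positivity)]
          congr 1
          have h2 := Real.sq_sqrt hs0.le
          generalize √s = r at *
          rw [← h2]
          field_simp
          ring
  have h3 : curveExt ((cell j k).indicator ((mid u K j).indicator u)) p =
      curveExt ((cell j k).indicator u) p -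
      curveExt ((cell j k).indicator ((mid u K j)ᶜ.indicator u)) p := by
    rw [hsum]; ring
  rw [h3, add_mul]
  exact (norm_sub_le _ _).trans (add_le_add hA hrest)

/-- A fixed value `|u(ξ)|` is comparable to `2^{-j/2}` up to `K` only for scales whose ratio is at
most `K⁴`. This is the only logarithmic loss in the argument. -/
theorem tsum_indicator_mid_le (u : ℝ → ℂ) {K : ℝ} (hK : 0 < K) {n : ℕ} (hn : K ^ 4 < 2 ^ n)
    (ξ : ℝ) : ∑' j, (mid u K j).indicator (fun _ => (1 : ℝ≥0∞)) ξ ≤ 2 * n := by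
  have hclose {i j : ℤ} (hi : ξ ∈ mid u K i) (hj : ξ ∈ mid u K j) : j - i < n := by
    have h1 : K⁻¹ ≤ ‖u ξ‖ * √((2 : ℝ) ^ i) := hi.1
    have h2 : ‖u ξ‖ * √((2 : ℝ) ^ j) ≤ K := hj.2
    have hsi : 0 < √((2 : ℝ) ^ i) := Real.sqrt_pos.2 (by positivity)
    have hsj : 0 < √((2 : ℝ) ^ j) := Real.sqrt_pos.2 (by positivity)
    have h3 : √((2 : ℝ) ^ j) ≤ K ^ 2 * √((2 : ℝ) ^ i) := by
      rw [inv_le_iff_one_le_mul₀ hK] at h1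
      calc √((2 : ℝ) ^ j) = 1 * √((2 : ℝ) ^ j) := (one_mul _).symm
        _ ≤ (‖u ξ‖ * √((2 : ℝ) ^ i) * K) * √((2 : ℝ) ^ j) := by gcongr
        _ = (‖u ξ‖ * √((2 : ℝ) ^ j)) * (√((2 : ℝ) ^ i) * K) := by ring
        _ ≤ K * (√((2 : ℝ) ^ i) * K) := by gcongr
        _ = _ := by ring
    have h4 : (2 : ℝ) ^ j ≤ K ^ 4 * (2 : ℝ) ^ i := by
      have h5 := pow_le_pow_left₀ hsj.le h3 2
      rw [mul_pow, Real.sq_sqrt (by positivity), Real.sq_sqrt (by positivity)] at h5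
      linarith
    have h5 : (2 : ℝ) ^ j < (2 : ℝ) ^ ((n : ℤ) + i) := by
      rw [zpow_add₀ (by norm_num), zpow_natCast]
      refine h4.trans_lt ?_
      gcongr
    have := (zpow_lt_zpow_iff_right₀ (by norm_num : (1 : ℝ) < 2)).1 h5
    omega
  by_cases hne : ∃ i, ξ ∈ mid u K i
  · obtain ⟨i, hi⟩ := hne
    rw [tsum_eq_sum (s := Finset.Ico (i - n) (i + n)) (fun j hj => by
      refine Set.indicator_of_notMem (fun hjm => hj ?_) _
      have h1 := hclose hi hjm
      have h2 := hclose hjm hi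
      rw [Finset.mem_Ico]
      omega)]
    calc _ ≤ ∑ j ∈ Finset.Ico (i - n) (i + n), (1 : ℝ≥0∞) :=
          Finset.sum_le_sum fun j _ => Set.indicator_le_self' (fun _ _ => zero_le) ξ
      _ = _ := by
          rw [Finset.sum_const, Int.card_Ico, show (i + n - (i - n)).toNat = 2 * n by omega]
          simp
  · push Not at hne
    simp [Set.indicator_of_notMem (hne _)]

theorem tsum_lintegral_cell_le (j : ℤ) (F : ℝ → ℝ≥0∞) :
    ∑' k, ∫⁻ ξ in cell j k, F ξ ≤ ∫⁻ ξ, F ξ := by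
  rw [← lintegral_iUnion (measurableSet_cell j) (fun k k' hkk' => by
    rw [Function.onFun, Set.disjoint_left]
    intro x hx hx'
    exact hkk' ((mem_cell_iff.1 hx).symm.trans (mem_cell_iff.1 hx')))]
  exact setLIntegral_le_lintegral _ _

/-- The mass of the comparable part of `u` in a dyadic interval. -/
def midMass (u : ℝ → ℂ) (K : ℝ) (j k : ℤ) : ℝ≥0∞ :=
  ∫⁻ ξ in cell j k, ‖(mid u K j).indicator u ξ‖ₑ ^ 2

theorem tsum_midMass_le {u : ℝ → ℂ} (hu : Measurable u) (hu1 : ∫⁻ ξ, ‖u ξ‖ₑ ^ 2 ≤ 1)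
    {K : ℝ} (hK : 0 < K) {n : ℕ} (hn : K ^ 4 < 2 ^ n) :
    ∑' j, ∑' k, midMass u K j k ≤ 2 * n := by
  calc ∑' j, ∑' k, midMass u K j k ≤ ∑' j, ∫⁻ ξ, ‖(mid u K j).indicator u ξ‖ₑ ^ 2 :=
        ENNReal.tsum_le_tsum fun j => tsum_lintegral_cell_le j _
    _ = ∫⁻ ξ, ∑' j, ‖(mid u K j).indicator u ξ‖ₑ ^ 2 := by
        rw [lintegral_tsum fun j => ?_]
        exact ((hu.indicator (measurableSet_mid hu K j)).enorm.pow_const 2).aemeasurable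
    _ ≤ ∫⁻ ξ, 2 * n * ‖u ξ‖ₑ ^ 2 := by
        refine lintegral_mono fun ξ => ?_
        have h1 (j : ℤ) : ‖(mid u K j).indicator u ξ‖ₑ ^ 2 =
            (mid u K j).indicator (fun _ => (1 : ℝ≥0∞)) ξ * ‖u ξ‖ₑ ^ 2 := by
          by_cases h : ξ ∈ mid u K j <;> simp [h]
        simp_rw [h1]
        rw [ENNReal.tsum_mul_right]
        gcongr
        exact tsum_indicator_mid_le u hK hn ξ
    _ ≤ 2 * n * 1 := by
        rw [lintegral_const_mul' _ _ (ENNReal.mul_ne_top (by simp) (by simp))]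
        gcongr
    _ = _ := mul_one _

/-- Each cell is counted four times: as the first or the second side, for either offset. -/
theorem tsum_whitney_midMass_le {u : ℝ → ℂ} (hu : Measurable u) (hu1 : ∫⁻ ξ, ‖u ξ‖ₑ ^ 2 ≤ 1)
    {K : ℝ} (hK : 0 < K) {n : ℕ} (hn : K ^ 4 < 2 ^ n) :
    ∑' i : ℤ × ℤ × Bool, (midMass u K i.1 i.2.1 + midMass u K i.1 (i.2.1 + offset i.2.2)) ≤
      8 * n := by
  have h1 (j : ℤ) : ∑' q : ℤ × Bool, (midMass u K j q.1 + midMass u K j (q.1 + offset q.2)) =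
      4 * ∑' k, midMass u K j k := by
    have h2 (c : ℤ) : ∑' k, midMass u K j (k + c) = ∑' k, midMass u K j k :=
      (Equiv.addRight c).tsum_eq (fun k => midMass u K j k)
    rw [ENNReal.tsum_prod (f := fun k b => midMass u K j k + midMass u K j (k + offset b))]
    simp only [tsum_bool, ENNReal.tsum_add, h2]
    ring
  rw [ENNReal.tsum_prod (f := fun j (q : ℤ × Bool) =>
    midMass u K j q.1 + midMass u K j (q.1 + offset q.2))]
  simp only [h1]
  rw [ENNReal.tsum_mul_left]
  calc _ ≤ 4 * (2 * (n : ℝ≥0∞)) := by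
        gcongr
        exact tsum_midMass_le hu hu1 hK hn
    _ = _ := by ring

theorem midMass_ne_top {u : ℝ → ℂ} (hu1 : ∫⁻ ξ, ‖u ξ‖ₑ ^ 2 ≤ 1) (K : ℝ) (j k : ℤ) :
    midMass u K j k ≠ ∞ := by
  refine ne_top_of_le_ne_top ENNReal.one_ne_top (le_trans ?_ hu1)
  refine (setLIntegral_le_lintegral _ _).trans (lintegral_mono fun ξ => ?_)
  by_cases h : ξ ∈ mid u K j <;> simp [h]

theorem midMass_of_neg {u : ℝ → ℂ} (hu0 : ∀ ξ ≤ 0, u ξ = 0) (K : ℝ) {j k : ℤ} (hk : k < 0) :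
    midMass u K j k = 0 := by
  unfold midMass
  rw [setLIntegral_congr_fun (measurableSet_cell j k) (g := fun _ => 0) fun ξ hξ => ?_]
  · simp
  · simp [Set.indicator, hu0 ξ (cell_neg hk hξ).le]

theorem lt_of_mem_whitney {i : ℤ × ℤ × Bool} {z : ℝ × ℝ} (hz : z ∈ whitney i) : z.1 < z.2 := by
  have h1 := (dist_of_mem_whitney hz).1
  have h2 : (0 : ℝ) < 2 ^ i.1 := by positivity
  linarith

theorem indicator_midPairs_pairDensity {u : ℝ → ℂ} {K : ℝ} {i : ℤ × ℤ × Bool} {z : ℝ × ℝ}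
    (hz : z ∈ whitney i) : (midPairs u K).indicator (pairDensity u) z =
      pairDensity ((mid u K i.1).indicator u) z := by
  by_cases h : z ∈ midPairs u K
  · rw [Set.indicator_of_mem h]
    rw [mem_midPairs_iff hz] at h
    simp [pairDensity, Set.indicator_of_mem h.1, Set.indicator_of_mem h.2]
  · rw [Set.indicator_of_notMem h]
    rw [mem_midPairs_iff hz, Set.mem_prod, not_and_or] at h
    rcases h with h | h <;> simp [pairDensity, Set.indicator_of_notMem h]

/-- On a Whitney square the bilinear extension factors. -/
theorem oscInt_whitney {u : ℝ → ℂ} (hu0 : ∀ ξ ≤ 0, u ξ = 0) (K : ℝ) {i : ℤ × ℤ × Bool}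
    (he : i.2.2 = true → Even i.2.1) (p : ℝ × ℝ) :
    oscInt ((volume.restrict pairs).restrict (whitney i)) curveSum
        ((midPairs u K).indicator (pairDensity u)) p =
      curveExt ((cell i.1 i.2.1).indicator ((mid u K i.1).indicator u)) p *
      curveExt ((cell i.1 (i.2.1 + offset i.2.2)).indicator ((mid u K i.1).indicator u)) p := by
  rw [← oscInt_curveSum_prod _ _ (measurableSet_cell _ _) (measurableSet_cell _ _),
    ← whitney_eq he, Measure.restrict_restrict (measurableSet_whitney i)]
  unfold oscInt
  symm
  rw [setIntegral_eq_of_subset_of_forall_sdiff_eq_zero (s := whitney i ∩ pairs)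
    (measurableSet_whitney i) Set.inter_subset_left]
  · refine setIntegral_congr_fun ((measurableSet_whitney i).inter measurableSet_pairs)
      fun z hz => ?_
    simp only [indicator_midPairs_pairDensity hz.1]
    rfl
  · intro z hz
    have h1 : z.1 ≤ 0 := by
      by_contra hc
      exact hz.2 ⟨hz.1, not_le.1 hc, lt_of_mem_whitney hz.1⟩
    simp [Set.indicator, hu0 _ h1]

/-- The weighted `L²` norm of the bilinear density on a Whitney square. -/
theorem lintegral_whitney_le {u : ℝ → ℂ} (hu : Measurable u)
    (hu1 : ∫⁻ ξ, ‖u ξ‖ₑ ^ 2 ≤ 1) (K : ℝ) (i : ℤ × ℤ × Bool) :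
    ∫⁻ z in whitney i, ‖(midPairs u K).indicator (pairDensity u) z‖ₑ ^ 2 /
        ENNReal.ofReal (jac z) ∂(volume.restrict pairs) ≤
      ENNReal.ofReal (4 / ((2 : ℝ) ^ i.1 * wt (cellCenter i.1 (i.2.1 + offset i.2.2)) ^ 2) *
        ((midMass u K i.1 i.2.1).toReal * (midMass u K i.1 (i.2.1 + offset i.2.2)).toReal)) := by
  by_cases he : i.2.2 = true → Even i.2.1
  swap
  · simp [whitney_eq_empty he]
  set j := i.1
  set k := i.2.1
  set l := i.2.1 + offset i.2.2 with hl
  set g := (mid u K j).indicator u with hg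
  have hgm : Measurable g := hu.indicator (measurableSet_mid hu K j)
  have hwc := wt_nonneg (cellCenter j l)
  rw [Measure.restrict_restrict (measurableSet_whitney i)]
  have hpt : ∀ z ∈ whitney i ∩ pairs, ‖(midPairs u K).indicator (pairDensity u) z‖ₑ ^ 2 /
      ENNReal.ofReal (jac z) ≤ ENNReal.ofReal (4 / ((2 : ℝ) ^ j * wt (cellCenter j l) ^ 2)) *
        (‖g z.1‖ₑ ^ 2 * ‖g z.2‖ₑ ^ 2) := by
    rintro z ⟨hz, hzp⟩
    have hdist := (dist_of_mem_whitney hz).1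
    rw [indicator_midPairs_pairDensity hz]
    have hz' := hz
    rw [whitney_eq he] at hz'
    have hk : 0 ≤ k := by
      by_contra hc
      have := cell_neg (not_le.1 hc) hz'.1
      linarith [hzp.1]
    -- The right side of the square is at least two cells away from `0`, so the weight there is
    -- comparable to its value at the center, also from below.
    have hl1 : 1 ≤ l := by
      rw [hl]
      unfold offset
      cases i.2.2 <;> simp <;> omega
    have hwt := wt_center_le_of_mem_cell hl1 hz'.2
    have hcpos := wt_pos (cellCenter_pos (j := j) (k := l) (by omega))
    have hjac := jac_ge hzp
    have hjpos := jac_pos hzp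
    have hW : 0 < wt z.2 := wt_pos (hzp.1.trans hzp.2)
    have hden := norm_pairDensity_le hzp g
    have hs : (0 : ℝ) < 2 ^ j := by positivity
    rw [← ofReal_norm, ← ofReal_norm, ← ofReal_norm, ← ENNReal.ofReal_pow (norm_nonneg _),
      ← ENNReal.ofReal_pow (norm_nonneg _), ← ENNReal.ofReal_pow (norm_nonneg _),
      ← ENNReal.ofReal_mul (by positivity), ← ENNReal.ofReal_mul (by positivity),
      ← ENNReal.ofReal_div_of_pos hjpos]
    apply ENNReal.ofReal_le_ofReal
    have hjac2 : (2 : ℝ) ^ j * wt z.2 ^ 6 ≤ jac z := le_trans (by gcongr) hjac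
    calc _ ≤ (wt z.2 ^ 2 * (‖g z.1‖ * ‖g z.2‖)) ^ 2 / ((2 : ℝ) ^ j * wt z.2 ^ 6) := by
          gcongr
      _ = 4 / ((2 : ℝ) ^ j * (2 * wt z.2) ^ 2) * (‖g z.1‖ ^ 2 * ‖g z.2‖ ^ 2) := by
          field_simp
          ring
      _ ≤ _ := by gcongr
  refine (setLIntegral_mono' ((measurableSet_whitney i).inter measurableSet_pairs) hpt).trans ?_
  refine (lintegral_mono_set Set.inter_subset_left).trans ?_
  rw [whitney_eq he, lintegral_const_mul' _ _ (by simp), Measure.volume_eq_prod,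
    ← Measure.prod_restrict, lintegral_prod_mul (f := fun ξ => ‖g ξ‖ₑ ^ 2)
      (g := fun ξ => ‖g ξ‖ₑ ^ 2) (by fun_prop) (by fun_prop),
    ENNReal.ofReal_mul (by positivity), ENNReal.ofReal_mul (by positivity),
    ENNReal.ofReal_toReal (midMass_ne_top hu1 K _ _),
    ENNReal.ofReal_toReal (midMass_ne_top hu1 K _ _)]
  rfl

/-- The `L³` bound for the part of the bilinear extension with comparable heights. -/
theorem lintegral_oscInt_midPairs_le {u : ℝ → ℂ} (hu : Measurable u) (hu0 : ∀ ξ ≤ 0, u ξ = 0)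
    (hi : Integrable fun ξ => (wt ξ : ℂ) * u ξ) (hu1 : ∫⁻ ξ, ‖u ξ‖ₑ ^ 2 ≤ 1)
    {K : ℝ} (hK : 0 < K) {n : ℕ} (hn : K ^ 4 < 2 ^ n) (hn0 : 0 < n) {A : ℝ} (hA0 : 0 ≤ A)
    (hA : ∀ j k : ℤ, 0 ≤ k → ∀ p, ‖curveExt ((cell j k).indicator u) p‖ ≤
      A * (wt (cellCenter j k) * √((2 : ℝ) ^ j))) :
    ∫⁻ p, ‖oscInt (volume.restrict pairs) curveSum
        ((midPairs u K).indicator (pairDensity u)) p‖ₑ ^ 3 ≤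
      ENNReal.ofReal (48 * (2 * Real.pi) ^ 2 * ((A + 4 / K) * (8 * n)) ^ 2) := by
  have hint : Integrable (pairDensity u) := hi.mul_prod hi
  set B := A + 4 / K with hB
  have hB0 : 0 < B := by positivity
  -- Here `a` is the product of the `L^∞` bounds for the two sides and `b` the Plancherel bound on
  -- the square. The powers of `2^j` cancel in `a b`, and `√(a b) = 2B √(G G') √(w / w')`, where
  -- `G`, `G'` are the masses and `w ≤ w'` the weights at the centers. This is at most `B (G + G')`.
  refine lintegral_oscInt_cube_le_partition isDominatedParam_curveSum
    ((hint.indicator (measurableSet_midPairs hu K)).integrableOn)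
    measurableSet_whitney pairwise_disjoint_whitney ?_
    (a := fun i => (B * (wt (cellCenter i.1 i.2.1) * √((2 : ℝ) ^ i.1))) *
      (B * (wt (cellCenter i.1 (i.2.1 + offset i.2.2)) * √((2 : ℝ) ^ i.1))))
    (b := fun i => 4 / ((2 : ℝ) ^ i.1 * wt (cellCenter i.1 (i.2.1 + offset i.2.2)) ^ 2) *
        ((midMass u K i.1 i.2.1).toReal * (midMass u K i.1 (i.2.1 + offset i.2.2)).toReal))
    (fun i => ?_) (fun i => by positivity) (fun i p => ?_)
    (lintegral_whitney_le hu hu1 K) (by positivity) ?_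
  · filter_upwards [ae_restrict_mem measurableSet_pairs] with z hz
    exact Set.mem_iUnion.2 (exists_mem_whitney hz)
  · have h1 := wt_nonneg (cellCenter i.1 i.2.1)
    have h2 := wt_nonneg (cellCenter i.1 (i.2.1 + offset i.2.2))
    positivity
  · have h1 := wt_nonneg (cellCenter i.1 i.2.1)
    have h2 := wt_nonneg (cellCenter i.1 (i.2.1 + offset i.2.2))
    by_cases he : i.2.2 = true → Even i.2.1
    · rw [oscInt_whitney hu0 K he, norm_mul]
      by_cases hk : 0 ≤ i.2.1
      · have hl : 0 ≤ i.2.1 + offset i.2.2 := by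
          unfold offset
          cases i.2.2 <;> simp <;> omega
        gcongr
        · exact norm_curveExt_mid_le hu hi hu1 hK (hA _ _ hk p)
        · exact norm_curveExt_mid_le hu hi hu1 hK (hA _ _ hl p)
      · have h3 : (cell i.1 i.2.1).indicator ((mid u K i.1).indicator u) = 0 := by
          funext ξ
          by_cases h : ξ ∈ cell i.1 i.2.1
          · have := hu0 ξ (cell_neg (not_le.1 hk) h).le
            simp [Set.indicator, this]
          · simp [h]
        rw [h3]
        have h4 : curveExt 0 p = 0 := by simp [curveExt, oscInt]
        rw [h4, norm_zero, zero_mul]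
        positivity
    · rw [whitney_eq_empty he]
      simp only [oscInt, Measure.restrict_empty, integral_zero_measure, norm_zero]
      positivity
  · have hle (i : ℤ × ℤ × Bool) :
        ENNReal.ofReal (√((B * (wt (cellCenter i.1 i.2.1) * √((2 : ℝ) ^ i.1))) *
          (B * (wt (cellCenter i.1 (i.2.1 + offset i.2.2)) * √((2 : ℝ) ^ i.1))) *
          (4 / ((2 : ℝ) ^ i.1 * wt (cellCenter i.1 (i.2.1 + offset i.2.2)) ^ 2) *
          ((midMass u K i.1 i.2.1).toReal *
            (midMass u K i.1 (i.2.1 + offset i.2.2)).toReal)))) ≤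
        ENNReal.ofReal B *
          (midMass u K i.1 i.2.1 + midMass u K i.1 (i.2.1 + offset i.2.2)) := by
      by_cases hk : 0 ≤ i.2.1
      · have hoff : 0 ≤ offset i.2.2 := by
          unfold offset
          cases i.2.2 <;> simp
        have hl : 0 ≤ i.2.1 + offset i.2.2 := by omega
        rw [← ENNReal.ofReal_toReal (midMass_ne_top hu1 K i.1 i.2.1),
          ← ENNReal.ofReal_toReal (midMass_ne_top hu1 K i.1 (i.2.1 + offset i.2.2)),
          ← ENNReal.ofReal_add (by positivity) (by positivity),
          ← ENNReal.ofReal_mul hB0.le, ENNReal.toReal_ofReal (by positivity),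
          ENNReal.toReal_ofReal (by positivity)]
        apply ENNReal.ofReal_le_ofReal
        have hG : 0 ≤ (midMass u K i.1 i.2.1).toReal := by positivity
        have hG' : 0 ≤ (midMass u K i.1 (i.2.1 + offset i.2.2)).toReal := by positivity
        have hwl := wt_pos (cellCenter_pos (j := i.1) hl)
        have hwk := wt_pos (cellCenter_pos (j := i.1) hk)
        have hww : wt (cellCenter i.1 i.2.1) ≤ wt (cellCenter i.1 (i.2.1 + offset i.2.2)) := by
          apply wt_le_wt
          rw [abs_of_pos (cellCenter_pos hk), abs_of_pos (cellCenter_pos hl)]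
          unfold cellCenter
          have : (0 : ℝ) ≤ offset i.2.2 := by exact_mod_cast hoff
          push_cast
          gcongr
          linarith
        have hs : (0 : ℝ) < 2 ^ i.1 := by positivity
        have hss := Real.sq_sqrt hs.le
        have hsp := Real.sqrt_pos.2 hs
        generalize (midMass u K i.1 i.2.1).toReal = G at *
        generalize (midMass u K i.1 (i.2.1 + offset i.2.2)).toReal = G' at *
        generalize wt (cellCenter i.1 i.2.1) = w at *
        generalize wt (cellCenter i.1 (i.2.1 + offset i.2.2)) = w' at *
        generalize √((2 : ℝ) ^ i.1) = r at *
        refine Real.sqrt_le_iff.2 ⟨by positivity, ?_⟩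
        rw [← hss]
        calc _ = B ^ 2 * (4 * (G * G')) * (w / w') := by field_simp
          _ ≤ B ^ 2 * (4 * (G * G')) * 1 := by
              gcongr
              exact (div_le_one hwl).2 hww
          _ ≤ _ := by
              rw [mul_pow, mul_one]
              gcongr
              nlinarith [sq_nonneg (G - G')]
      · rw [midMass_of_neg hu0 K (not_le.1 hk)]
        simp
    refine (ENNReal.tsum_le_tsum hle).trans ?_
    rw [ENNReal.tsum_mul_left, ENNReal.ofReal_mul hB0.le]
    gcongr
    refine (tsum_whitney_midMass_le hu hu1 hK hn).trans_eq ?_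
    rw [ENNReal.ofReal_mul (by norm_num)]
    simp

/-! ### The refined `L⁶` bound for densities on the line. -/

theorem enorm_add_pow_le (x y : ℂ) (n : ℕ) :
    ‖x + y‖ₑ ^ (n + 1) ≤ 2 ^ n * (‖x‖ₑ ^ (n + 1) + ‖y‖ₑ ^ (n + 1)) := by
  refine (pow_le_pow_left' (enorm_add_le x y) _).trans ?_
  have h := ENNReal.rpow_add_le_mul_rpow_add_rpow ‖x‖ₑ ‖y‖ₑ (p := (n + 1 : ℕ))
    (by simp)
  simp only [ENNReal.rpow_natCast] at h
  refine h.trans_eq ?_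
  congr 1
  push_cast
  rw [add_sub_cancel_right, ENNReal.rpow_natCast]

/-- A constant for the `L⁶` bound of the extension of normalized densities. -/
def extConst : ℝ := 32 * (48 * (2 * Real.pi) ^ 2) * (4896 ^ 2 + 17 ^ 2)

theorem extConst_pos : 0 < extConst := by
  unfold extConst
  positivity

/-- With `L = 2^m` and `K = L⁴`, both the comparable and the incomparable part have parameter `N =
O(1 / L)` in the `L³` bounds, which are quadratic in `N`. -/
theorem lintegral_curveExt_pow_six_le_of_normalized {u : ℝ → ℂ} (hu : Measurable u)
    (hu0 : ∀ ξ ≤ 0, u ξ = 0) (hi : Integrable fun ξ => (wt ξ : ℂ) * u ξ)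
    (hu1 : ∫⁻ ξ, ‖u ξ‖ₑ ^ 2 ≤ 1) {m : ℕ} (hm : 1 ≤ m)
    (hA : ∀ j k : ℤ, 0 ≤ k → ∀ p, ‖curveExt ((cell j k).indicator u) p‖ ≤
      32 / ((2 : ℝ) ^ m) ^ 4 * (wt (cellCenter j k) * √((2 : ℝ) ^ j))) :
    ∫⁻ p, ‖curveExt u p‖ₑ ^ 6 ≤ ENNReal.ofReal (extConst / ((2 : ℝ) ^ m) ^ 2) := by
  set L : ℝ := 2 ^ m with hL
  have hL2 : 2 ≤ L := by
    calc (2 : ℝ) = 2 ^ 1 := by norm_num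
      _ ≤ 2 ^ m := pow_le_pow_right₀ (by norm_num) hm
  have hL0 : 0 < L := by linarith
  have hint : Integrable (pairDensity u) := hi.mul_prod hi
  have hP := measurableSet_midPairs hu (L ^ 4)
  set hmain := (midPairs u (L ^ 4)).indicator (pairDensity u)
  set hrest := (midPairs u (L ^ 4))ᶜ.indicator (pairDensity u)
  have him : Integrable hmain (volume.restrict pairs) := (hint.indicator hP).integrableOn
  have hir : Integrable hrest (volume.restrict pairs) := (hint.indicator hP.compl).integrableOn
  have hsplit (p : ℝ × ℝ) : oscInt (volume.restrict pairs) curveSum (pairDensity u) p =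
      oscInt (volume.restrict pairs) curveSum hmain p +
      oscInt (volume.restrict pairs) curveSum hrest p := by
    rw [← oscInt_add measurable_curveSum him hir]
    congr 1
    exact (Set.indicator_self_add_compl _ _).symm
  have hpt (p : ℝ × ℝ) : ‖curveExt u p‖ₑ ^ 6 ≤
      32 * ‖oscInt (volume.restrict pairs) curveSum hmain p‖ₑ ^ 3 +
      32 * ‖oscInt (volume.restrict pairs) curveSum hrest p‖ₑ ^ 3 := by
    have h1 : ‖curveExt u p‖ₑ ^ 6 = ‖curveExt u p ^ 2‖ₑ ^ 3 := by
      rw [enorm_pow, ← pow_mul]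
    have h2 := curveExt_sq hu0 hi p
    change curveExt u p ^ 2 = 2 * oscInt (volume.restrict pairs) curveSum (pairDensity u) p at h2
    have h3 : ‖(2 : ℂ)‖ₑ = 2 := by
      rw [← ofReal_norm]
      simp
    rw [h1, h2, hsplit, enorm_mul, mul_pow, h3]
    calc _ ≤ 2 ^ 3 * (2 ^ 2 * (‖oscInt (volume.restrict pairs) curveSum hmain p‖ₑ ^ 3 +
          ‖oscInt (volume.restrict pairs) curveSum hrest p‖ₑ ^ 3)) := by
          gcongr
          exact enorm_add_pow_le _ _ 2
      _ = _ := by ring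
  -- `K⁴ = L¹⁶ = 2^{16m}`, so `n = 16m + 1` scales suffice.
  have hn : (L ^ 4) ^ 4 < 2 ^ (16 * m + 1) := by
    rw [hL, ← pow_mul, ← pow_mul]
    exact pow_lt_pow_right₀ (by norm_num) (by omega)
  have hmainle := lintegral_oscInt_midPairs_le hu hu0 hi hu1 (by positivity : 0 < L ^ 4) hn
    (by omega) (by positivity : 0 ≤ 32 / L ^ 4) hA
  have hrestle := lintegral_oscInt_cube_le_hausdorffYoung isDominatedParam_curveSum hir
    ((measurable_pairDensity hu).indicator hP.compl) (by positivity : 0 < 17 / L)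
    (lintegral_rest_le hu hu1 hL2)
  have hcm := (continuous_oscInt measurable_curveSum him).measurable
  have hcr := (continuous_oscInt measurable_curveSum hir).measurable
  refine (lintegral_mono hpt).trans ?_
  rw [lintegral_add_left (by fun_prop), lintegral_const_mul' _ _ (by simp),
    lintegral_const_mul' _ _ (by simp)]
  refine (add_le_add (mul_le_mul_right hmainle _) (mul_le_mul_right hrestle _)).trans ?_
  rw [show (32 : ℝ≥0∞) = ENNReal.ofReal 32 by simp, ← ENNReal.ofReal_mul (by norm_num),
    ← ENNReal.ofReal_mul (by norm_num), ← ENNReal.ofReal_add (by positivity) (by positivity)]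
  apply ENNReal.ofReal_le_ofReal
  have hmL : (m : ℝ) ≤ L := by
    rw [hL]
    exact_mod_cast Nat.lt_two_pow_self.le
  -- The logarithm `m ≤ L` is absorbed by one power of `L`; `4896 = 36 · 8 · 17`.
  have h1 : (32 / L ^ 4 + 4 / L ^ 4) * (8 * ((16 * m + 1 : ℕ) : ℝ)) ≤ 4896 / L := by
    push_cast
    calc (32 / L ^ 4 + 4 / L ^ 4) * (8 * (16 * (m : ℝ) + 1)) ≤
        (32 / L ^ 4 + 4 / L ^ 4) * (8 * (16 * L + L)) := by
          gcongr
          linarith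
      _ = 4896 / L ^ 3 := by
          field_simp
          ring
      _ ≤ 4896 / L ^ 1 := by
          gcongr
          · linarith
          · norm_num
      _ = _ := by rw [pow_one]
  calc _ ≤ 32 * (48 * (2 * Real.pi) ^ 2 * (4896 / L) ^ 2) +
      32 * (48 * (2 * Real.pi) ^ 2 * (17 / L) ^ 2) := by gcongr
    _ = _ := by
      unfold extConst
      field_simp

/-- The trivial bound for the extension from a dyadic interval. -/
theorem norm_curveExt_cell_le {u : ℝ → ℂ} {M : ℝ} (hM : 0 < M)
    (hu1 : ∫⁻ ξ, ‖u ξ‖ₑ ^ 2 ≤ ENNReal.ofReal (M ^ 2))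
    (j k : ℤ) (p : ℝ × ℝ) : ‖curveExt ((cell j k).indicator u) p‖ ≤
      2 * M * (wt (cellCenter j k) * √((2 : ℝ) ^ j)) := by
  have hw := wt_nonneg (cellCenter j k)
  have hC := measurableSet_cell j k
  set s : ℝ := (2 : ℝ) ^ j with hs
  have hs0 : 0 < s := by positivity
  have hss : 0 < √s := Real.sqrt_pos.2 hs0
  refine norm_le_of_enorm_le (by positivity) ((enorm_curveExt_le _ _).trans ?_)
  have h1 : ∫⁻ ξ, ENNReal.ofReal (wt ξ) * ‖(cell j k).indicator u ξ‖ₑ ≤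
      ∫⁻ ξ in cell j k, ENNReal.ofReal (2 * wt (cellCenter j k)) *
        (ENNReal.ofReal (M / (2 * √s)) + ENNReal.ofReal (√s / (2 * M)) * ‖u ξ‖ₑ ^ 2) := by
    rw [← lintegral_indicator hC]
    refine lintegral_mono fun ξ => ?_
    by_cases h : ξ ∈ cell j k
    · simp only [Set.indicator_of_mem h]
      gcongr
      · exact wt_le_of_mem_cell h
      · rw [← ofReal_norm, ← ENNReal.ofReal_pow (norm_nonneg _),
          ← ENNReal.ofReal_mul (by positivity),
          ← ENNReal.ofReal_add (by positivity) (by positivity)]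
        apply ENNReal.ofReal_le_ofReal
        -- Pointwise AM–GM, balanced for a cell of length `s` and mass `M²`, takes the place of
        -- Cauchy–Schwarz.
        have h2 : M / (2 * √s) + √s / (2 * M) * ‖u ξ‖ ^ 2 - ‖u ξ‖ =
            (√s * ‖u ξ‖ - M) ^ 2 / (2 * √s * M) := by
          field_simp
          ring
        have h3 : 0 ≤ (√s * ‖u ξ‖ - M) ^ 2 / (2 * √s * M) := by positivity
        linarith
    · simp [h]
  refine h1.trans ?_
  rw [lintegral_const_mul' _ _ ENNReal.ofReal_ne_top, lintegral_add_left measurable_const,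
    lintegral_const_mul' _ _ ENNReal.ofReal_ne_top, setLIntegral_const, volume_cell]
  calc _ ≤ ENNReal.ofReal (2 * wt (cellCenter j k)) * (ENNReal.ofReal (M / (2 * √s)) *
      ENNReal.ofReal s + ENNReal.ofReal (√s / (2 * M)) * ENNReal.ofReal (M ^ 2)) := by
        gcongr
        exact (setLIntegral_le_lintegral _ _).trans hu1
    _ = _ := by
        rw [← ENNReal.ofReal_mul (by positivity), ← ENNReal.ofReal_mul (by positivity),
          ← ENNReal.ofReal_add (by positivity) (by positivity),
          ← ENNReal.ofReal_mul (by positivity)]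
        congr 1
        have h2 := Real.sq_sqrt hs0.le
        generalize √s = r at *
        rw [← h2]
        field_simp
        ring

theorem curveExt_const_mul (c : ℂ) (u : ℝ → ℂ) (p : ℝ × ℝ) :
    curveExt (fun ξ => c * u ξ) p = c * curveExt u p := by
  unfold curveExt oscInt
  rw [← integral_const_mul]
  refine integral_congr_ae (ae_of_all _ fun ξ => ?_)
  simp only
  ring

/-- The refined `L⁶` bound for densities on `(0, ∞)`. -/
theorem lintegral_curveExt_pow_six_le_of_pos {u : ℝ → ℂ} (hu : Measurable u)
    (hu0 : ∀ ξ ≤ 0, u ξ = 0) (hi : Integrable fun ξ => (wt ξ : ℂ) * u ξ) {M : ℝ} (hM : 0 < M)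
    (hu1 : ∫⁻ ξ, ‖u ξ‖ₑ ^ 2 ≤ ENNReal.ofReal (M ^ 2)) {A : ℝ} (hA0 : 0 < A)
    (hA : ∀ j k : ℤ, 0 ≤ k → ∀ p, ‖curveExt ((cell j k).indicator u) p‖ ≤
      A * (wt (cellCenter j k) * √((2 : ℝ) ^ j))) :
    ∫⁻ p, ‖curveExt u p‖ₑ ^ 6 ≤ ENNReal.ofReal (extConst * (M ^ 6 * √(A / M))) := by
  set c : ℂ := ((M⁻¹ : ℝ) : ℂ) with hc
  have hcn : ‖c‖ = M⁻¹ := by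
    rw [hc, Complex.norm_real, Real.norm_of_nonneg (by positivity)]
  have hce : ‖c‖ₑ = ENNReal.ofReal M⁻¹ := by rw [← ofReal_norm, hcn]
  set v : ℝ → ℂ := fun ξ => c * u ξ with hv
  have hvm : Measurable v := by fun_prop
  have hv0 : ∀ ξ ≤ 0, v ξ = 0 := fun ξ hξ => by simp [hv, hu0 ξ hξ]
  have hvi : Integrable fun ξ => (wt ξ : ℂ) * v ξ := by
    refine (hi.const_mul c).congr (ae_of_all _ fun ξ => ?_)
    simp only [hv]
    ring
  have hv1 : ∫⁻ ξ, ‖v ξ‖ₑ ^ 2 ≤ 1 := by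
    simp only [hv, enorm_mul, mul_pow]
    rw [lintegral_const_mul' _ _ (by simp), hce]
    calc _ ≤ ENNReal.ofReal M⁻¹ ^ 2 * ENNReal.ofReal (M ^ 2) := by gcongr
      _ = 1 := by
        rw [← ENNReal.ofReal_pow (by positivity), ← ENNReal.ofReal_mul (by positivity)]
        simp [hM.ne']
  have hvc (j k : ℤ) (p : ℝ × ℝ) : ‖curveExt ((cell j k).indicator v) p‖ =
      M⁻¹ * ‖curveExt ((cell j k).indicator u) p‖ := by
    rw [← hcn, ← norm_mul, ← curveExt_const_mul]
    congr 2
    funext ξ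
    by_cases h : ξ ∈ cell j k <;> simp [h, hv]
  have hnorm : ∫⁻ p, ‖curveExt v p‖ₑ ^ 6 ≤ ENNReal.ofReal (extConst * √(A / M)) := by
    have hpos := extConst_pos
    -- For `A / M ≤ 2` choose `m = n + 1` with `16^{-m} < A / (2M) ≤ 16^{-n}`, so that `A / M ≤ 32 /
    -- L⁴` and `L^{-2} ≤ √(A / M)`. For `A / M > 2` take `m = 1`: the required bound `32 / 16 = 2`
    -- is then the trivial one.
    rcases le_or_gt (A / M) 2 with h | h
    · obtain ⟨n, hn1, hn2⟩ := exists_nat_pow_near_of_lt_one (x := A / M / 2) (y := 1 / 16)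
        (by positivity) (by linarith) (by norm_num) (by norm_num)
      have h16 : ((2 : ℝ) ^ (n + 1)) ^ 4 = 16 ^ (n + 1) := by
        rw [← pow_mul, mul_comm, pow_mul]
        norm_num
      refine (lintegral_curveExt_pow_six_le_of_normalized hvm hv0 hvi hv1 (m := n + 1) (by omega)
        fun j k hk p => ?_).trans (ENNReal.ofReal_le_ofReal ?_)
      · rw [hvc]
        have hw := wt_nonneg (cellCenter j k)
        have h32 : A / M ≤ 32 / ((2 : ℝ) ^ (n + 1)) ^ 4 := by
          rw [h16, pow_succ]
          rw [one_div, inv_pow] at hn2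
          have : 32 / ((16 : ℝ) ^ n * 16) = 2 * (16 ^ n)⁻¹ := by
            field_simp
            norm_num
          rw [this]
          linarith
        calc _ ≤ M⁻¹ * (A * (wt (cellCenter j k) * √((2 : ℝ) ^ j))) := by
              gcongr
              exact hA j k hk p
          _ = A / M * (wt (cellCenter j k) * √((2 : ℝ) ^ j)) := by ring
          _ ≤ _ := by gcongr
      · rw [div_eq_mul_inv]
        gcongr
        apply Real.le_sqrt_of_sq_le
        rw [inv_pow, ← pow_mul, show 2 * 2 = 4 by norm_num, h16]
        rw [one_div, inv_pow] at hn1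
        have : 0 < A / M := by positivity
        linarith
    · refine (lintegral_curveExt_pow_six_le_of_normalized hvm hv0 hvi hv1 (m := 1) le_rfl
        fun j k hk p => ?_).trans (ENNReal.ofReal_le_ofReal ?_)
      · have := norm_curveExt_cell_le (u := v) one_pos (by simpa using hv1) j k p
        norm_num at this ⊢
        exact this
      · rw [div_eq_mul_inv]
        gcongr
        apply Real.le_sqrt_of_sq_le
        norm_num
        linarith
  have huv (p : ℝ × ℝ) : curveExt u p = (M : ℂ) * curveExt v p := by
    rw [← curveExt_const_mul]
    congr 1
    funext ξ
    simp only [hv, hc]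
    push_cast
    rw [mul_inv_cancel_left₀ (by exact_mod_cast hM.ne')]
  have hMe : ‖(M : ℂ)‖ₑ = ENNReal.ofReal M := by
    rw [← ofReal_norm, Complex.norm_real, Real.norm_of_nonneg hM.le]
  simp_rw [huv, enorm_mul, mul_pow]
  rw [lintegral_const_mul' _ _ (by simp), hMe, ← ENNReal.ofReal_pow hM.le]
  calc _ ≤ ENNReal.ofReal (M ^ 6) * ENNReal.ofReal (extConst * √(A / M)) := by gcongr
    _ = _ := by
      rw [← ENNReal.ofReal_mul (by positivity)]
      congr 1
      ring

/-- Both coordinates of the curve are odd and the weight is even. -/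
theorem curveExt_comp_neg (u : ℝ → ℂ) (p : ℝ × ℝ) :
    curveExt (fun ξ => u (-ξ)) p = curveExt u (-p) := by
  unfold curveExt oscInt
  rw [← integral_neg_eq_self]
  refine integral_congr_ae (ae_of_all _ fun ξ => ?_)
  simp only [neg_neg, wt_neg]
  congr 4
  simp only [curve, Prod.fst_neg, Prod.snd_neg]
  ring

theorem curveExt_congr {u v : ℝ → ℂ} (h : u =ᵐ[volume] v) : curveExt u = curveExt v := by
  funext p
  exact oscInt_congr (h.mono fun ξ hξ => by simp only [hξ]) p

/-- The refined `L⁶` bound. -/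
theorem lintegral_curveExt_pow_six_le {u : ℝ → ℂ} (hu : Measurable u)
    (hi : Integrable fun ξ => (wt ξ : ℂ) * u ξ) {M : ℝ} (hM : 0 < M)
    (hu1 : ∫⁻ ξ, ‖u ξ‖ₑ ^ 2 ≤ ENNReal.ofReal (M ^ 2)) {A : ℝ} (hA0 : 0 < A)
    (hA : ∀ j k : ℤ, ∀ p, ‖curveExt ((cell j k).indicator u) p‖ ≤
      A * (wt (cellCenter j k) * √((2 : ℝ) ^ j))) :
    ∫⁻ p, ‖curveExt u p‖ₑ ^ 6 ≤ ENNReal.ofReal (64 * extConst * (M ^ 6 * √(A / M))) := by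
  have hne : ∀ᵐ ξ : ℝ, ξ ≠ 0 := by simp [ae_iff]
  have hmass (S : Set ℝ) : ∫⁻ ξ, ‖S.indicator u ξ‖ₑ ^ 2 ≤ ENNReal.ofReal (M ^ 2) := by
    refine (lintegral_mono fun ξ => ?_).trans hu1
    by_cases h : ξ ∈ S <;> simp [h]
  set U := (Set.Ioi (0 : ℝ)).indicator u with hU
  set V := (Set.Iio (0 : ℝ)).indicator u with hV
  have hUi := integrable_wt_mul_indicator hi (measurableSet_Ioi (a := (0 : ℝ)))
  have hVi := integrable_wt_mul_indicator hi (measurableSet_Iio (a := (0 : ℝ)))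
  have hUle : ∫⁻ p, ‖curveExt U p‖ₑ ^ 6 ≤ ENNReal.ofReal (extConst * (M ^ 6 * √(A / M))) := by
    refine lintegral_curveExt_pow_six_le_of_pos (hu.indicator measurableSet_Ioi)
      (fun ξ hξ => Set.indicator_of_notMem (by simpa using hξ) _) hUi hM (hmass _) hA0
      fun j k hk p => ?_
    refine le_of_eq_of_le ?_ (hA j k p)
    rw [curveExt_congr]
    filter_upwards [hne] with ξ hξ
    by_cases h : ξ ∈ cell j k
    · have : ξ ∈ Set.Ioi (0 : ℝ) := lt_of_le_of_ne (cell_nonneg hk h) hξ.symm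
      simp only [Set.indicator_of_mem h, Set.indicator_of_mem this]
    · simp [h]
  have hVle : ∫⁻ p, ‖curveExt V p‖ₑ ^ 6 ≤ ENNReal.ofReal (extConst * (M ^ 6 * √(A / M))) := by
    have h1 : ∫⁻ p, ‖curveExt V p‖ₑ ^ 6 = ∫⁻ p, ‖curveExt (fun ξ => V (-ξ)) p‖ₑ ^ 6 := by
      simp_rw [curveExt_comp_neg]
      exact (lintegral_neg_eq_self (μ := volume) fun p : ℝ × ℝ => ‖curveExt V p‖ₑ ^ 6).symm
    rw [h1]
    refine lintegral_curveExt_pow_six_le_of_pos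
      ((hu.indicator measurableSet_Iio).comp measurable_neg)
      (fun ξ hξ => Set.indicator_of_notMem (by simpa using hξ) _) ?_ hM ?_ hA0
      fun j k hk p => ?_
    · refine hVi.comp_neg.congr (ae_of_all _ fun ξ => ?_)
      simp only [wt_neg]
      rfl
    · refine le_of_eq_of_le ?_ (hmass (Set.Iio (0 : ℝ)))
      exact lintegral_neg_eq_self (μ := volume) fun ξ : ℝ => ‖V ξ‖ₑ ^ 2
    · have h2 : wt (cellCenter j k) = wt (cellCenter j (-k - 1)) := by
        rw [← wt_neg]
        congr 1
        unfold cellCenter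
        push_cast
        ring
      rw [h2]
      refine le_of_eq_of_le ?_ (hA j (-k - 1) (-p))
      rw [← curveExt_comp_neg, curveExt_congr]
      have hpt : ∀ᵐ ξ : ℝ, ξ ≠ k * (2 : ℝ) ^ j := by simp [ae_iff]
      have hpt' : ∀ᵐ ξ : ℝ, ξ ≠ (k + 1) * (2 : ℝ) ^ j := by simp [ae_iff]
      filter_upwards [hne, hpt, hpt'] with ξ hξ hξ1 hξ2
      -- Reflection turns a half-open cell into one that is open on the other side, so the end
      -- points are discarded as a null set.
      have hiff : -ξ ∈ cell j (-k - 1) ↔ ξ ∈ cell j k := by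
        simp only [cell, Set.mem_Ico]
        push_cast
        constructor
        · rintro ⟨h3, h4⟩
          exact ⟨by nlinarith, lt_of_le_of_ne (by nlinarith) hξ2⟩
        · rintro ⟨h3, h4⟩
          have := lt_of_le_of_ne h3 hξ1.symm
          exact ⟨by nlinarith, by nlinarith⟩
      by_cases h : ξ ∈ cell j k
      · have h3 : -ξ ∈ Set.Iio (0 : ℝ) := by
          have := lt_of_le_of_ne (cell_nonneg hk h) hξ.symm
          simpa using this
        rw [Set.indicator_of_mem h, Set.indicator_of_mem (hiff.2 h), Function.comp_apply,
          Set.indicator_of_mem h3]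
      · rw [Set.indicator_of_notMem h, Set.indicator_of_notMem (fun h' => h (hiff.1 h'))]
  have hsum (p : ℝ × ℝ) : curveExt u p = curveExt U p + curveExt V p := by
    rw [← curveExt_add hUi hVi]
    refine congrFun (curveExt_congr ?_) p
    filter_upwards [hne] with ξ hξ
    rcases lt_or_gt_of_ne hξ with h | h
    · simp [h, h.le]
    · simp [h, h.le]
  have hUm := (continuous_oscInt measurable_curve hUi).measurable
  have hUm' : Measurable fun p => ‖curveExt U p‖ₑ ^ 6 := hUm.enorm.pow_const 6
  calc _ ≤ ∫⁻ p, 2 ^ 5 * (‖curveExt U p‖ₑ ^ 6 + ‖curveExt V p‖ₑ ^ 6) := by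
        refine lintegral_mono fun p => ?_
        rw [hsum]
        exact enorm_add_pow_le _ _ 5
    _ ≤ 2 ^ 5 * (ENNReal.ofReal (extConst * (M ^ 6 * √(A / M))) +
        ENNReal.ofReal (extConst * (M ^ 6 * √(A / M)))) := by
        rw [lintegral_const_mul' _ _ (by simp), lintegral_add_left hUm']
        gcongr
    _ = _ := by
        have := extConst_pos
        rw [← ENNReal.ofReal_add (by positivity) (by positivity),
          show (2 ^ 5 : ℝ≥0∞) = ENNReal.ofReal 32 by norm_num,
          ← ENNReal.ofReal_mul (by norm_num)]
        congr 1
        ring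

/-! ### From densities to functions in `L²`: norms, the Fourier transform and the dyadic supremum.
-/

theorem eLpNorm_six_le {F : ℝ × ℝ → ℂ} {c : ℝ} (hc : 0 ≤ c)
    (h : ∫⁻ p, ‖F p‖ₑ ^ 6 ≤ ENNReal.ofReal (c ^ 6)) : eLpNorm F 6 volume ≤ ENNReal.ofReal c := by
  rw [eLpNorm_eq_lintegral_rpow_enorm_toReal (by simp) (by simp)]
  have h6 : (6 : ℝ≥0∞).toReal = ((6 : ℕ) : ℝ) := by simp
  simp only [h6, ENNReal.rpow_natCast]
  refine (ENNReal.rpow_le_rpow h (by positivity)).trans_eq ?_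
  rw [ENNReal.ofReal_pow hc, ← ENNReal.rpow_natCast, ← ENNReal.rpow_mul]
  norm_num

/-- The refined `L⁶` bound, in terms of `eLpNorm`. -/
theorem eLpNorm_curveExt_le {u : ℝ → ℂ} (hu : Measurable u)
    (hi : Integrable fun ξ => (wt ξ : ℂ) * u ξ) {M : ℝ} (hM : 0 < M)
    (hu1 : ∫⁻ ξ, ‖u ξ‖ₑ ^ 2 ≤ ENNReal.ofReal (M ^ 2)) {A : ℝ} (hA0 : 0 < A)
    (hA : ∀ j k : ℤ, ∀ p, ‖curveExt ((cell j k).indicator u) p‖ ≤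
      A * (wt (cellCenter j k) * √((2 : ℝ) ^ j))) :
    eLpNorm (curveExt u) 6 volume ≤ ENNReal.ofReal ((64 * extConst) ^ (1 / 6 : ℝ) *
      (A ^ (1 / 12 : ℝ) * M ^ (1 - 1 / 12 : ℝ))) := by
  have hpos := extConst_pos
  refine eLpNorm_six_le (by positivity)
    ((lintegral_curveExt_pow_six_le hu hi hM hu1 hA0 hA).trans_eq ?_)
  congr 1
  rw [mul_pow, mul_pow, ← Real.rpow_natCast, ← Real.rpow_natCast, ← Real.rpow_natCast,
    ← Real.rpow_natCast, ← Real.rpow_mul (by positivity), ← Real.rpow_mul hA0.le,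
    ← Real.rpow_mul hM.le, Real.sqrt_eq_rpow, Real.div_rpow hA0.le hM.le]
  have h1 : M ^ ((6 : ℕ) : ℝ) * (A ^ (1 / 2 : ℝ) / M ^ (1 / 2 : ℝ)) =
      A ^ (1 / 2 : ℝ) * M ^ (((6 : ℕ) : ℝ) - 1 / 2) := by
    rw [Real.rpow_sub hM]
    ring
  rw [h1]
  norm_num

/-- The constant of the `L² → L⁶` bound. -/
def strichartzConst : ℝ := (64 * extConst) ^ (1 / 6 : ℝ) * 2 ^ (1 / 12 : ℝ)

theorem strichartzConst_pos : 0 < strichartzConst := by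
  have := extConst_pos
  unfold strichartzConst
  positivity

/-- The trivial bound on cells makes `A = 2M` always admissible, so the refined estimate contains
the unrefined one. The latter is what gives existence of the limit. -/
theorem eLpNorm_curveExt_le_strichartz {u : ℝ → ℂ} (hu : Measurable u)
    (hi : Integrable fun ξ => (wt ξ : ℂ) * u ξ) {M : ℝ} (hM : 0 < M)
    (hu1 : ∫⁻ ξ, ‖u ξ‖ₑ ^ 2 ≤ ENNReal.ofReal (M ^ 2)) :
    eLpNorm (curveExt u) 6 volume ≤ ENNReal.ofReal (strichartzConst * M) := by
  refine (eLpNorm_curveExt_le hu hi hM hu1 (by positivity : 0 < 2 * M)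
    (norm_curveExt_cell_le hM hu1)).trans_eq ?_
  congr 1
  rw [strichartzConst, Real.mul_rpow (by norm_num) hM.le, mul_assoc, mul_assoc, ← Real.rpow_add hM]
  norm_num

theorem integrable_wt_mul_indicator_Ico {u : ℝ → ℂ} (hu : Measurable u)
    (hu2 : ∫⁻ ξ, ‖u ξ‖ₑ ^ 2 ≠ ∞) (a b : ℝ) :
    Integrable fun ξ => (wt ξ : ℂ) * (Set.Ico a b).indicator u ξ := by
  rw [wt_mul_indicator, integrable_indicator_iff measurableSet_Ico]
  have h1 : MemLp u 2 (volume.restrict (Set.Ico a b)) := by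
    refine ⟨hu.aestronglyMeasurable, ?_⟩
    rw [eLpNorm_lt_top_iff_lintegral_rpow_enorm_lt_top (by simp) (by simp)]
    have : (2 : ℝ≥0∞).toReal = ((2 : ℕ) : ℝ) := by simp
    simp only [this, ENNReal.rpow_natCast]
    exact (setLIntegral_le_lintegral _ _).trans_lt hu2.lt_top
  have h2 : Integrable u (volume.restrict (Set.Ico a b)) := h1.integrable (by norm_num)
  have hm := measurable_wt
  refine h2.bdd_mul (c := wt (max |a| |b|))
    (by fun_prop) ?_
  filter_upwards [ae_restrict_mem measurableSet_Ico] with ξ hξ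
  rw [Complex.norm_real, Real.norm_of_nonneg (wt_nonneg _)]
  refine wt_le_wt (le_trans ?_ (le_abs_self _))
  exact abs_le_max_abs_abs hξ.1 hξ.2.le

theorem measurable_hat (f : L2) : Measurable (hat f) := by
  have h := (Lp.stronglyMeasurable (𝓕 f : L2)).measurable
  unfold hat
  fun_prop

theorem lintegral_hat_sq (f : L2) :
    ∫⁻ ξ, ‖hat f ξ‖ₑ ^ 2 = ENNReal.ofReal ((√(2 * Real.pi) * ‖f‖) ^ 2) := by
  have hm := (Lp.stronglyMeasurable (𝓕 f : L2)).measurable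
  have hpi : (2 * Real.pi) ≠ 0 := by positivity
  have h1 : ∫⁻ ξ, ‖hat f ξ‖ₑ ^ 2 = ∫⁻ ζ, ‖(𝓕 f : L2) ζ‖ₑ ^ 2
      ∂(Measure.map (fun ξ : ℝ => (2 * Real.pi)⁻¹ * ξ) volume) := by
    rw [lintegral_map (by fun_prop) (by fun_prop)]
    refine lintegral_congr fun ξ => ?_
    rw [hat, div_eq_inv_mul]
  have h2 : ∫⁻ ζ, ‖(𝓕 f : L2) ζ‖ₑ ^ 2 = ENNReal.ofReal (‖f‖ ^ 2) := by
    have h3 : ‖(𝓕 f : L2)‖ₑ = ENNReal.ofReal ‖f‖ := by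
      rw [← ofReal_norm, Lp.norm_fourier_eq]
    rw [Lp.enorm_def, eLpNorm_eq_lintegral_rpow_enorm_toReal (by simp) (by simp)] at h3
    have h4 : (2 : ℝ≥0∞).toReal = ((2 : ℕ) : ℝ) := by simp
    simp only [h4, ENNReal.rpow_natCast] at h3
    rw [ENNReal.ofReal_pow (norm_nonneg _), ← h3, ← ENNReal.rpow_natCast, ← ENNReal.rpow_mul]
    norm_num
  rw [h1, Real.map_volume_mul_left (inv_ne_zero hpi), lintegral_smul_measure, h2, inv_inv,
    abs_of_pos (by positivity), mul_pow, Real.sq_sqrt (by positivity), smul_eq_mul,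
    ← ENNReal.ofReal_mul (by positivity)]

theorem lintegral_hat_sq_ne_top (f : L2) : ∫⁻ ξ, ‖hat f ξ‖ₑ ^ 2 ≠ ∞ := by
  rw [lintegral_hat_sq]
  exact ENNReal.ofReal_ne_top

theorem extIntegral_freqCut (a b : ℝ) (f : L2) :
    extIntegral (freqCut a b f) =
      (1 / (2 * Real.pi) : ℂ) • curveExt ((Set.Ico a b).indicator (hat f)) := by
  funext p
  rw [extIntegral_eq, curveExt_congr (hat_freqCut a b f)]
  rfl

theorem enorm_one_div_two_pi : ‖(1 / (2 * Real.pi) : ℂ)‖ₑ = ENNReal.ofReal (1 / (2 * Real.pi)) := by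
  rw [← ofReal_norm]
  congr 1
  have : (1 / (2 * Real.pi) : ℂ) = ((1 / (2 * Real.pi) : ℝ) : ℂ) := by push_cast; rfl
  rw [this, Complex.norm_real, Real.norm_of_nonneg (by positivity)]

theorem piece_eq (f : L2) (k j : ℤ) :
    extIntegral (piece f ⟨k, j⟩) =
      (1 / (2 * Real.pi) : ℂ) • curveExt ((cell j k).indicator (hat f)) :=
  extIntegral_freqCut _ _ f

theorem continuous_curveExt_cell (f : L2) (j k : ℤ) :
    Continuous (curveExt ((cell j k).indicator (hat f))) :=
  continuous_oscInt measurable_curve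
    (integrable_wt_mul_indicator_Ico (measurable_hat f) (lintegral_hat_sq_ne_top f) _ _)

theorem cellCenter_ne_zero (j k : ℤ) : cellCenter j k ≠ 0 := by
  refine mul_ne_zero (fun h => ?_) (by positivity)
  have : ((2 * k + 1 : ℤ) : ℝ) = 0 := by
    push_cast
    linarith
  have : 2 * k + 1 = 0 := by exact_mod_cast this
  omega

theorem wt_cellCenter_pos (j k : ℤ) : 0 < wt (cellCenter j k) := by
  refine Real.rpow_pos_of_pos (abs_pos.2 ?_) _
  have h := cellCenter_ne_zero j k
  rw [show cellCenter j k + cellCenter j k ^ 3 = cellCenter j k * (1 + cellCenter j k ^ 2) by ring]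
  exact mul_ne_zero h (by positivity)

theorem dyadic_weight_eq (k j : ℤ) :
    |(⟨k, j⟩ : DyadicInterval).center + (⟨k, j⟩ : DyadicInterval).center ^ 3| ^ (-(1 / 6) : ℝ) *
        (⟨k, j⟩ : DyadicInterval).length ^ (-(1 / 2) : ℝ) =
      (wt (cellCenter j k) * √((2 : ℝ) ^ j))⁻¹ := by
  have h1 : (⟨k, j⟩ : DyadicInterval).center = cellCenter j k := by
    simp only [DyadicInterval.center, DyadicInterval.left, DyadicInterval.right, cellCenter]
    ring
  have h2 : (⟨k, j⟩ : DyadicInterval).length = (2 : ℝ) ^ j := by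
    simp only [DyadicInterval.length, DyadicInterval.left, DyadicInterval.right]
    ring
  rw [h1, h2, Real.rpow_neg (abs_nonneg _), Real.rpow_neg (by positivity), mul_inv,
    Real.sqrt_eq_rpow]
  rfl

/-- The bound holds on a set that is closed by continuity and dense as it has full measure. -/
theorem norm_le_of_eLpNorm_top_le {F : ℝ × ℝ → ℂ} (hF : Continuous F) {b : ℝ≥0∞}
    (h : eLpNorm F ∞ volume ≤ b) (p : ℝ × ℝ) : ‖F p‖ₑ ≤ b := by
  rw [eLpNorm_exponent_top] at h
  have h1 : ∀ᵐ p, ‖F p‖ₑ ≤ b := by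
    filter_upwards [ae_le_eLpNormEssSup (f := F) (μ := volume)] with p hp using hp.trans h
  have h2 : IsClosed {p | ‖F p‖ₑ ≤ b} := isClosed_le hF.enorm continuous_const
  have h3 := (Measure.dense_of_ae h1).closure_eq
  rw [h2.closure_eq] at h3
  have h4 : p ∈ {p | ‖F p‖ₑ ≤ b} := h3.symm ▸ Set.mem_univ p
  exact h4

/-- The dyadic supremum bounds the extension from each dyadic interval. -/
theorem norm_curveExt_cell_le_dyadicSup (f : L2) (hD : dyadicSup f ≠ ∞) (j k : ℤ) (p : ℝ × ℝ) :
    ‖curveExt ((cell j k).indicator (hat f)) p‖ ≤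
      2 * Real.pi * (dyadicSup f).toReal * (wt (cellCenter j k) * √((2 : ℝ) ^ j)) := by
  have hx : 0 < wt (cellCenter j k) * √((2 : ℝ) ^ j) :=
    mul_pos (wt_cellCenter_pos j k) (Real.sqrt_pos.2 (by positivity))
  set x := wt (cellCenter j k) * √((2 : ℝ) ^ j)
  have h1 : ENNReal.ofReal x⁻¹ * eLpNorm (extIntegral (piece f ⟨k, j⟩)) ∞ volume ≤
      dyadicSup f := by
    rw [← dyadic_weight_eq]
    exact le_iSup (fun τ : DyadicInterval =>
      ENNReal.ofReal (|τ.center + τ.center ^ 3| ^ (-(1 / 6) : ℝ) * τ.length ^ (-(1 / 2) : ℝ)) *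
      eLpNorm (extIntegral (piece f τ)) ∞ volume) ⟨k, j⟩
  rw [piece_eq, eLpNorm_const_smul, enorm_one_div_two_pi, ← mul_assoc,
    ← ENNReal.ofReal_mul (by positivity)] at h1
  have h2 : eLpNorm (curveExt ((cell j k).indicator (hat f))) ∞ volume ≤
      ENNReal.ofReal (2 * Real.pi * (dyadicSup f).toReal * x) := by
    calc _ = ENNReal.ofReal (2 * Real.pi * x) * (ENNReal.ofReal (x⁻¹ * (1 / (2 * Real.pi))) *
          eLpNorm (curveExt ((cell j k).indicator (hat f))) ∞ volume) := by
          rw [← mul_assoc, ← ENNReal.ofReal_mul (by positivity)]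
          have : 2 * Real.pi * x * (x⁻¹ * (1 / (2 * Real.pi))) = 1 := by field_simp
          rw [this, ENNReal.ofReal_one, one_mul]
      _ ≤ ENNReal.ofReal (2 * Real.pi * x) * dyadicSup f := by gcongr
      _ = _ := by
          nth_rewrite 1 [← ENNReal.ofReal_toReal hD]
          rw [← ENNReal.ofReal_mul (by positivity)]
          congr 1
          ring
  exact norm_le_of_enorm_le (by positivity)
    (norm_le_of_eLpNorm_top_le (continuous_curveExt_cell f j k) h2 p)

theorem dyadicSup_ne_top (f : L2) : dyadicSup f ≠ ∞ := by
  set M := √(2 * Real.pi) * ‖f‖ + 1 with hM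
  have hM0 : 0 < M := by positivity
  have hu1 : ∫⁻ ξ, ‖hat f ξ‖ₑ ^ 2 ≤ ENNReal.ofReal (M ^ 2) := by
    rw [lintegral_hat_sq]
    gcongr
    linarith
  refine ne_top_of_le_ne_top (ENNReal.ofReal_ne_top (r := 1 / (2 * Real.pi) * (2 * M)))
    (iSup_le fun τ => ?_)
  obtain ⟨k, j⟩ := τ
  have hx : 0 < wt (cellCenter j k) * √((2 : ℝ) ^ j) :=
    mul_pos (wt_cellCenter_pos j k) (Real.sqrt_pos.2 (by positivity))
  rw [dyadic_weight_eq, piece_eq, eLpNorm_const_smul, enorm_one_div_two_pi]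
  have h1 : eLpNorm (curveExt ((cell j k).indicator (hat f))) ∞ volume ≤
      ENNReal.ofReal (2 * M * (wt (cellCenter j k) * √((2 : ℝ) ^ j))) := by
    rw [eLpNorm_exponent_top]
    refine eLpNormEssSup_le_of_ae_enorm_bound (ae_of_all _ fun p => ?_)
    rw [← ofReal_norm]
    exact ENNReal.ofReal_le_ofReal (norm_curveExt_cell_le hM0 hu1 j k p)
  refine (mul_le_mul_right (mul_le_mul_right h1 _) _).trans_eq ?_
  rw [← ENNReal.ofReal_mul (by positivity), ← ENNReal.ofReal_mul (by positivity)]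
  congr 1
  have := wt_cellCenter_pos j k
  field_simp

/-! ### Frequency cut-offs and the limit in `L⁶`. -/

theorem floor_div_zpow_add (x : ℝ) (j : ℤ) (n : ℕ) :
    ⌊x / (2 : ℝ) ^ (j + n)⌋ = ⌊x / (2 : ℝ) ^ j⌋ / 2 ^ n := by
  have h : x / (2 : ℝ) ^ (j + n) = x / (2 : ℝ) ^ j / ((2 ^ n : ℕ) : ℝ) := by
    rw [zpow_add₀ (by norm_num), zpow_natCast, div_div]
    norm_num
  rw [h, Int.floor_div_natCast]
  push_cast
  rfl

/-- A symmetric interval around `0` is not dyadic, but for dyadic radii it is the union of the two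
cells `k = -1` and `k = 0`. -/
theorem mem_Ico_two_pow_iff (m : ℤ) (x : ℝ) :
    x ∈ Set.Ico (-(2 : ℝ) ^ m) ((2 : ℝ) ^ m) ↔
      ⌊x / (2 : ℝ) ^ m⌋ = -1 ∨ ⌊x / (2 : ℝ) ^ m⌋ = 0 := by
  have h0 : (0 : ℝ) < 2 ^ m := by positivity
  rw [← mem_cell_iff, ← mem_cell_iff]
  simp only [cell, Set.mem_Ico]
  push_cast
  constructor
  · rintro ⟨h1, h2⟩
    rcases lt_or_ge x 0 with h | h
    · exact Or.inl ⟨by linarith, by linarith⟩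
    · exact Or.inr ⟨by linarith, by linarith⟩
  · rintro (⟨h1, h2⟩ | ⟨h1, h2⟩)
    · exact ⟨by linarith, by linarith⟩
    · exact ⟨by linarith, by linarith⟩

/-- A cut-off to `[-2^m, 2^m)` preserves the bounds for the extensions from dyadic intervals. -/
theorem norm_curveExt_cell_cut_le {u : ℝ → ℂ} {A : ℝ} (hA0 : 0 ≤ A)
    (hA : ∀ j k : ℤ, ∀ p, ‖curveExt ((cell j k).indicator u) p‖ ≤
      A * (wt (cellCenter j k) * √((2 : ℝ) ^ j))) (m j k : ℤ) (p : ℝ × ℝ) :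
    ‖curveExt ((cell j k).indicator
        ((Set.Ico (-(2 : ℝ) ^ m) ((2 : ℝ) ^ m)).indicator u)) p‖ ≤
      A * (wt (cellCenter j k) * √((2 : ℝ) ^ j)) := by
  rw [Set.indicator_indicator]
  set S := Set.Ico (-(2 : ℝ) ^ m) ((2 : ℝ) ^ m) with hS
  have hempty (h : cell j k ∩ S = ∅) : ‖curveExt ((cell j k ∩ S).indicator u) p‖ ≤
      A * (wt (cellCenter j k) * √((2 : ℝ) ^ j)) := by
    have h0 : curveExt (fun _ => 0) p = 0 := by simp [curveExt, oscInt]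
    rw [h, Set.indicator_empty, h0, norm_zero]
    have := wt_nonneg (cellCenter j k)
    positivity
  rcases le_or_gt j m with hjm | hjm
  · obtain ⟨n, rfl⟩ := Int.le.dest hjm
    by_cases hk : k / 2 ^ n = -1 ∨ k / 2 ^ n = 0
    · have : cell j k ∩ S = cell j k := by
        refine Set.inter_eq_left.2 fun x hx => ?_
        rwa [hS, mem_Ico_two_pow_iff, floor_div_zpow_add, mem_cell_iff.1 hx]
      rw [this]
      exact hA j k p
    · refine hempty (Set.eq_empty_of_forall_notMem fun x hx => hk ?_)
      have h1 := hx.2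
      rwa [hS, mem_Ico_two_pow_iff, floor_div_zpow_add, mem_cell_iff.1 hx.1] at h1
  · obtain ⟨n, rfl⟩ := Int.le.dest hjm.le
    have hdiv {q : ℤ} (hq : q = -1 ∨ q = 0) : q / 2 ^ n = q := by
      have h2 : (0 : ℤ) < 2 ^ n := by positivity
      rcases hq with rfl | rfl
      · exact Int.ediv_eq_neg_one_of_neg_of_le (by norm_num) (by omega)
      · simp
    -- A cell coarser than the cut-off meets it only if it touches `0`. The intersection is then the
    -- cell with the same index at scale `m`, whose length and weight at the center are smaller.
    by_cases hk : k = -1 ∨ k = 0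
    · have hcell : cell (m + n) k ∩ S = cell m k := by
        ext x
        rw [Set.mem_inter_iff, mem_cell_iff, mem_cell_iff, hS, mem_Ico_two_pow_iff,
          floor_div_zpow_add]
        constructor
        · rintro ⟨h1, h2⟩
          rwa [hdiv h2] at h1
        · rintro h
          rw [h]
          exact ⟨hdiv hk, hk⟩
      rw [hcell]
      refine (hA m k p).trans ?_
      have hpow : (2 : ℝ) ^ m ≤ 2 ^ (m + n : ℤ) := zpow_le_zpow_right₀ (by norm_num) hjm.le
      have hw : wt (cellCenter m k) ≤ wt (cellCenter (m + n) k) := by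
        apply wt_le_wt
        simp only [cellCenter, abs_mul]
        rw [abs_of_pos (by positivity : (0 : ℝ) < 2 ^ m),
          abs_of_pos (by positivity : (0 : ℝ) < 2 ^ (m + n : ℤ))]
        gcongr
      have := wt_nonneg (cellCenter (m + n) k)
      gcongr
    · refine hempty (Set.eq_empty_of_forall_notMem fun x hx => hk ?_)
      have h1 := hx.2
      have h2 := mem_cell_iff.1 hx.1
      rw [hS, mem_Ico_two_pow_iff] at h1
      rw [floor_div_zpow_add, hdiv h1] at h2
      rwa [h2] at h1

/-- The integral over `[-R, R)`. -/
def cutExt (f : L2) (R : ℝ) : ℝ × ℝ → ℂ := extIntegral (freqCut (-R) R f)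

theorem cutExt_eq (f : L2) (R : ℝ) : cutExt f R =
    (1 / (2 * Real.pi) : ℂ) • curveExt ((Set.Ico (-R) R).indicator (hat f)) :=
  extIntegral_freqCut _ _ f

theorem lintegral_indicator_hat_sq_le (f : L2) (S : Set ℝ) {M : ℝ}
    (hM : √(2 * Real.pi) * ‖f‖ ≤ M) :
    ∫⁻ ξ, ‖S.indicator (hat f) ξ‖ₑ ^ 2 ≤ ENNReal.ofReal (M ^ 2) := by
  calc _ ≤ ∫⁻ ξ, ‖hat f ξ‖ₑ ^ 2 := by
        refine lintegral_mono fun ξ => ?_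
        by_cases h : ξ ∈ S <;> simp [h]
    _ ≤ _ := by
        rw [lintegral_hat_sq]
        gcongr

theorem memLp_cutExt (f : L2) (R : ℝ) : MemLp (cutExt f R) 6 volume := by
  have hi := integrable_wt_mul_indicator_Ico (measurable_hat f) (lintegral_hat_sq_ne_top f) (-R) R
  rw [cutExt_eq]
  refine MemLp.const_smul ⟨(continuous_oscInt measurable_curve hi).aestronglyMeasurable, ?_⟩ _
  exact (eLpNorm_curveExt_le_strichartz ((measurable_hat f).indicator measurableSet_Ico) hi
    (M := √(2 * Real.pi) * ‖f‖ + 1) (by positivity)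
    (lintegral_indicator_hat_sq_le f _ (by linarith))).trans_lt ENNReal.ofReal_lt_top

theorem tendsto_lintegral_tail (f : L2) :
    Tendsto (fun R : ℝ => ∫⁻ ξ, ‖(Set.Ico (-R) R)ᶜ.indicator (hat f) ξ‖ₑ ^ 2) atTop (𝓝 0) := by
  have h := tendsto_lintegral_filter_of_dominated_convergence (μ := volume) (l := atTop)
    (F := fun (R : ℝ) ξ => ‖(Set.Ico (-R) R)ᶜ.indicator (hat f) ξ‖ₑ ^ 2) (f := fun _ => 0)
    (fun ξ => ‖hat f ξ‖ₑ ^ 2)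
    (Eventually.of_forall fun R =>
      ((measurable_hat f).indicator measurableSet_Ico.compl).enorm.pow_const 2)
    (Eventually.of_forall fun R => ae_of_all _ fun ξ => by
      by_cases h : ξ ∈ (Set.Ico (-R) R)ᶜ
      · rw [Set.indicator_of_mem h]
      · rw [Set.indicator_of_notMem h]
        simp)
    (lintegral_hat_sq_ne_top f)
    (ae_of_all _ fun ξ => by
      refine tendsto_const_nhds.congr' ?_
      filter_upwards [eventually_gt_atTop |ξ|] with R hR
      have h1 := abs_lt.1 hR
      rw [Set.indicator_of_notMem (by simpa using ⟨h1.1.le, h1.2⟩)]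
      simp)
  simpa using h

/-- The difference of two cut-offs is an extension of a density dominated by the tail beyond `R₀`,
so the unrefined bound yields the Cauchy property. -/
theorem eLpNorm_cutExt_sub_le (f : L2) {R₀ R S : ℝ} (hR : R₀ ≤ R) (hS : R₀ ≤ S) {M : ℝ}
    (hM : 0 < M)
    (htail : ∫⁻ ξ, ‖(Set.Ico (-R₀) R₀)ᶜ.indicator (hat f) ξ‖ₑ ^ 2 ≤ ENNReal.ofReal (M ^ 2)) :
    eLpNorm (cutExt f R - cutExt f S) 6 volume ≤ ENNReal.ofReal (strichartzConst * M) := by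
  have hi (R : ℝ) := integrable_wt_mul_indicator_Ico (measurable_hat f)
    (lintegral_hat_sq_ne_top f) (-R) R
  set v : ℝ → ℂ := (Set.Ico (-R) R).indicator (hat f) + fun ξ =>
    (-1 : ℂ) * (Set.Ico (-S) S).indicator (hat f) ξ with hv
  have hvi2 : Integrable fun ξ => (wt ξ : ℂ) *
      ((-1 : ℂ) * (Set.Ico (-S) S).indicator (hat f) ξ) := by
    refine (hi S).neg.congr (ae_of_all _ fun ξ => ?_)
    simp
  have hvi : Integrable fun ξ => (wt ξ : ℂ) * v ξ := by
    refine ((hi R).add hvi2).congr (ae_of_all _ fun ξ => ?_)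
    simp only [hv, Pi.add_apply]
    ring
  have hvm : Measurable v := ((measurable_hat f).indicator measurableSet_Ico).add
    (((measurable_hat f).indicator measurableSet_Ico).const_mul _)
  have hsub : cutExt f R - cutExt f S = (1 / (2 * Real.pi) : ℂ) • curveExt v := by
    funext p
    rw [Pi.sub_apply, cutExt_eq, cutExt_eq, Pi.smul_apply, Pi.smul_apply, Pi.smul_apply, hv,
      curveExt_add (hi R) hvi2, curveExt_const_mul]
    simp only [smul_eq_mul]
    ring
  have hv1 : ∫⁻ ξ, ‖v ξ‖ₑ ^ 2 ≤ ENNReal.ofReal (M ^ 2) := by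
    refine (lintegral_mono fun ξ => ?_).trans htail
    simp only [hv, Pi.add_apply]
    by_cases h0 : ξ ∈ Set.Ico (-R₀) R₀
    · have h1 : ξ ∈ Set.Ico (-R) R := ⟨by linarith [h0.1], by linarith [h0.2]⟩
      have h2 : ξ ∈ Set.Ico (-S) S := ⟨by linarith [h0.1], by linarith [h0.2]⟩
      rw [Set.indicator_of_mem h1, Set.indicator_of_mem h2]
      simp
    · rw [Set.indicator_of_mem (by simpa using h0 : ξ ∈ (Set.Ico (-R₀) R₀)ᶜ)]
      by_cases h1 : ξ ∈ Set.Ico (-R) R <;> by_cases h2 : ξ ∈ Set.Ico (-S) S <;>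
        simp only [Set.indicator_of_mem, Set.indicator_of_notMem, h1, h2, not_false_eq_true] <;>
        simp
  rw [hsub, eLpNorm_const_smul, enorm_one_div_two_pi]
  refine (mul_le_of_le_one_left zero_le ?_).trans
    (eLpNorm_curveExt_le_strichartz hvm hvi hM hv1)
  rw [ENNReal.ofReal_le_one, div_le_one (by positivity)]
  linarith [Real.pi_gt_three]

/-- The extension `Ẽ₅ f` exists in `L⁶`. -/
theorem exists_isExtension (f : L2) : ∃ F, IsExtension f F := by
  have : Fact ((1 : ℝ≥0∞) ≤ 6) := ⟨by norm_num⟩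
  have hC := strichartzConst_pos
  have hcauchy : CauchySeq fun R : ℝ => (memLp_cutExt f R).toLp (cutExt f R) := by
    rw [EMetric.cauchySeq_iff]
    intro ε hε
    obtain ⟨δ, hδ0, hδ⟩ := ENNReal.lt_iff_exists_real_btwn.1 hε
    have hδ1 : 0 < δ := by
      by_contra hc
      rw [ENNReal.ofReal_of_nonpos (not_lt.1 hc)] at hδ
      exact lt_irrefl _ hδ.1
    set M := δ / strichartzConst with hM
    have hM0 : 0 < M := by positivity
    obtain ⟨R₀, hR₀⟩ := ((tendsto_lintegral_tail f).eventually_le_const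
      (ENNReal.ofReal_pos.2 (by positivity : 0 < M ^ 2))).exists
    refine ⟨R₀, fun R hR S hS => ?_⟩
    rw [Lp.edist_toLp_toLp]
    refine (eLpNorm_cutExt_sub_le f hR hS hM0 hR₀).trans_lt ?_
    rw [hM, mul_div_cancel₀ _ hC.ne']
    exact hδ.2
  obtain ⟨F, hF⟩ := cauchySeq_tendsto_of_complete hcauchy
  refine ⟨F, Lp.memLp F, ?_⟩
  rw [← Lp.toLp_coeFn F (Lp.memLp F), Lp.tendsto_Lp_iff_tendsto_eLpNorm''] at hF
  exact hF

/-- The limit is taken along the radii `2^m`, where the cut-offs inherit the dyadic bounds of `f`.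
Adding `ε` keeps `A` and `M` positive even when the supremum or the norm vanishes;
`eLpNorm_le_refined` lets `ε` tend to `0`. -/
theorem eLpNorm_le_of_isExtension {f : L2} {F : ℝ × ℝ → ℂ} (hF : IsExtension f F) {ε : ℝ}
    (hε : 0 < ε) :
    eLpNorm F 6 volume ≤ ENNReal.ofReal ((64 * extConst) ^ (1 / 6 : ℝ) *
      ((2 * Real.pi * (dyadicSup f).toReal + ε) ^ (1 / 12 : ℝ) *
        (√(2 * Real.pi) * ‖f‖ + ε) ^ (1 - 1 / 12 : ℝ))) := by
  set b := ENNReal.ofReal ((64 * extConst) ^ (1 / 6 : ℝ) *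
      ((2 * Real.pi * (dyadicSup f).toReal + ε) ^ (1 / 12 : ℝ) *
        (√(2 * Real.pi) * ‖f‖ + ε) ^ (1 - 1 / 12 : ℝ)))
  have hcut (m : ℕ) : eLpNorm (cutExt f (2 ^ (m : ℤ))) 6 volume ≤ b := by
    rw [cutExt_eq, eLpNorm_const_smul, enorm_one_div_two_pi]
    refine (mul_le_of_le_one_left zero_le ?_).trans
      (eLpNorm_curveExt_le ((measurable_hat f).indicator measurableSet_Ico)
        (integrable_wt_mul_indicator_Ico (measurable_hat f) (lintegral_hat_sq_ne_top f) _ _)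
        (by positivity) (lintegral_indicator_hat_sq_le f _ (by linarith)) (by positivity)
        (norm_curveExt_cell_cut_le (by positivity) (fun j k p => ?_) m))
    · rw [ENNReal.ofReal_le_one, div_le_one (by positivity)]
      linarith [Real.pi_gt_three]
    · refine (norm_curveExt_cell_le_dyadicSup f (dyadicSup_ne_top f) j k p).trans ?_
      have := wt_nonneg (cellCenter j k)
      gcongr
      linarith
  have hlim : Tendsto (fun m : ℕ => eLpNorm (cutExt f (2 ^ (m : ℤ)) - F) 6 volume + b) atTop
      (𝓝 (0 + b)) := by
    refine Tendsto.add_const b (hF.2.comp ?_)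
    simp only [zpow_natCast]
    exact tendsto_pow_atTop_atTop_of_one_lt one_lt_two
  rw [zero_add] at hlim
  refine ge_of_tendsto' hlim fun m => ?_
  have h1 : F = (F - cutExt f (2 ^ (m : ℤ))) + cutExt f (2 ^ (m : ℤ)) := by simp
  calc eLpNorm F 6 volume = eLpNorm ((F - cutExt f (2 ^ (m : ℤ))) + cutExt f (2 ^ (m : ℤ))) 6
        volume := by rw [← h1]
    _ ≤ eLpNorm (F - cutExt f (2 ^ (m : ℤ))) 6 volume + eLpNorm (cutExt f (2 ^ (m : ℤ))) 6
        volume := eLpNorm_add_le (hF.1.sub (memLp_cutExt f _)).aestronglyMeasurable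
          (memLp_cutExt f _).aestronglyMeasurable (by norm_num)
    _ ≤ _ := by
        rw [eLpNorm_sub_comm]
        gcongr
        exact hcut m

/-- The constant of the refined Strichartz estimate. -/
def refinedConst : ℝ :=
  (64 * extConst) ^ (1 / 6 : ℝ) *
    ((2 * Real.pi) ^ (1 / 12 : ℝ) * √(2 * Real.pi) ^ (1 - 1 / 12 : ℝ))

theorem eLpNorm_le_refined {f : L2} {F : ℝ × ℝ → ℂ} (hF : IsExtension f F) :
    eLpNorm F 6 volume ≤ ENNReal.ofReal refinedConst * dyadicSup f ^ (1 / 12 : ℝ) *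
      eLpNorm f 2 volume ^ (1 - 1 / 12 : ℝ) := by
  have hpos := extConst_pos
  set d := (dyadicSup f).toReal with hd
  have hd0 : 0 ≤ d := ENNReal.toReal_nonneg
  have hcont : Continuous fun ε : ℝ => ENNReal.ofReal ((64 * extConst) ^ (1 / 6 : ℝ) *
      ((2 * Real.pi * d + ε) ^ (1 / 12 : ℝ) *
        (√(2 * Real.pi) * ‖f‖ + ε) ^ (1 - 1 / 12 : ℝ))) := by
    refine ENNReal.continuous_ofReal.comp (continuous_const.mul (Continuous.mul ?_ ?_))
    · exact (continuous_const.add continuous_id).rpow_const fun _ => Or.inr (by norm_num)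
    · exact (continuous_const.add continuous_id).rpow_const fun _ => Or.inr (by norm_num)
  have hlim := (hcont.tendsto 0).mono_left (nhdsWithin_le_nhds (s := Set.Ioi 0))
  have h1 := ge_of_tendsto hlim (eventually_nhdsWithin_of_forall fun ε hε =>
    eLpNorm_le_of_isExtension hF hε)
  refine h1.trans_eq ?_
  have h2 : eLpNorm f 2 volume = ENNReal.ofReal ‖f‖ := by
    rw [← Lp.enorm_def, ofReal_norm]
  rw [h2, ← ENNReal.ofReal_toReal (dyadicSup_ne_top f), ← hd,
    ENNReal.ofReal_rpow_of_nonneg hd0 (by norm_num),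
    ENNReal.ofReal_rpow_of_nonneg (norm_nonneg _) (by norm_num),
    ← ENNReal.ofReal_mul (by unfold refinedConst; positivity),
    ← ENNReal.ofReal_mul (by unfold refinedConst; positivity)]
  congr 1
  rw [add_zero, add_zero, Real.mul_rpow (by positivity) hd0,
    Real.mul_rpow (by positivity) (norm_nonneg _), refinedConst]
  ring

end RefinedStrichartz

end

theorem propositionP :
    ∃ θ : ℝ, 0 < θ ∧ θ < 1 ∧ ∃ C : ℝ≥0, ∀ f : RefinedStrichartz.L2,
      ∃ F : ℝ × ℝ → ℂ, RefinedStrichartz.IsExtension f F ∧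
        eLpNorm F 6 volume ≤
          C * RefinedStrichartz.dyadicSup f ^ θ * eLpNorm f 2 volume ^ (1 - θ) := by
  refine ⟨1 / 12, by norm_num, by norm_num, RefinedStrichartz.refinedConst.toNNReal, fun f => ?_⟩
  obtain ⟨F, hF⟩ := RefinedStrichartz.exists_isExtension f
  exact ⟨F, hF, RefinedStrichartz.eLpNorm_le_refined hF⟩
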